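/- Let $\mathbb F_q$ be a finite field with algebraic closure $K$, and let $C \subset \mathbb P^2$ be a plane curve of degree $d \ge 4$ defined over $\mathbb F_q$ that is irreducible over $K$. Let $K(C)$ be its function field. A point $P \in \mathbb P^2(K)$ is called a Galois point for $C$ if the field extension $K(C)/\pi_P^*K(\mathbb P^1)$ induced by the projection $\pi_P : C \dashrightarrow \mathbb P^1$ from $P$ is Galois; let $\Delta(C) \subset \mathbb P^2(K)$ be the set of all Galois points for $C$. Let $C_{\rm sm}$ be the smooth locus of $C$, and let $B_{q+1} \subset \mathbb P^2$ be the Ballico–Hefez curve, that is, the image of the morphism $$\mathbb P^1 \to \mathbb P^2, \qquad (s:t) \mapsto (s^{q+1} : (s+t)^{q+1} : t^{q+1}).$$ Theorem. Assume that the geometric genus of $C$ (the genus of the function field $K(C)$) is $0$ or $1$. Then the two conditions $C_{\rm sm}(\mathbb F_q) \neq \emptyset$ and $\Delta(C) = \mathbb P^2(\mathbb F_q)$ hold together if and only if $C$ is projectively equivalent to $B_{q+1}$ over $\mathbb F_q$, i.e. if and only if some element of $\mathrm{GL}_3(\mathbb F_q)$ maps $C$ onto $B_{q+1}$. -/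

import Mathlib

open scoped LinearAlgebra.Projectivization WithZero

noncomputable section

/-! ### Places, Riemann-Roch spaces and the genus of a function field -/

/-- A place of the field extension `E / K`: a discrete valuation ring of `E` that contains `K`
and has field of fractions `E`. -/
structure Place (K E : Type*) [Field K] [Field E] [Algebra K E] where
  valuationRing : ValuationSubring E
  algebraMap_mem : ∀ c : K, algebraMap K E c ∈ valuationRing
  isDVR : IsDiscreteValuationRing valuationRing

namespace Place

variable {K E : Type*} [Field K] [Field E] [Algebra K E]

/-- The valuation of a place, written multiplicatively: for `x ≠ 0` its value is
`exp (-ord x)`, and its value at `0` is `0`. -/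
def valuation (P : Place K E) : Valuation E ℤᵐ⁰ :=
  haveI := P.isDVR
  (IsDiscreteValuationRing.maximalIdeal P.valuationRing).valuation E

theorem valuation_algebraMap_le_one (P : Place K E) (c : K) :
    P.valuation (algebraMap K E c) ≤ 1 :=
  haveI := P.isDVR
  (IsDiscreteValuationRing.maximalIdeal P.valuationRing).valuation_le_one
    (⟨algebraMap K E c, P.algebraMap_mem c⟩ : P.valuationRing)

end Place

/-- The Riemann-Roch space `L(D)` of a divisor `D`: all `x` with `x = 0` or
`ord_P x ≥ - D P` at every place `P`. -/
def riemannRochSpace (K E : Type*) [Field K] [Field E] [Algebra K E] (D : Place K E →₀ ℤ) :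
    Submodule K E where
  carrier := {x | ∀ P : Place K E, P.valuation x ≤ WithZero.exp (D P)}
  zero_mem' := fun P => by simp
  add_mem' := fun hx hy P => Valuation.map_add_le _ (hx P) (hy P)
  smul_mem' := fun c x hx P => by
    rw [Algebra.smul_def, map_mul]
    exact (mul_le_of_le_one_left' (P.valuation_algebraMap_le_one c)).trans (hx P)

/-- The degree of a divisor. Over an algebraically closed field of constants every place
has degree one, so the degree is the sum of the coefficients. -/
def divisorDegree {K E : Type*} [Field K] [Field E] [Algebra K E] (D : Place K E →₀ ℤ) : ℤ :=
  D.sum fun _ n => n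

/-- The genus of a function field of one variable `E` over an algebraically closed field `K`:
the maximum of `deg D + 1 - dim L(D)` over all divisors `D`. (The divisor `0` contributes `0`,
so that cutting off negative values by `toNat` does not change the maximum.) -/
def functionFieldGenus (K E : Type*) [Field K] [Field E] [Algebra K E] : ℕ∞ :=
  ⨆ D : Place K E →₀ ℤ,
    ((divisorDegree D + 1 - (Module.finrank K (riemannRochSpace K E D) : ℤ)).toNat : ℕ∞)

/-! ### Plane curves -/

/-- A plane curve of degree `d` over `F` that is irreducible over the extension field `K` of `F`
(in applications an algebraic closure of `F`), given by its homogeneous equation. -/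
structure GeomIrredPlaneCurve (F K : Type*) [Field F] [Field K] [Algebra F K] (d : ℕ) where
  poly : MvPolynomial (Fin 3) F
  isHomogeneous : poly.IsHomogeneous d
  irreducible : Irreducible (MvPolynomial.map (algebraMap F K) poly)

namespace GeomIrredPlaneCurve

variable {F K : Type*} [Field F] [Field K] [Algebra F K] {d : ℕ}

/-- The `K`-points of the curve, inside the projective plane over `K`. -/
def points (C : GeomIrredPlaneCurve F K d) : Set (ℙ K (Fin 3 → K)) :=
  {P | MvPolynomial.aeval P.rep C.poly = 0}

/-- The `F`-rational points in the smooth locus of the curve. -/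
def smoothRationalPoints (C : GeomIrredPlaneCurve F K d) : Set (ℙ F (Fin 3 → F)) :=
  {P | MvPolynomial.eval P.rep C.poly = 0 ∧
    ∃ i, MvPolynomial.eval P.rep (MvPolynomial.pderiv i C.poly) ≠ 0}

/-- The homogeneous ideal of the curve over `K`. -/
abbrev ideal (C : GeomIrredPlaneCurve F K d) : Ideal (MvPolynomial (Fin 3) K) :=
  Ideal.span {MvPolynomial.map (algebraMap F K) C.poly}

instance ideal_isPrime (C : GeomIrredPlaneCurve F K d) : C.ideal.IsPrime :=
  (Ideal.span_singleton_prime C.irreducible.ne_zero).mpr C.irreducible.prime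

/-- The homogeneous coordinate ring of the curve over `K`. -/
abbrev coordinateRing (C : GeomIrredPlaneCurve F K d) : Type _ :=
  MvPolynomial (Fin 3) K ⧸ C.ideal

/-- The quotient `a / b` of two polynomials in the fraction field of the homogeneous coordinate
ring (it is `0` if `b` vanishes on the curve). -/
def ratio (C : GeomIrredPlaneCurve F K d) (a b : MvPolynomial (Fin 3) K) :
    FractionRing C.coordinateRing :=
  algebraMap C.coordinateRing _ (Ideal.Quotient.mk C.ideal a) /
    algebraMap C.coordinateRing _ (Ideal.Quotient.mk C.ideal b)

/-- The function field `K(C)`: all quotients `a / b` of homogeneous polynomials of the same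
degree, as a subfield of the fraction field of the homogeneous coordinate ring. -/
def functionField (C : GeomIrredPlaneCurve F K d) :
    IntermediateField K (FractionRing C.coordinateRing) where
  carrier := {z | ∃ (n : ℕ) (a b : MvPolynomial (Fin 3) K),
    a.IsHomogeneous n ∧ b.IsHomogeneous n ∧ z = C.ratio a b}
  mul_mem' := by
    rintro _ _ ⟨n, a, b, ha, hb, rfl⟩ ⟨m, a', b', ha', hb', rfl⟩
    refine ⟨n + m, a * a', b * b', ha.mul ha', hb.mul hb', ?_⟩
    simp only [ratio, map_mul]
    exact div_mul_div_comm _ _ _ _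
  add_mem' := by
    rintro _ _ ⟨n, a, b, ha, hb, rfl⟩ ⟨m, a', b', ha', hb', rfl⟩
    by_cases h : algebraMap C.coordinateRing (FractionRing C.coordinateRing)
        (Ideal.Quotient.mk C.ideal b) = 0
    · exact ⟨m, a', b', ha', hb', by simp [ratio, h]⟩
    by_cases h' : algebraMap C.coordinateRing (FractionRing C.coordinateRing)
        (Ideal.Quotient.mk C.ideal b') = 0
    · exact ⟨n, a, b, ha, hb, by simp [ratio, h']⟩
    refine ⟨n + m, a * b' + b * a', b * b', (ha.mul hb').add (hb.mul ha'), hb.mul hb', ?_⟩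
    simp only [ratio, map_mul, map_add]
    exact div_add_div _ _ h h'
  algebraMap_mem' := fun c =>
    ⟨0, MvPolynomial.C c, 1, MvPolynomial.isHomogeneous_C _ _, MvPolynomial.isHomogeneous_one _ _,
      by simp only [ratio, map_one, div_one]; rfl⟩
  inv_mem' := by
    rintro _ ⟨n, a, b, ha, hb, rfl⟩
    exact ⟨n, b, a, hb, ha, by simp [ratio]⟩

/-- The geometric genus of the curve: the genus of its function field over `K`. -/
def geometricGenus (C : GeomIrredPlaneCurve F K d) : ℕ∞ :=
  functionFieldGenus K C.functionField

/-- The subfield `π_P^* K(ℙ¹)` of the function field, where `π_P` is the projection from `P`: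
it is generated over `K` by the quotients `ℓ / m` of linear forms that vanish at `P`. -/
def projectionField (C : GeomIrredPlaneCurve F K d) (P : ℙ K (Fin 3 → K)) :
    IntermediateField K C.functionField :=
  IntermediateField.adjoin K {z | ∃ ℓ m : MvPolynomial (Fin 3) K,
    ℓ.IsHomogeneous 1 ∧ m.IsHomogeneous 1 ∧
    MvPolynomial.eval P.rep ℓ = 0 ∧ MvPolynomial.eval P.rep m = 0 ∧
    (z : FractionRing C.coordinateRing) = C.ratio ℓ m}

/-- The set `Δ(C)` of Galois points: the points `P` of the plane over `K` such that the extension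
`K(C) / π_P^* K(ℙ¹)` is Galois (normal and separable). -/
def galoisPoints (C : GeomIrredPlaneCurve F K d) : Set (ℙ K (Fin 3 → K)) :=
  {P | IsGalois (C.projectionField P) C.functionField}

end GeomIrredPlaneCurve

/-- The `F`-rational points of the projective plane over `K`. -/
def rationalPlanePoints (F K : Type*) [Field F] [Field K] [Algebra F K] :
    Set (ℙ K (Fin 3 → K)) :=
  {P | ∃ (v : Fin 3 → F) (h : (fun i => algebraMap F K (v i)) ≠ 0),
    P = Projectivization.mk K (fun i => algebraMap F K (v i)) h}

/-- The (`K`-points of the) Ballico-Hefez curve `B_{q+1}`: the image of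
`(s : t) ↦ (s^(q+1) : (s+t)^(q+1) : t^(q+1))`. -/
def ballicoHefezPoints (K : Type*) [Field K] (q : ℕ) : Set (ℙ K (Fin 3 → K)) :=
  {P | ∃ (s t : K) (h : ![s ^ (q + 1), (s + t) ^ (q + 1), t ^ (q + 1)] ≠ 0),
    P = Projectivization.mk K ![s ^ (q + 1), (s + t) ^ (q + 1), t ^ (q + 1)] h}

/-- Two subsets of the projective plane over `K` are projectively equivalent over `F` if an
invertible matrix with entries in `F` carries one onto the other. -/
def ProjectivelyEquivalentOver (F : Type*) {K : Type*} [Field F] [Field K] [Algebra F K]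
    (S T : Set (ℙ K (Fin 3 → K))) : Prop :=
  ∃ A : GL (Fin 3) F,
    (fun P : ℙ K (Fin 3 → K) =>
      Matrix.GeneralLinearGroup.toLin (A.map (algebraMap F K)) • P) '' S = T

end

/-! Write L for K(C). Being a Galois point becomes a statement about L over K(z), where z is a
quotient of two independent linear forms vanishing at the point (`isGalois_projectionField_iff`).

Only if. Choose coordinates over F_q in which the given smooth point is (0:1:0) with tangent line Z
= 0, and put x = X/Z, y = Y/Z. The points (0:1:0), (1:0:0), (1:1:0) of the tangent are Galois, so L
is Galois over K(x), K(y) and K(y - x). The local ring at the smooth point is a place P, at which x,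
y, y - x have poles of orders m - 1, m, m, with m the order of contact. A Galois group permutes
transitively the places over a given one, so all poles of one of these functions have the same
order; comparing these orders shows that x and y have no pole besides P
(`mem_poleRing_of_isGalois`). Hence the tangent meets C in one point, m = d, and the Galois groups
fix P.

Genus at most one means dim L(nP) ≥ n for n ≥ 0. Suppose first that no function has a simple pole at
P as its only pole. Then there are functions u, w with poles of orders 2 and 3, tied by a
nonsingular Weierstrass equation. Subgroups of odd order in the stabilizer of P have at most three
elements, and every involution in it fixes u, which leaves room for only one involution. The groups
of y and y - x have order at least 4, so both contain it (`exists_ne_one_mem_inf`); it then fixes x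
and y, which generate L, a contradiction.

Otherwise L = K(t), and x, y, y - x are polynomials in t of degrees d - 1, d, d, each invariant
under a group of affine substitutions whose order is its degree. Comparing derivatives excludes p |
d, so y and y - x are, up to constants, d-th powers of linear polynomials. The symmetry of their
difference x forces d - 1 = p^e, and in a suitable variable s one has x = κ(s^(p^e) + s) + γ, y = κ
s^(p^e + 1) + δ (`exists_normal_form`). For this model (1:a:0) is Galois exactly when a^(p^e) = a,
and (γ:δ:1), (κ+γ:δ:1) are Galois. Since the Galois points are the rational ones, p^e = q and κ, γ,
δ lie in F_q.

If. The curve is parametrized by (t^q + t : t^(q+1) : 1) and its pencils of lines can be computed.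
Through (u+v : uv : 1) there is a line that cuts out (t - u)(t^q - u). If Frobenius permutes {u, v},
a Möbius change of t turns the projection into a Kummer or Artin-Schreier extension
(`isGalois_affine_point`). If not, some fibre contains a simple and a multiple point, which cannot
happen in a Galois extension (`not_isGalois_of_zeros`). -/

section DedekindValuations

/-! ### Valuation rings over a Dedekind domain and their centers. -/

variable {A F' L : Type*} [CommRing A] [Field F'] [Field L]
  [Algebra A F'] [IsFractionRing A F'] [Algebra F' L] [Algebra A L] [IsScalarTower A F' L]

theorem ValuationSubring.integralClosure_le (V : ValuationSubring L)
    (hV : ∀ a : A, algebraMap A L a ∈ V) : (integralClosure A L).toSubring ≤ V.toSubring := by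
  intro x hx
  obtain ⟨p, hp, hpx⟩ := (hx : IsIntegral A x)
  have hint : IsIntegral V x := by
    let g : A →+* V := (algebraMap A L).codRestrict V hV
    refine ⟨p.map g, hp.map g, ?_⟩
    rw [Polynomial.eval₂_map]
    exact hpx
  obtain ⟨y, hy⟩ := IsIntegrallyClosed.isIntegral_iff.mp hint
  rw [← hy]
  exact y.2

/-- The center of a valuation ring on the integral closure of `A` in `L`. -/
noncomputable def ValuationSubring.center (A : Type*) [CommRing A] [Algebra A L]
    (V : ValuationSubring L)
    (hV : ∀ a : A, algebraMap A L a ∈ V) : Ideal (integralClosure A L).toSubring :=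
  (IsLocalRing.maximalIdeal V).comap (Subring.inclusion (V.integralClosure_le hV))

instance ValuationSubring.center_isPrime (V : ValuationSubring L)
    (hV : ∀ a : A, algebraMap A L a ∈ V) : (V.center A hV).IsPrime :=
  Ideal.comap_isPrime _ _

theorem ValuationSubring.mem_center (V : ValuationSubring L)
    (hV : ∀ a : A, algebraMap A L a ∈ V) (b : (integralClosure A L).toSubring) :
    b ∈ V.center A hV ↔ (b : L) ∈ V.nonunits := by
  rw [V.mem_nonunits_iff_exists_mem_maximalIdeal]
  exact ⟨fun h => ⟨V.integralClosure_le hV b.2, h⟩, fun h => h.2⟩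

/-- Elements of the integral closure outside the center are units of `V`, so the fractions lie in
`V`. The order on local subrings is domination; the second half checks that a fraction which is a
unit of `V` has its numerator outside the center. -/
theorem ValuationSubring.ofPrime_center_le (V : ValuationSubring L)
    (hV : ∀ a : A, algebraMap A L a ∈ V) :
    LocalSubring.ofPrime _ (V.center A hV) ≤ V.toLocalSubring := by
  have key : ∀ x ∈ (LocalSubring.ofPrime _ (V.center A hV)).toSubring, ∃ a s :
      (integralClosure A L).toSubring, s ∉ V.center A hV ∧ x = a / s := by
    intro x hx
    obtain ⟨a, s, h⟩ := IsLocalization.exists_mk'_eq (V.center A hV).primeCompl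
      (⟨x, hx⟩ : (LocalSubring.ofPrime _ (V.center A hV)).toSubring)
    refine ⟨a, s, s.2, ?_⟩
    have h2 := IsLocalization.mk'_spec
      (LocalSubring.ofPrime _ (V.center A hV)).toSubring a s
    rw [h] at h2
    have h3 : x * (s : (integralClosure A L).toSubring) = (a : L) := congrArg Subtype.val h2
    have hs : ((s : (integralClosure A L).toSubring) : L) ≠ 0 := by
      intro h0
      apply s.2
      refine (V.mem_center hV _).mpr ?_
      rw [h0]
      exact V.nonunits.zero_mem
    rw [eq_div_iff hs, h3]
  have unit : ∀ s : (integralClosure A L).toSubring, s ∉ V.center A hV → (s : L)⁻¹ ∈ V := by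
    intro s hs
    rw [V.mem_center, V.mem_nonunits_iff_or] at hs
    push Not at hs
    exact hs.2
  have hle : (LocalSubring.ofPrime _ (V.center A hV)).toSubring ≤ V.toSubring := by
    intro x hx
    obtain ⟨a, s, hs, rfl⟩ := key x hx
    rw [div_eq_mul_inv]
    exact V.mul_mem _ _ (V.integralClosure_le hV a.2) (unit s hs)
  refine ⟨hle, ⟨?_⟩⟩
  rintro ⟨x, hx⟩ hu
  obtain ⟨a, s, hs, hxe⟩ := key x hx
  obtain ⟨⟨y, hy⟩, hxy⟩ := isUnit_iff_exists_inv.mp hu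
  have hxy' : x * y = 1 := congrArg Subtype.val hxy
  have hx0 : x ≠ 0 := left_ne_zero_of_mul_eq_one hxy'
  have hs0 : (s : L) ≠ 0 := by rintro h; rw [h] at hxe; simp at hxe; exact hx0 hxe
  have ha : a ∉ V.center A hV := by
    intro h
    rw [V.mem_center, V.mem_nonunits_iff_or] at h
    have ha0 : (a : L) ≠ 0 := by rintro h; rw [h] at hxe; simp at hxe; exact hx0 hxe
    apply h.resolve_left ha0
    have : (a : L)⁻¹ = y * (s : L)⁻¹ := by
      have : y = s / a := by
        field_simp
        rw [hxe] at hxy'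
        field_simp at hxy'
        rw [mul_comm]; exact hxy'
      rw [this]; field_simp
    rw [this]
    exact V.mul_mem _ _ hy (unit s hs)
  have hainv := IsLocalization.map_units
    (LocalSubring.ofPrime _ (V.center A hV)).toSubring (⟨a, ha⟩ : (V.center A hV).primeCompl)
  obtain ⟨⟨b, hb⟩, hab⟩ := isUnit_iff_exists_inv.mp hainv
  have hab' : (a : L) * b = 1 := congrArg Subtype.val hab
  refine isUnit_iff_exists_inv.mpr ⟨⟨s * b, ?_⟩, Subtype.ext ?_⟩
  · exact Subring.mul_mem _ (LocalSubring.le_ofPrime _ _ s.2) hb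
  · change x * (s * b) = 1
    rw [hxe, ← hab']
    field_simp

variable (F') in
-- The localization of a Dedekind domain at a nonzero prime is a discrete valuation ring, and
-- valuation rings are maximal for domination; being dominated by `V`, it is all of `V`.
theorem ValuationSubring.toLocalSubring_eq_ofPrime_center [IsDedekindDomain A] [FiniteDimensional F' L]
    [Algebra.IsSeparable F' L] (V : ValuationSubring L)
    (hV : ∀ a : A, algebraMap A L a ∈ V) (htop : V ≠ ⊤) :
    IsDiscreteValuationRing V ∧
    LocalSubring.ofPrime _ (V.center A hV) = V.toLocalSubring := by
  let B := (integralClosure A L).toSubring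
  have : IsDedekindDomain B := integralClosure.isDedekindDomain A F' L
  have : IsFractionRing B L :=
    integralClosure.isFractionRing_of_finite_extension F' L
  -- With zero center every nonzero element of the integral closure would be a unit of `V`, and `V`
  -- would be the whole field.
  have hbot : V.center A hV ≠ ⊥ := by
    intro h
    apply htop
    refine top_le_iff.mp fun x _ => ?_
    obtain ⟨a, b, hb, rfl⟩ := IsFractionRing.div_surjective B x
    rw [div_eq_mul_inv]
    refine V.mul_mem _ _ (V.integralClosure_le hV a.2) ?_
    have hb0 : b ∉ V.center A hV := by
      rw [h]
      exact nonZeroDivisors.ne_zero hb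
    rw [V.mem_center, V.mem_nonunits_iff_or] at hb0
    push Not at hb0
    exact hb0.2
  have hD := IsLocalization.AtPrime.isDiscreteValuationRing_of_dedekind_domain B hbot
    (LocalSubring.ofPrime B (V.center A hV)).toSubring
  have hle := V.ofPrime_center_le hV
  have hmax : IsMax (LocalSubring.ofPrime B (V.center A hV)) := by
    rw [LocalSubring.isMax_iff]
    have : IsFractionRing (LocalSubring.ofPrime B (V.center A hV)).toSubring L :=
      IsFractionRing.isFractionRing_of_isDomain_of_isLocalization (V.center A hV).primeCompl _ L
    refine ⟨ValuationSubring.ofSubring (LocalSubring.ofPrime B (V.center A hV)).toSubring ?_, ?_⟩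
    · intro x
      rcases ValuationRing.isInteger_or_isInteger
        (LocalSubring.ofPrime B (V.center A hV)).toSubring x with h | h
      · obtain ⟨y, hy⟩ := h; left; rw [← hy]; exact y.2
      · obtain ⟨y, hy⟩ := h; right; rw [← hy]; exact y.2
    · exact LocalSubring.toSubring_injective rfl
  have heq := hmax.eq_of_le hle
  refine ⟨?_, heq⟩
  have : (LocalSubring.ofPrime B (V.center A hV)).toSubring = V.toSubring := by rw [heq]; rfl
  let e : (LocalSubring.ofPrime B (V.center A hV)).toSubring ≃+* V := RingEquiv.subringCongr this
  exact IsDiscreteValuationRing.RingEquivClass.isDiscreteValuationRing e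

variable (F') in
theorem ValuationSubring.eq_of_center_eq [IsDedekindDomain A] [FiniteDimensional F' L]
    [Algebra.IsSeparable F' L] (V W : ValuationSubring L)
    (hV : ∀ a : A, algebraMap A L a ∈ V) (hVtop : V ≠ ⊤)
    (hW : ∀ a : A, algebraMap A L a ∈ W) (hWtop : W ≠ ⊤)
    (h : V.center A hV = W.center A hW) : V = W := by
  apply ValuationSubring.toLocalSubring_injective
  rw [← (V.toLocalSubring_eq_ofPrime_center F' hV hVtop).2,
    ← (W.toLocalSubring_eq_ofPrime_center F' hW hWtop).2]
  congr 1

end DedekindValuations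

/-! ### Transitivity of the Galois group on valuation rings. -/

section DedekindValuations

open scoped Pointwise

variable {A F' L : Type*} [CommRing A] [Field F'] [Field L]
  [Algebra A F'] [IsFractionRing A F'] [Algebra F' L] [Algebra A L] [IsScalarTower A F' L]

theorem integralClosure_isInvariant [IsDedekindDomain A] [FiniteDimensional F' L] [IsGalois F' L] :
    Algebra.IsInvariant A (integralClosure A L) (L ≃ₐ[F'] L) := by
  refine ⟨fun b hb => ?_⟩
  obtain ⟨c, hc⟩ := (IsGalois.mem_range_algebraMap_iff_fixed (F := F') (b : L)).mpr
    fun σ => congrArg Subtype.val (hb σ)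
  have hint : IsIntegral A c := by
    have h := b.2
    rw [← hc] at h
    exact (isIntegral_algebraMap_iff (algebraMap F' L).injective).mp h
  obtain ⟨a, ha⟩ := IsIntegrallyClosed.isIntegral_iff.mp hint
  refine ⟨a, Subtype.ext ?_⟩
  rw [← hc, ← ha, ← IsScalarTower.algebraMap_apply]
  rfl

/-- The Galois group permutes transitively the valuation rings with a given center. -/
theorem ValuationSubring.exists_algEquiv_of_center [IsDedekindDomain A] [FiniteDimensional F' L]
    [IsGalois F' L] (V W : ValuationSubring L)
    (hV : ∀ a : A, algebraMap A L a ∈ V) (hVtop : V ≠ ⊤)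
    (hW : ∀ a : A, algebraMap A L a ∈ W) (hWtop : W ≠ ⊤)
    (h : ∀ a : A, algebraMap A L a ∈ V.nonunits ↔ algebraMap A L a ∈ W.nonunits) :
    ∃ σ : L ≃ₐ[F'] L, ∀ x, x ∈ V ↔ σ x ∈ W := by
  have := integralClosure_isInvariant (A := A) (F' := F') (L := L)
  -- The integral closure occurs both as a subalgebra and as a subring; `f` is the identity between
  -- them.
  let f : integralClosure A L →+* (integralClosure A L).toSubring := RingHom.id _
  have hmem : ∀ (V : ValuationSubring L) (hV : ∀ a : A, algebraMap A L a ∈ V)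
      (b : integralClosure A L), b ∈ (V.center A hV).comap f ↔ (b : L) ∈ V.nonunits :=
    fun V hV b => V.mem_center hV (f b)
  obtain ⟨g, hg⟩ := Algebra.IsInvariant.exists_smul_of_under_eq A (integralClosure A L)
    (L ≃ₐ[F'] L) ((V.center A hV).comap f) ((W.center A hW).comap f) (by
      ext a
      exact ((hmem V hV _).trans (h a)).trans (hmem W hW _).symm)
  refine ⟨g, ?_⟩
  have hcom : ∀ a : A, algebraMap A L a ∈ W.comap (g : L →+* L) := by
    intro a
    rw [ValuationSubring.mem_comap]
    have : (g : L →+* L) (algebraMap A L a) = algebraMap A L a := by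
      rw [IsScalarTower.algebraMap_apply A F' L]
      exact g.commutes _
    rw [this]
    exact hW a
  have hnon : ∀ x, x ∈ (W.comap (g : L →+* L)).nonunits ↔ g x ∈ W.nonunits := by
    intro x
    rw [ValuationSubring.mem_nonunits_iff_or, ValuationSubring.mem_nonunits_iff_or,
      ValuationSubring.mem_comap, map_inv₀]
    simp
  -- `g` carries one center to the other, and a valuation ring is determined by its center.
  have key : V = W.comap (g : L →+* L) := by
    refine ValuationSubring.eq_of_center_eq F' _ _ hV hVtop hcom ?_ ?_
    · intro ht
      apply hWtop
      refine top_le_iff.mp fun x _ => ?_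
      have : g.symm x ∈ W.comap (g : L →+* L) := by rw [ht]; trivial
      simpa using (ValuationSubring.mem_comap.mp this)
    · ext b
      rw [ValuationSubring.mem_center, ValuationSubring.mem_center, hnon]
      let b' : integralClosure A L := b
      have h1 : g • b' ∈ (W.center A hW).comap f ↔ b' ∈ (V.center A hV).comap f := by
        rw [hg]
        exact Ideal.smul_mem_pointwise_smul_iff
      exact ((hmem V hV b').symm.trans h1.symm).trans (hmem W hW (g • b'))
  intro x
  conv_lhs => rw [key]
  exact ValuationSubring.mem_comap

end DedekindValuations

/-! ### Valuation rings over `K(z)`. -/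

section Simple

open IntermediateField algebraAdjoinAdjoin

variable {K L : Type*} [Field K] [Field L] [Algebra K L]

theorem isDedekindDomain_adjoin_of_transcendental {z : L} (hz : Transcendental K z) :
    IsDedekindDomain (Algebra.adjoin K {z}) := by
  have : IsPrincipalIdealRing (Algebra.adjoin K {z}) :=
    IsPrincipalIdealRing.of_surjective (Polynomial.algEquivOfTranscendental K z hz)
      (Polynomial.algEquivOfTranscendental K z hz).surjective
  infer_instance

theorem ValuationSubring.adjoin_le (V : ValuationSubring L) (hV : ∀ c : K, algebraMap K L c ∈ V)
    {z : L} (hz : z ∈ V) (a : Algebra.adjoin K {z}) : (a : L) ∈ V := by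
  have : Algebra.adjoin K {z} ≤ ({ V.toSubring with algebraMap_mem' := hV } : Subalgebra K L) :=
    Algebra.adjoin_le (by simpa using hz)
  exact this a.2

/-- Either `z` or `z⁻¹` lies in `V`, so `K[z]` or `K[z⁻¹]` is a Dedekind domain inside `V` with
fraction field `K(z)`. -/
theorem ValuationSubring.isDVR_of_isGalois {z : L} (hz : Transcendental K z)
    [FiniteDimensional K⟮z⟯ L] [IsGalois K⟮z⟯ L] (V : ValuationSubring L)
    (hV : ∀ c : K, algebraMap K L c ∈ V) (htop : V ≠ ⊤) : IsDiscreteValuationRing V := by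
  rcases V.2 z with h | h
  · have := isDedekindDomain_adjoin_of_transcendental hz
    exact (V.toLocalSubring_eq_ofPrime_center (A := Algebra.adjoin K {z}) K⟮z⟯
      (fun a => V.adjoin_le hV h a) htop).1
  · have hz' : Transcendental K z⁻¹ := fun h => hz (by simpa using h.inv)
    have e : K⟮z⁻¹⟯ = K⟮z⟯ := by
      apply le_antisymm
      · rw [adjoin_simple_le_iff]; exact inv_mem (mem_adjoin_simple_self K z)
      · rw [adjoin_simple_le_iff]; simpa using inv_mem (mem_adjoin_simple_self K z⁻¹)
    have : FiniteDimensional K⟮z⁻¹⟯ L := by rw [e]; infer_instance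
    have : IsGalois K⟮z⁻¹⟯ L := by rw [e]; infer_instance
    have := isDedekindDomain_adjoin_of_transcendental hz'
    exact (V.toLocalSubring_eq_ofPrime_center (A := Algebra.adjoin K {z⁻¹}) K⟮z⁻¹⟯
      (fun a => V.adjoin_le hV h a) htop).1

/-- Both rings have center `(z)` on `K[z]`, so the zeros of `z` are conjugate over `K(z)`. -/
theorem ValuationSubring.exists_algEquiv_of_nonunits {z : L} (hz : Transcendental K z)
    [FiniteDimensional K⟮z⟯ L] [IsGalois K⟮z⟯ L] (V W : ValuationSubring L)
    (hV : ∀ c : K, algebraMap K L c ∈ V) (hW : ∀ c : K, algebraMap K L c ∈ W)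
    (hzV : z ∈ V.nonunits) (hzW : z ∈ W.nonunits) :
    ∃ σ : L ≃ₐ[K] L, σ z = z ∧ ∀ x, x ∈ V ↔ σ x ∈ W := by
  have := isDedekindDomain_adjoin_of_transcendental hz
  have hz0 : z ≠ 0 := fun h => hz (h ▸ isAlgebraic_zero)
  have htop : ∀ V : ValuationSubring L, z ∈ V.nonunits → V ≠ ⊤ := by
    rintro V h rfl
    exact ((ValuationSubring.mem_nonunits_iff_or _).mp h).resolve_left hz0 trivial
  -- In `p(z) = z * r(z) + p(0)` the first summand is a nonunit, so `p(z)` is a nonunit exactly when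
  -- `p(0) = 0`.
  have hdec : ∀ (V : ValuationSubring L), (∀ c : K, algebraMap K L c ∈ V) → z ∈ V.nonunits →
      ∀ a : Algebra.adjoin K {z}, (a : L) ∈ V.nonunits ↔
        ((Polynomial.algEquivOfTranscendental K z hz).symm a).coeff 0 = 0 := by
    intro V hV hzV a
    obtain ⟨p, rfl⟩ := (Polynomial.algEquivOfTranscendental K z hz).surjective a
    rw [AlgEquiv.symm_apply_apply]
    have hp : ((Polynomial.algEquivOfTranscendental K z hz p : Algebra.adjoin K {z}) : L) =
        z * Polynomial.aeval z p.divX + algebraMap K L (p.coeff 0) := by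
      have : ((Polynomial.algEquivOfTranscendental K z hz p : Algebra.adjoin K {z}) : L) =
        Polynomial.aeval z p := by simp
      rw [this]
      exact (congrArg (Polynomial.aeval z) (Polynomial.X_mul_divX_add p)).symm.trans
        (by rw [map_add, map_mul, Polynomial.aeval_X, Polynomial.aeval_C])
    have hzp : z * Polynomial.aeval z p.divX ∈ V.nonunits := by
      have h1 : Polynomial.aeval z p.divX ∈ V :=
        V.adjoin_le hV (V.nonunits_le hzV) ⟨_, Polynomial.aeval_mem_adjoin_singleton K z⟩
      rw [ValuationSubring.mem_nonunits_iff] at hzV ⊢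
      rw [map_mul]
      exact mul_lt_one_of_lt_of_le hzV ((V.valuation_le_one_iff _).mpr h1)
    rw [hp]
    constructor
    · intro h
      by_contra hc
      have h2 := V.nonunits.sub_mem h hzp
      rw [add_sub_cancel_left, ValuationSubring.mem_nonunits_iff_or, ← map_inv₀] at h2
      exact h2.elim (fun h => hc (by simpa using h)) (fun h => h (hV _))
    · intro h
      rw [h, map_zero, add_zero]
      exact hzp
  obtain ⟨σ, hσ⟩ := ValuationSubring.exists_algEquiv_of_center (A := Algebra.adjoin K {z})
    (F' := K⟮z⟯) V W (fun a => V.adjoin_le hV (V.nonunits_le hzV) a) (htop V hzV)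
    (fun a => W.adjoin_le hW (W.nonunits_le hzW) a) (htop W hzW)
    (fun a => (hdec V hV hzV a).trans (hdec W hW hzW a).symm)
  exact ⟨σ.restrictScalars K, σ.commutes (AdjoinSimple.gen K z), hσ⟩

/-- Every subring with a proper ideal is contained in a valuation ring centered on it, and
a transcendental element vanishes at some place. -/
theorem exists_valuationSubring_nonunit {z : L} (hz : Transcendental K z) :
    ∃ V : ValuationSubring L, (∀ c : K, algebraMap K L c ∈ V) ∧ z ∈ V.nonunits := by
  let A := (Algebra.adjoin K {z}).toSubring
  let zA : A := ⟨z, Algebra.self_mem_adjoin_singleton K z⟩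
  have hI : Ideal.span {zA} ≠ ⊤ := by
    rw [Ne, Ideal.span_singleton_eq_top]
    intro hu
    obtain ⟨⟨b, hb⟩, hzb⟩ := isUnit_iff_exists_inv.mp hu
    have hzb' : z * b = 1 := congrArg Subtype.val hzb
    obtain ⟨p, rfl⟩ := (show b ∈ (Polynomial.aeval z).range from
      Algebra.adjoin_singleton_eq_range_aeval K z ▸ (show b ∈ Algebra.adjoin K {z} from hb))
    have h0 : Polynomial.aeval z (Polynomial.X * p - 1) = 0 := by
      simpa [sub_eq_zero] using hzb'
    have h1 := (transcendental_iff.mp hz) _ h0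
    have h2 := congrArg (fun p => p.coeff 0) h1
    simp at h2
  obtain ⟨V, hAV, hIV⟩ := Ideal.image_subset_nonunits_valuationSubring _ hI
  exact ⟨V, fun c => hAV (Subalgebra.algebraMap_mem _ c),
    hIV ⟨zA, Ideal.mem_span_singleton_self _, rfl⟩⟩

end Simple

/-! ### Galois criteria for subfields of a rational function field. -/

section RationalFields

open IntermediateField

variable {K L : Type*} [Field K] [Field L] [Algebra K L]

theorem mem_range_algebraMap_of_isAlgebraic [IsAlgClosed K] {z : L} (hz : IsAlgebraic K z) :
    ∃ c : K, algebraMap K L c = z :=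
  minpoly.mem_range_of_degree_eq_one K z
    (IsAlgClosed.degree_eq_one_of_irreducible K (minpoly.irreducible hz.isIntegral))

theorem finiteDimensional_of_adjoin_eq_top {S : Set L} (hS : S.Finite) (htop : adjoin K S = ⊤)
    (F' : IntermediateField K L) [Algebra.IsAlgebraic F' L] : FiniteDimensional F' L := by
  have := hS.to_subtype
  have h := finiteDimensional_adjoin (K := F') (S := S)
    fun x _ => (Algebra.IsAlgebraic.isAlgebraic x).isIntegral
  have h2 : adjoin F' S = ⊤ := by
    refine restrictScalars_injective K ?_
    refine top_le_iff.mp ?_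
    change (⊤ : IntermediateField K L) ≤ _
    rw [← htop, adjoin_le_iff]
    exact subset_adjoin F' S
  rw [h2] at h
  exact Module.Finite.equiv (topEquiv (F := F') (E := L)).toLinearEquiv

theorem isGalois_of_adjoin_root {F' : IntermediateField K L} {s : L} (hs : K⟮s⟯ = ⊤)
    (P : Polynomial F') (hsep : P.Separable) (hroot : Polynomial.aeval s P = 0)
    (hsplit : (P.map (algebraMap F' L)).Splits) : IsGalois F' L := by
  have hP0 : P ≠ 0 := hsep.ne_zero
  have htop : adjoin F' (P.rootSet L) = ⊤ := by
    refine restrictScalars_injective K (top_le_iff.mp ?_)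
    change (⊤ : IntermediateField K L) ≤ _
    rw [← hs, adjoin_simple_le_iff]
    exact subset_adjoin F' _ (by rw [Polynomial.mem_rootSet]; exact ⟨hP0, hroot⟩)
  have halg : ∀ x ∈ P.rootSet L, IsAlgebraic F' x := fun x hx =>
    ⟨P, hP0, (Polynomial.mem_rootSet.mp hx).2⟩
  have : P.IsSplittingField F' L := by
    refine ⟨hsplit, ?_⟩
    rw [← adjoin_toSubalgebra_of_isAlgebraic halg, htop]
    rfl
  exact IsGalois.of_separable_splitting_field hsep

/-- Kummer: `X ^ n - s ^ n` is `s ^ n` times `X ^ n - 1` evaluated at `X / s`, so its roots are the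
multiples of `s` by roots of unity. -/
theorem isGalois_adjoin_pow [IsAlgClosed K] {s : L} (hs : K⟮s⟯ = ⊤) (hs0 : s ≠ 0) {n : ℕ}
    (hn : (n : K) ≠ 0) : IsGalois K⟮s ^ n⟯ L := by
  refine isGalois_of_adjoin_root hs (Polynomial.X ^ n - Polynomial.C (AdjoinSimple.gen K (s ^ n)))
    (Polynomial.separable_X_pow_sub_C _ ?_ ?_) (by simp) ?_
  · intro h
    apply hn
    apply (algebraMap K K⟮s ^ n⟯).injective
    simpa using h
  · intro h
    have := congrArg Subtype.val h
    simp [hs0] at this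
  · have h1 : ((Polynomial.X ^ n - 1 : Polynomial K).map (algebraMap K L)).Splits :=
      (IsAlgClosed.splits _).map _
    have h2 := h1.comp_of_natDegree_le_one (g := Polynomial.C s⁻¹ * Polynomial.X)
      (by compute_degree)
    have h3 := (Polynomial.Splits.C (s ^ n)).mul h2
    convert h3 using 1
    simp only [Polynomial.map_sub, Polynomial.map_pow, Polynomial.map_X, Polynomial.map_C,
      Polynomial.map_one, Polynomial.sub_comp, Polynomial.pow_comp, Polynomial.X_comp,
      Polynomial.one_comp, mul_sub, mul_one, mul_pow, ← Polynomial.C_pow, ← mul_assoc,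
      ← Polynomial.C_mul]
    rw [← mul_pow, mul_inv_cancel₀ hs0]
    simp

/-- Artin-Schreier: `X ^ p ^ f + X` is additive with derivative `1`, and the polynomial of `s` is
its translate by `s`. -/
theorem isGalois_adjoin_frobenius_add [IsAlgClosed K] (p f : ℕ) [Fact p.Prime] [CharP K p]
    (hf : f ≠ 0) {s : L} (hs : K⟮s⟯ = ⊤) : IsGalois K⟮s ^ p ^ f + s⟯ L := by
  have : CharP L p := charP_of_injective_algebraMap (algebraMap K L).injective p
  have : CharP K⟮s ^ p ^ f + s⟯ p := charP_of_injective_algebraMap (algebraMap K _).injective p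
  refine isGalois_of_adjoin_root hs (Polynomial.X ^ p ^ f + Polynomial.X -
    Polynomial.C (AdjoinSimple.gen K (s ^ p ^ f + s))) ?_ (by simp) ?_
  · rw [Polynomial.separable_def]
    have : Polynomial.derivative (Polynomial.X ^ p ^ f + Polynomial.X -
        Polynomial.C (AdjoinSimple.gen K (s ^ p ^ f + s))) = 1 := by
      rw [Polynomial.derivative_sub, Polynomial.derivative_add, Polynomial.derivative_X_pow,
        Nat.cast_pow, CharP.cast_eq_zero, zero_pow hf]
      simp
    rw [this]
    exact isCoprime_one_right
  · have h1 : ((Polynomial.X ^ p ^ f + Polynomial.X : Polynomial K).map (algebraMap K L)).Splits :=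
      (IsAlgClosed.splits _).map _
    have h2 := h1.comp_X_sub_C s
    have heq : (Polynomial.X ^ p ^ f + Polynomial.X -
        Polynomial.C (AdjoinSimple.gen K (s ^ p ^ f + s))).map (algebraMap K⟮s ^ p ^ f + s⟯ L) =
        ((Polynomial.X ^ p ^ f + Polynomial.X : Polynomial K).map (algebraMap K L)).comp
          (Polynomial.X - Polynomial.C s) := by
      simp only [Polynomial.map_sub, Polynomial.map_add, Polynomial.map_pow, Polynomial.map_X,
        Polynomial.map_C, Polynomial.add_comp, Polynomial.pow_comp, Polynomial.X_comp,
        sub_pow_char_pow]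
      have : algebraMap K⟮s ^ p ^ f + s⟯ L (AdjoinSimple.gen K (s ^ p ^ f + s)) =
        s ^ p ^ f + s := rfl
      rw [this, Polynomial.C_add, Polynomial.C_pow]
      ring
    rw [heq]
    exact h2

/-- A change of basis in a pencil of lines does not change the field of the projection. Keeping
numerator and denominator apart allows a convenient member of the pencil to be put in either place.
-/
theorem adjoin_mobius {a b c d : K} (hdet : a * d - b * c ≠ 0) {z w : L} (hw : w ≠ 0)
    (hden : algebraMap K L c * z + algebraMap K L d * w ≠ 0) :
    K⟮(algebraMap K L a * z + algebraMap K L b * w) /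
      (algebraMap K L c * z + algebraMap K L d * w)⟯ = K⟮z / w⟯ := by
  apply le_antisymm
  · rw [adjoin_simple_le_iff]
    have : (algebraMap K L a * z + algebraMap K L b * w) /
      (algebraMap K L c * z + algebraMap K L d * w) =
      (algebraMap K L a * (z / w) + algebraMap K L b) /
      (algebraMap K L c * (z / w) + algebraMap K L d) := by
      rw [← mul_div_mul_right _ (algebraMap K L c * (z / w) + algebraMap K L d) hw]
      congr 1 <;> field_simp
    rw [this]
    have hz := mem_adjoin_simple_self K (z / w)
    exact div_mem (add_mem (mul_mem (IntermediateField.algebraMap_mem _ _) hz) (IntermediateField.algebraMap_mem _ _))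
      (add_mem (mul_mem (IntermediateField.algebraMap_mem _ _) hz) (IntermediateField.algebraMap_mem _ _))
  · rw [adjoin_simple_le_iff]
    set y := (algebraMap K L a * z + algebraMap K L b * w) /
      (algebraMap K L c * z + algebraMap K L d * w) with hy
    have hdet' : algebraMap K L a * algebraMap K L d - algebraMap K L b * algebraMap K L c ≠ 0 := by
      rw [← map_mul, ← map_mul, ← map_sub]
      exact (map_ne_zero _).mpr hdet
    have hyD : y * (algebraMap K L c * z + algebraMap K L d * w) =
        algebraMap K L a * z + algebraMap K L b * w := div_mul_cancel₀ _ hden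
    have hden2 : algebraMap K L a - algebraMap K L c * y ≠ 0 := by
      intro h
      apply hdet'
      have : (algebraMap K L a * algebraMap K L d - algebraMap K L b * algebraMap K L c) * w = 0 := by
        linear_combination (algebraMap K L c * z + algebraMap K L d * w) * h +
          algebraMap K L c * hyD
      exact (mul_eq_zero.mp this).resolve_right hw
    have : z / w = (algebraMap K L d * y - algebraMap K L b) /
        (algebraMap K L a - algebraMap K L c * y) := by
      rw [div_eq_div_iff hw hden2]
      linear_combination -hyD
    rw [this]
    have hz := mem_adjoin_simple_self K y
    exact div_mem (sub_mem (mul_mem (IntermediateField.algebraMap_mem _ _) hz) (IntermediateField.algebraMap_mem _ _))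
      (sub_mem (IntermediateField.algebraMap_mem _ _) (mul_mem (IntermediateField.algebraMap_mem _ _) hz))

theorem ValuationSubring.valuation_algebraMap (V : ValuationSubring L)
    (hV : ∀ c : K, algebraMap K L c ∈ V) {c : K} (hc : c ≠ 0) :
    V.valuation (algebraMap K L c) = 1 := by
  refine le_antisymm ((V.valuation_le_one_iff _).mpr (hV c)) ?_
  have h := (V.valuation_le_one_iff _).mpr (hV c⁻¹)
  rw [map_inv₀, map_inv₀, inv_le_one₀] at h
  · exact h
  · rw [zero_lt_iff]; simpa using hc

theorem ValuationSubring.valuation_aeval (V : ValuationSubring L)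
    (hV : ∀ c : K, algebraMap K L c ∈ V) {t : L} {b : K}
    (ht : t - algebraMap K L b ∈ V.nonunits) {g : Polynomial K} (hg : g.eval b ≠ 0) :
    V.valuation (Polynomial.aeval t g) = 1 := by
  obtain ⟨h, hh⟩ := Polynomial.X_sub_C_dvd_sub_C_eval (p := g) (a := b)
  have hg' : Polynomial.aeval t g =
      (t - algebraMap K L b) * Polynomial.aeval t h + algebraMap K L (g.eval b) := by
    rw [sub_eq_iff_eq_add] at hh
    conv_lhs => rw [hh]
    simp
  have htV : t ∈ V := by
    have := V.add_mem _ _ (V.nonunits_le ht) (hV b)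
    simpa using this
  have h1 : V.valuation ((t - algebraMap K L b) * Polynomial.aeval t h) < 1 := by
    rw [map_mul]
    exact mul_lt_one_of_lt_of_le (V.mem_nonunits_iff.mp ht) ((V.valuation_le_one_iff _).mpr
      (V.adjoin_le hV htV ⟨_, Polynomial.aeval_mem_adjoin_singleton K t⟩))
  rw [hg', V.valuation.map_add_eq_of_lt_right, V.valuation_algebraMap hV hg]
  rwa [V.valuation_algebraMap hV hg]

theorem ValuationSubring.valuation_eq_zpow (V : ValuationSubring L)
    (hV : ∀ c : K, algebraMap K L c ∈ V) {t : L} (htop : K⟮t⟯ = ⊤) {b : K}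
    (ht : t - algebraMap K L b ∈ V.nonunits) {x : L} (hx : x ≠ 0) :
    ∃ j : ℤ, V.valuation x = V.valuation (t - algebraMap K L b) ^ j := by
  have hpoly : ∀ g : Polynomial K, Polynomial.aeval t g ≠ 0 → ∃ j : ℕ,
      V.valuation (Polynomial.aeval t g) = V.valuation (t - algebraMap K L b) ^ j := by
    intro g hg
    have hg0 : g ≠ 0 := by rintro rfl; simp at hg
    obtain ⟨h, hh, hnd⟩ := Polynomial.exists_eq_pow_rootMultiplicity_mul_and_not_dvd g hg0 b
    refine ⟨g.rootMultiplicity b, ?_⟩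
    conv_lhs => rw [hh]
    rw [map_mul, map_mul, V.valuation_aeval hV ht (g := h) (by
      rwa [Polynomial.dvd_iff_isRoot] at hnd)]
    simp
  obtain ⟨p, q, rfl⟩ := (mem_adjoin_simple_iff K x).mp (by rw [htop]; trivial)
  obtain ⟨hp, hq⟩ := div_ne_zero_iff.mp hx
  obtain ⟨i, hi⟩ := hpoly p hp
  obtain ⟨j, hj⟩ := hpoly q hq
  have h0 : V.valuation (t - algebraMap K L b) ≠ 0 ∨ V.valuation (t - algebraMap K L b) = 0 :=
    (em _).symm
  rcases h0 with h0 | h0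
  · exact ⟨i - j, by rw [map_div₀, hi, hj, zpow_sub₀ h0]; simp⟩
  · rw [h0] at hi hj
    have hi0 : i = 0 := by
      by_contra h
      rw [zero_pow h] at hi
      exact hp ((map_eq_zero _).mp hi)
    have hj0 : j = 0 := by
      by_contra h
      rw [zero_pow h] at hj
      exact hq ((map_eq_zero _).mp hj)
    exact ⟨0, by rw [map_div₀, hi, hj, hi0, hj0]; simp⟩

/-- A rational function with a simple zero and a multiple zero does not generate a subfield
over which the rational function field is Galois. -/
theorem not_isGalois_of_zeros [IsAlgClosed K] {t : L} (ht : Transcendental K t)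
    (htop : K⟮t⟯ = ⊤) {P Q P₁ P₂ : Polynomial K} {a b : K} {e : ℕ} (he : 2 ≤ e)
    (hPa : P = (Polynomial.X - Polynomial.C a) ^ e * P₁) (hP₁ : P₁.eval a ≠ 0)
    (hQa : Q.eval a ≠ 0)
    (hPb : P = (Polynomial.X - Polynomial.C b) * P₂) (hP₂ : P₂.eval b ≠ 0) (hQb : Q.eval b ≠ 0) :
    ¬ IsGalois K⟮Polynomial.aeval t P / Polynomial.aeval t Q⟯ L := by
  intro hG
  set z := Polynomial.aeval t P / Polynomial.aeval t Q with hz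
  have hfin : FiniteDimensional K⟮z⟯ L :=
    finiteDimensional_of_adjoin_eq_top (Set.finite_singleton t) htop _
  have htr : ∀ c : K, Transcendental K (t - algebraMap K L c) := by
    intro c h
    apply ht
    have := h.add (isAlgebraic_algebraMap c)
    simpa using this
  obtain ⟨V, hV, hVa⟩ := exists_valuationSubring_nonunit (htr a)
  obtain ⟨W, hW, hWb⟩ := exists_valuationSubring_nonunit (htr b)
  have hzV : V.valuation z = V.valuation (t - algebraMap K L a) ^ e := by
    rw [hz, map_div₀, V.valuation_aeval hV hVa hQa, hPa, map_mul, map_mul,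
      V.valuation_aeval hV hVa hP₁]
    simp
  have hzW : W.valuation z = W.valuation (t - algebraMap K L b) := by
    rw [hz, map_div₀, W.valuation_aeval hW hWb hQb, hPb, map_mul, map_mul,
      W.valuation_aeval hW hWb hP₂]
    simp
  have hb0 : W.valuation (t - algebraMap K L b) ≠ 0 := by
    intro h
    apply htr b
    rw [(map_eq_zero _).mp h]
    exact isAlgebraic_zero
  have hb1 := W.mem_nonunits_iff.mp hWb
  have hztr : Transcendental K z := by
    intro h
    obtain ⟨c, hc⟩ := mem_range_algebraMap_of_isAlgebraic h
    rw [← hc] at hzW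
    by_cases hc0 : c = 0
    · rw [hc0] at hzW
      exact hb0 (by rw [← hzW]; simp)
    · rw [W.valuation_algebraMap hW hc0] at hzW
      exact hb1.ne hzW.symm
  obtain ⟨σ, hσz, hσ⟩ := V.exists_algEquiv_of_nonunits hztr W hV hW
    (by rw [V.mem_nonunits_iff, hzV]; exact pow_lt_one' (V.mem_nonunits_iff.mp hVa) (by lia))
    (by rw [W.mem_nonunits_iff, hzW]; exact hb1)
  have hunit : ∀ x, V.valuation x = 1 → W.valuation (σ x) = 1 := by
    intro x hx
    have hx0 : x ≠ 0 := by rintro rfl; simp at hx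
    apply le_antisymm
    · rw [W.valuation_le_one_iff, ← hσ, ← V.valuation_le_one_iff, hx]
    · have : W.valuation (σ x⁻¹) ≤ 1 := by
        rw [W.valuation_le_one_iff, ← hσ, ← V.valuation_le_one_iff, map_inv₀, hx, inv_one]
      rw [map_inv₀, map_inv₀, inv_le_one₀] at this
      · exact this
      · rw [zero_lt_iff]; simpa using hx0
  have hta0 : t - algebraMap K L a ≠ 0 := fun h => htr a (h ▸ isAlgebraic_zero)
  have hlt : W.valuation (σ (t - algebraMap K L a)) < 1 := by
    rw [← W.mem_nonunits_iff, W.mem_nonunits_iff_or, ← map_inv₀, ← hσ]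
    right
    exact ((V.mem_nonunits_iff_or).mp hVa).resolve_left hta0
  -- Ramification indices over `z = 0` must agree: `σ` carries `V` to `W`, so the value of `z` at
  -- `W` is that of `t - b`, and also the `e`-th power of a power of it. Hence `e` divides `1`.
  obtain ⟨j, hj⟩ := W.valuation_eq_zpow hW htop hWb (x := σ (t - algebraMap K L a))
    ((map_ne_zero σ).mpr hta0)
  have h1 : W.valuation z = W.valuation (σ (t - algebraMap K L a)) ^ e := by
    conv_lhs => rw [← hσz]
    have h2 : z = (t - algebraMap K L a) ^ e * (z / (t - algebraMap K L a) ^ e) := by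
      rw [mul_div_cancel₀ _ (pow_ne_zero _ hta0)]
    have h3 : V.valuation (z / (t - algebraMap K L a) ^ e) = 1 := by
      rw [map_div₀, hzV, map_pow, div_self]
      simpa using fun h => absurd h hta0
    rw [h2, map_mul, map_mul, hunit _ h3, map_pow, map_pow, mul_one]
  rw [hzW, hj, ← zpow_natCast, ← zpow_mul] at h1
  have hinj := zpow_right_injective₀ (zero_lt_iff.mpr hb0) hb1.ne
  have h2 : (1 : ℤ) = j * e := hinj (by simpa using h1)
  have h3 : (e : ℤ) ∣ 1 := ⟨j, by rw [h2]; ring⟩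
  have := Int.eq_one_of_dvd_one (by positivity) h3
  lia

end RationalFields

/-! ### Projections of the curve `(t ^ q + t : t ^ (q + 1) : 1)`, where `q = p ^ f`. -/

section BallicoHefezProjections

open IntermediateField Polynomial

variable {K L : Type*} [Field K] [Field L] [Algebra K L]

theorem aeval_ne_zero_of_transcendental {t : L} (ht : Transcendental K t) {P : K[X]}
    (hP : P ≠ 0) : aeval t P ≠ 0 :=
  fun h => hP (transcendental_iff.mp ht P h)

theorem sub_algebraMap_ne_zero {t : L} (ht : Transcendental K t) (c : K) :
    t - algebraMap K L c ≠ 0 := by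
  simpa using aeval_ne_zero_of_transcendental ht (X_sub_C_ne_zero c)

theorem adjoin_affine {a b : K} (ha : a ≠ 0) (z : L) :
    K⟮algebraMap K L a * z + algebraMap K L b⟯ = K⟮z⟯ := by
  have := adjoin_mobius (K := K) (a := a) (b := b) (c := 0) (d := 1) (by simpa using ha) (z := z)
    (one_ne_zero (α := L)) (by simp)
  simpa using this

theorem adjoin_div_affine {a b : K} (ha : a ≠ 0) (z w : L) (hw : w ≠ 0) :
    K⟮(algebraMap K L a * z + algebraMap K L b * w) / w⟯ = K⟮z / w⟯ := by
  have := adjoin_mobius (K := K) (a := a) (b := b) (c := 0) (d := 1) (by simpa using ha) (z := z)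
    hw (by simpa using hw)
  simpa using this

theorem isGalois_adjoin_congr {z w : L} (h : z = w) : IsGalois K⟮z⟯ L ↔ IsGalois K⟮w⟯ L := by
  rw [h]

variable [IsAlgClosed K] (p f : ℕ) [hp : Fact p.Prime] [CharP K p]

/-- When Frobenius fixes `a`, the generator is `(t - a) ^ (q + 1) - a ^ 2`; this is Kummer, as `q +
1 = 1` in `K`. -/
theorem isGalois_outer_line (hf : f ≠ 0) {t : L} (ht : Transcendental K t) (htop : K⟮t⟯ = ⊤)
    {a : K} (ha : a ^ p ^ f = a) :
    IsGalois K⟮t ^ (p ^ f + 1) - algebraMap K L a * (t ^ p ^ f + t)⟯ L := by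
  have : CharP L p := charP_of_injective_algebraMap (algebraMap K L).injective p
  have htop' : K⟮t - algebraMap K L a⟯ = ⊤ := by
    rw [← htop, ← adjoin_affine (a := 1) (b := -a) one_ne_zero t]
    congr 2
    simp [sub_eq_add_neg]
  have h := isGalois_adjoin_pow htop' (sub_algebraMap_ne_zero ht a) (n := p ^ f + 1)
    (by simp [zero_pow hf])
  rw [← adjoin_affine (a := 1) (b := - a ^ 2) one_ne_zero] at h
  refine (isGalois_adjoin_congr ?_).mpr h
  rw [pow_succ (t - algebraMap K L a), sub_pow_char_pow, ← map_pow, ha]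
  simp
  ring_nf

/-- Let `u`, `v` have sum `S` and product `N`. Numerator minus `u` times denominator is `(t - u) *
(t ^ q - u)`, likewise for `v`. If Frobenius fixes `u` and `v`, the variable `s = 1 / (t - u)` gives
the generator `(u - v) * s ^ (q + 1) + s ^ q + s`, which is Artin-Schreier or a case of
`isGalois_outer_line`. If Frobenius swaps them, the quotient of the two members is the `(q - 1)`-st
power of `(t - v) / (t - u)`, a Kummer generator. -/
theorem isGalois_affine_point (hf : f ≠ 0) {t : L} (ht : Transcendental K t) (htop : K⟮t⟯ = ⊤)
    {S N : K} (hS : S ^ p ^ f = S) (hN : N ^ p ^ f = N) :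
    IsGalois K⟮(t ^ (p ^ f + 1) - algebraMap K L N) / (t ^ p ^ f + t - algebraMap K L S)⟯ L := by
  have : CharP L p := charP_of_injective_algebraMap (algebraMap K L).injective p
  obtain ⟨u, hu⟩ := IsAlgClosed.exists_root (X ^ 2 - C S * X + C N : K[X])
    (by rw [show (X ^ 2 - C S * X + C N : K[X]).degree = 2 by compute_degree!]; decide)
  have hu' : u ^ 2 - S * u + N = 0 := by simpa using hu
  obtain ⟨v, rfl⟩ : ∃ v, S = u + v := ⟨S - u, by ring⟩
  obtain rfl : N = u * v := by linear_combination hu'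
  have hw0 : t ^ p ^ f + t - algebraMap K L (u + v) ≠ 0 := by
    have hP : (X ^ p ^ f + X - C (u + v) : K[X]) ≠ 0 := by
      intro h
      have h2 := congrArg derivative h
      rw [derivative_sub, derivative_add, derivative_X_pow, Nat.cast_pow, CharP.cast_eq_zero,
        zero_pow hf] at h2
      simp at h2
    simpa using aeval_ne_zero_of_transcendental ht hP
  have htu := sub_algebraMap_ne_zero ht u
  have htv := sub_algebraMap_ne_zero ht v
  -- Frobenius fixes the coefficients of `X ^ 2 - S * X + N`, so `u ^ q` is again one of its roots
  -- `u`, `v`.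
  have hroot : (u ^ p ^ f - u) * (u ^ p ^ f - v) = 0 := by
    have h := congrArg (· ^ p ^ f) hu'
    simp only [add_pow_char_pow, sub_pow_char_pow, mul_pow, hS] at h
    rw [← mul_pow, hN, zero_pow (pow_ne_zero _ hp.out.ne_zero)] at h
    linear_combination h
  by_cases huu : u ^ p ^ f = u
  · have hvv : v ^ p ^ f = v := by
      rw [add_pow_char_pow, huu] at hS
      exact add_left_cancel hS
    set s := (t - algebraMap K L u)⁻¹ with hs
    have hsgen : K⟮s⟯ = ⊤ := by
      have := adjoin_mobius (K := K) (a := 0) (b := 1) (c := 1) (d := -u) (by simp) (z := t)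
        (one_ne_zero (α := L)) (by simpa [← sub_eq_add_neg] using htu)
      rw [← htop]
      simpa [hs, ← sub_eq_add_neg] using this
    have hs0 : s ≠ 0 := inv_ne_zero htu
    have ht' : t = algebraMap K L u + s⁻¹ := by rw [hs, inv_inv]; ring
    have htq : t ^ p ^ f = algebraMap K L u + (s ^ p ^ f)⁻¹ := by
      rw [ht', add_pow_char_pow, ← map_pow, huu, inv_pow]
    have hfield : K⟮(t ^ (p ^ f + 1) - algebraMap K L (u * v)) /
        (t ^ p ^ f + t - algebraMap K L (u + v))⟯ =
        K⟮algebraMap K L (u - v) * s ^ (p ^ f + 1) + (s ^ p ^ f + s)⟯ := by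
      have hden : algebraMap K L 1 * (t ^ (p ^ f + 1) - algebraMap K L (u * v)) +
          algebraMap K L (-u) * (t ^ p ^ f + t - algebraMap K L (u + v)) =
          (s ^ (p ^ f + 1))⁻¹ := by
        rw [pow_succ t, htq, ht', pow_succ, mul_inv]
        simp
        ring
      rw [← adjoin_mobius (K := K) (a := 0) (b := 1) (c := 1) (d := -u) (by simp) hw0
        (by rw [hden]; exact inv_ne_zero (pow_ne_zero _ hs0)), hden, htq, ht']
      congr 2
      simp [pow_succ]
      field_simp
      ring
    rw [hfield]
    by_cases hc : u - v = 0
    · rw [hc, map_zero, zero_mul, zero_add]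
      exact isGalois_adjoin_frobenius_add p f hf hsgen
    · have hstr : Transcendental K s := by
        intro h
        have h2 := h.inv.add (isAlgebraic_algebraMap u)
        rw [add_comm, ← ht'] at h2
        exact ht h2
      have h := isGalois_outer_line p f hf hstr hsgen (a := -(u - v)⁻¹) (by
        rw [neg_pow, inv_pow, sub_pow_char_pow, huu, hvv]
        rcases neg_one_pow_eq_or K (p ^ f) with h | h
        · have : (1 : K) ^ p ^ f = 1 := one_pow _
          have h3 : (-1 : K) ^ p ^ f = -1 := by
            have := sub_pow_char_pow (R := K) (p := p) (n := f) 0 1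
            simpa [zero_pow (pow_ne_zero f hp.out.ne_zero)] using this
          rw [h3]; ring
        · rw [h]; ring)
      rw [← adjoin_affine (a := u - v) (b := 0) hc] at h
      refine (isGalois_adjoin_congr ?_).mpr h
      have hc' : algebraMap K L u - algebraMap K L v ≠ 0 := by
        rw [← map_sub]; exact (_root_.map_ne_zero _).mpr hc
      simp
      field_simp
  · have huv : u ^ p ^ f = v :=
      sub_eq_zero.mp ((mul_eq_zero.mp hroot).resolve_left (sub_ne_zero.mpr huu))
    have hvu : v ^ p ^ f = u := by
      rw [add_pow_char_pow, huv, add_comm u v] at hS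
      exact add_left_cancel hS
    have hne : u ≠ v := fun h => huu (huv.trans h.symm)
    have hq1 : 1 ≤ p ^ f := Nat.one_le_pow _ _ hp.out.pos
    set s := (t - algebraMap K L v) / (t - algebraMap K L u) with hs
    have hsgen : K⟮s⟯ = ⊤ := by
      have := adjoin_mobius (K := K) (a := 1) (b := -v) (c := 1) (d := -u)
        (by simpa [sub_eq_zero, neg_add_eq_sub] using hne.symm) (z := t)
        (one_ne_zero (α := L)) (by simpa [← sub_eq_add_neg] using htu)
      rw [← htop]
      simpa [hs, ← sub_eq_add_neg] using this
    have h := isGalois_adjoin_pow hsgen (div_ne_zero htv htu) (n := p ^ f - 1)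
      (by rw [Nat.cast_sub hq1]; simp [zero_pow hf])
    have hLu : ∀ u v : K, v ^ p ^ f = u →
        algebraMap K L 1 * (t ^ (p ^ f + 1) - algebraMap K L (u * v)) +
          algebraMap K L (-u) * (t ^ p ^ f + t - algebraMap K L (u + v)) =
          (t - algebraMap K L u) * (t - algebraMap K L v) ^ p ^ f := by
      intro u v hvu
      rw [sub_pow_char_pow, ← map_pow, hvu]
      simp
      ring
    have hLv := hLu v u huv
    rw [mul_comm v u, add_comm v u] at hLv
    rw [← adjoin_mobius (K := K) (a := 1) (b := -u) (c := 1) (d := -v)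
      (by simpa [sub_eq_zero, neg_add_eq_sub] using hne) hw0
        (by rw [hLv]; exact mul_ne_zero htv (pow_ne_zero _ htu)), hLv, hLu u v hvu]
    refine (isGalois_adjoin_congr ?_).mpr h
    obtain ⟨k, hk⟩ : ∃ k, p ^ f = k + 1 := ⟨p ^ f - 1, by lia⟩
    rw [hs, hk, Nat.add_sub_cancel, div_pow, pow_succ, pow_succ]
    field_simp

/-- With `a' ^ q = a`, adding the constant `a ^ 2` gives `(t - a) * (t - a') ^ q`, where `a ≠ a'`: a
simple zero beside a zero of order `q`. -/
theorem not_isGalois_outer_line (hf : f ≠ 0) {t : L} (ht : Transcendental K t) (htop : K⟮t⟯ = ⊤)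
    {a : K} (ha : a ^ p ^ f ≠ a) :
    ¬ IsGalois K⟮t ^ (p ^ f + 1) - algebraMap K L a * (t ^ p ^ f + t)⟯ L := by
  obtain ⟨a', ha'⟩ := IsAlgClosed.exists_pow_nat_eq a (pow_pos hp.out.pos f)
  have hne : a ≠ a' := by rintro rfl; exact ha ha'
  have hq2 : 2 ≤ p ^ f := hp.out.two_le.trans (Nat.le_self_pow hf p)
  have h := not_isGalois_of_zeros ht htop (P := (X - C a) * (X - C a') ^ p ^ f) (Q := 1)
    (P₁ := X - C a) (P₂ := (X - C a') ^ p ^ f) (a := a') (b := a) hq2 (mul_comm _ _)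
    (by simpa [sub_eq_zero] using hne.symm) (by simp) rfl
    (by simpa [sub_eq_zero] using fun h => absurd h hne) (by simp)
  rw [← adjoin_affine (a := 1) (b := a ^ 2) one_ne_zero]
  refine (isGalois_adjoin_congr ?_).not.mpr h
  rw [sub_pow_char_pow, ← C_pow, ha']
  simp
  ring

theorem not_isGalois_affine_point (hq : 3 ≤ p ^ f) {t : L} (ht : Transcendental K t)
    (htop : K⟮t⟯ = ⊤) {S N : K} (hSN : ¬ (S ^ p ^ f = S ∧ N ^ p ^ f = N)) :
    ¬ IsGalois K⟮(t ^ (p ^ f + 1) - algebraMap K L N) /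
      (t ^ p ^ f + t - algebraMap K L S)⟯ L := by
  have : CharP L p := charP_of_injective_algebraMap (algebraMap K L).injective p
  have hf : f ≠ 0 := by rintro rfl; simp at hq
  obtain ⟨u₀, hu⟩ := IsAlgClosed.exists_root (X ^ 2 - C S * X + C N : K[X])
    (by rw [show (X ^ 2 - C S * X + C N : K[X]).degree = 2 by compute_degree!]; decide)
  have hu' : u₀ ^ 2 - S * u₀ + N = 0 := by simpa using hu
  have hinj : Function.Injective fun x : K => x ^ p ^ f := by
    intro x y hxy
    have : (x - y) ^ p ^ f = 0 := by rw [sub_pow_char_pow]; exact sub_eq_zero.mpr hxy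
    exact sub_eq_zero.mp (eq_zero_of_pow_eq_zero this)
  -- One of the two roots is sent by Frobenius outside the pair; otherwise Frobenius, being
  -- injective, would permute the pair and fix `S` and `N`.
  obtain ⟨u, v, rfl, rfl, huu, huv⟩ : ∃ u v, S = u + v ∧ N = u * v ∧ u ^ p ^ f ≠ u ∧
      u ^ p ^ f ≠ v := by
    have h1 : S = u₀ + (S - u₀) := by ring
    have h2 : N = u₀ * (S - u₀) := by linear_combination hu'
    generalize S - u₀ = v₀ at h1 h2
    subst h1 h2
    by_cases hA : u₀ ^ p ^ f ≠ u₀ ∧ u₀ ^ p ^ f ≠ v₀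
    · exact ⟨u₀, v₀, rfl, rfl, hA.1, hA.2⟩
    refine ⟨v₀, u₀, add_comm _ _, mul_comm _ _, fun hB => hSN ?_, fun hB => hSN ?_⟩
    · have hC : u₀ ^ p ^ f = u₀ := by
        by_contra hC
        have hD : u₀ ^ p ^ f = v₀ := by
          by_contra hD
          exact hA ⟨hC, hD⟩
        have : u₀ = v₀ := hinj (hD.trans hB.symm)
        exact hC (hD.trans this.symm)
      rw [add_pow_char_pow, mul_pow, hB, hC]
      exact ⟨rfl, rfl⟩
    · have hD : u₀ ^ p ^ f = v₀ := by
        by_contra hD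
        have hC : u₀ ^ p ^ f = u₀ := by
          by_contra hC
          exact hA ⟨hC, hD⟩
        have : v₀ = u₀ := hinj (hB.trans hC.symm)
        exact hD (hC.trans this.symm)
      rw [add_pow_char_pow, mul_pow, hB, hD]
      exact ⟨add_comm _ _, mul_comm _ _⟩
  obtain ⟨u', hu'⟩ := IsAlgClosed.exists_pow_nat_eq u (pow_pos hp.out.pos f)
  have hne : u ≠ u' := by rintro rfl; exact huu hu'
  have hw0 : t ^ p ^ f + t - algebraMap K L (u + v) ≠ 0 := by
    have hP : (X ^ p ^ f + X - C (u + v) : K[X]) ≠ 0 := by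
      intro h
      have h2 := congrArg derivative h
      rw [derivative_sub, derivative_add, derivative_X_pow, Nat.cast_pow, CharP.cast_eq_zero,
        zero_pow hf] at h2
      simp at h2
    simpa using aeval_ne_zero_of_transcendental ht hP
  have hnum : algebraMap K L 1 * (t ^ (p ^ f + 1) - algebraMap K L (u * v)) +
      algebraMap K L (-u) * (t ^ p ^ f + t - algebraMap K L (u + v)) =
      (t - algebraMap K L u) * (t - algebraMap K L u') ^ p ^ f := by
    rw [sub_pow_char_pow, ← map_pow, hu']
    simp
    ring
  rw [← adjoin_div_affine (a := 1) (b := -u) one_ne_zero _ _ hw0, hnum]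
  -- The chosen member of the pencil is `(t - u) * (t - u') ^ q`. If `v = u'`, the denominator also
  -- vanishes, simply, at `v`, and the multiplicity drops to `q - 1`; this is at least two because
  -- `q ≥ 3`.
  by_cases hv : v = u'
  · subst hv
    have hq1 : 2 ≤ p ^ f - 1 := by lia
    have h := not_isGalois_of_zeros ht htop (P := (X - C u) * (X - C v) ^ (p ^ f - 1))
      (Q := (X - C v) ^ (p ^ f - 1) + 1)
      (P₁ := X - C u) (P₂ := (X - C v) ^ (p ^ f - 1)) (a := v) (b := u) hq1 (mul_comm _ _)
      (by simpa [sub_eq_zero] using hne.symm) (by simp [zero_pow (show p ^ f - 1 ≠ 0 by lia)]) rfl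
      (by simpa [sub_eq_zero] using fun h => absurd h hne) (by
        intro h0
        have h1 : (u - v) ^ (p ^ f - 1) + 1 = 0 := by simpa using h0
        have h2 : (u - v) ^ p ^ f + (u - v) = 0 := by
          obtain ⟨k, hk⟩ : ∃ k, p ^ f = k + 1 := ⟨p ^ f - 1, by lia⟩
          rw [hk, Nat.add_sub_cancel] at h1
          rw [hk, pow_succ]
          linear_combination (u - v) * h1
        rw [sub_pow_char_pow, hu'] at h2
        exact huv (by linear_combination h2))
    refine (isGalois_adjoin_congr ?_).not.mpr h
    have htv := sub_algebraMap_ne_zero ht v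
    have hden : t ^ p ^ f + t - algebraMap K L (u + v) =
        (t - algebraMap K L v) * ((t - algebraMap K L v) ^ (p ^ f - 1) + 1) := by
      have : (t - algebraMap K L v) * (t - algebraMap K L v) ^ (p ^ f - 1) =
          (t - algebraMap K L v) ^ p ^ f := by
        rw [← pow_succ', Nat.sub_add_cancel (by lia)]
      rw [mul_add, this, sub_pow_char_pow, ← map_pow, hu', map_add]
      ring
    rw [hden]
    obtain ⟨k, hk⟩ : ∃ k, p ^ f = k + 1 := ⟨p ^ f - 1, by lia⟩
    rw [hk, Nat.add_sub_cancel, pow_succ, ← mul_assoc, mul_comm _ (t - algebraMap K L v),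
      mul_div_mul_left _ _ htv]
    simp
  · have h := not_isGalois_of_zeros ht htop (P := (X - C u) * (X - C u') ^ p ^ f)
      (Q := X ^ p ^ f + X - C (u + v))
      (P₁ := X - C u) (P₂ := (X - C u') ^ p ^ f) (a := u') (b := u) (by lia) (mul_comm _ _)
      (by simpa [sub_eq_zero] using hne.symm)
      (by simp only [eval_sub, eval_add, eval_pow, eval_X, eval_C, hu']
          intro h
          exact hv (by linear_combination -h)) rfl
      (by simpa [sub_eq_zero] using fun h => absurd h hne)
      (by simp only [eval_sub, eval_add, eval_pow, eval_X, eval_C]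
          intro h
          exact huv (by linear_combination h))
    exact (isGalois_adjoin_congr (by simp)).not.mpr h

end BallicoHefezProjections

/-! ### Generic points of a plane curve and projection fields. -/

section GenericPoints

open IntermediateField MvPolynomial

variable {K L : Type*} [Field K] [Field L] [Algebra K L]

/-- `φ` is a generic point over `K`, with function field `L`, of the plane curve `f = 0`. -/
structure IsGenericCurvePoint (f : MvPolynomial (Fin 3) K) (φ : Fin 3 → L) : Prop where
  aeval_eq_zero_iff : ∀ (n : ℕ) (g : MvPolynomial (Fin 3) K), g.IsHomogeneous n →
    (aeval φ g = 0 ↔ f ∣ g)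
  adjoin_eq_top : adjoin K {z : L | ∃ i j, z = φ i / φ j} = ⊤

/-- Scaling a point by an indeterminate separates the homogeneous components of a polynomial. Thus a
generic point, which tests only homogeneous polynomials, yields a test for all of them. -/
theorem aeval_C_mul_X_of_isHomogeneous {A : Type*} [CommRing A] [Algebra K A]
    {g : MvPolynomial (Fin 3) K} {n : ℕ}
    (hg : g.IsHomogeneous n) (φ : Fin 3 → A) :
    aeval (fun i => Polynomial.C (φ i) * Polynomial.X) g =
      Polynomial.C (aeval φ g) * Polynomial.X ^ n := by
  rw [aeval_def, aeval_def, eval₂_eq', eval₂_eq', map_sum, Finset.sum_mul]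
  refine Finset.sum_congr rfl fun m hm => ?_
  have hdeg : ∑ i, m i = n := by
    have := hg (mem_support_iff.mp hm)
    rw [Finsupp.weight_apply, Finsupp.sum_fintype _ _ (by simp)] at this
    simpa using this
  simp only [mul_pow, Finset.prod_mul_distrib, map_mul, map_prod, map_pow]
  rw [Finset.prod_pow_eq_pow_sum, hdeg, mul_assoc]
  rfl

theorem aeval_smul_of_isHomogeneous {A : Type*} [CommRing A] [Algebra K A]
    {g : MvPolynomial (Fin 3) K} {n : ℕ}
    (hg : g.IsHomogeneous n) (c : A) (φ : Fin 3 → A) :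
    aeval (c • φ) g = c ^ n * aeval φ g := by
  have h := congrArg (Polynomial.eval c) (aeval_C_mul_X_of_isHomogeneous hg φ)
  rw [Polynomial.eval_mul, Polynomial.eval_pow, Polynomial.eval_X, Polynomial.eval_C,
    mul_comm] at h
  rw [← h]
  have h2 := (map_aeval (fun i => Polynomial.C (φ i) * Polynomial.X) (Polynomial.evalRingHom c) g)
  rw [Polynomial.coe_evalRingHom] at h2
  rw [h2, aeval_def, coe_eval₂Hom]
  congr 1
  · exact RingHom.ext fun x => by
      rw [RingHom.comp_apply, IsScalarTower.algebraMap_apply K A (Polynomial A)]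
      exact (Polynomial.eval_C).symm
  · funext i
    rw [Polynomial.eval_mul, Polynomial.eval_C, Polynomial.eval_X,
      mul_comm]
    rfl

theorem IsGenericCurvePoint.aeval_C_mul_X_eq_zero_iff {f : MvPolynomial (Fin 3) K} {φ : Fin 3 → L}
    (h : IsGenericCurvePoint f φ) {d : ℕ} (hf : f.IsHomogeneous d) (g : MvPolynomial (Fin 3) K) :
    aeval (fun i => Polynomial.C (φ i) * Polynomial.X) g = 0 ↔ f ∣ g := by
  constructor
  · intro h0
    rw [← sum_homogeneousComponent g]
    refine Finset.dvd_sum fun n hn => ?_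
    rw [← h.aeval_eq_zero_iff n _ (homogeneousComponent_isHomogeneous n g)]
    rw [← sum_homogeneousComponent g, map_sum] at h0
    have h1 := congrArg (fun p => Polynomial.coeff p n) h0
    simp only [Polynomial.finsetSum_coeff, Polynomial.coeff_zero] at h1
    rw [Finset.sum_eq_single n] at h1
    · rw [aeval_C_mul_X_of_isHomogeneous (homogeneousComponent_isHomogeneous n g),
        Polynomial.coeff_C_mul_X_pow] at h1
      simpa using h1
    · intro m _ hm
      rw [aeval_C_mul_X_of_isHomogeneous (homogeneousComponent_isHomogeneous m g),
        Polynomial.coeff_C_mul_X_pow, if_neg hm.symm]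
    · intro h2; exact absurd hn h2
  · rintro ⟨k, rfl⟩
    rw [map_mul, aeval_C_mul_X_of_isHomogeneous hf, (h.aeval_eq_zero_iff d f hf).mpr dvd_rfl]
    simp

theorem exists_linear_of_isHomogeneous_one {ℓ : MvPolynomial (Fin 3) K} (h : ℓ.IsHomogeneous 1) :
    ∃ c : Fin 3 → K, ℓ = ∑ i, C (c i) * X i := by
  refine ⟨fun i => coeff (Finsupp.single i 1) ℓ, ?_⟩
  ext m
  by_cases hm : m.degree = 1
  · obtain ⟨i, rfl⟩ : ∃ i, m = Finsupp.single i 1 := by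
      obtain ⟨i, hi⟩ : m ∈ Set.range fun i : Fin 3 => Finsupp.single i 1 := by
        rw [Finsupp.range_single_one]
        exact hm
      exact ⟨i, hi.symm⟩
    simp [coeff_sum, coeff_C_mul, coeff_X, Finsupp.single_left_inj]
  · rw [h.coeff_eq_zero hm, coeff_sum]
    symm
    refine Finset.sum_eq_zero fun i _ => ?_
    rw [coeff_C_mul, coeff_X, if_neg, mul_zero]
    rintro rfl
    simp at hm

theorem isHomogeneous_linear (c : Fin 3 → K) :
    (∑ i, C (c i) * X i : MvPolynomial (Fin 3) K).IsHomogeneous 1 :=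
  IsHomogeneous.sum _ _ _ fun i _ => by
    simpa using (isHomogeneous_C (Fin 3) (c i)).mul (isHomogeneous_X K i)

theorem not_dvd_linear {f : MvPolynomial (Fin 3) K} {d : ℕ} (hf : f.IsHomogeneous d)
    (hd : 2 ≤ d) {c : Fin 3 → K} (hc : c ≠ 0) : ¬ f ∣ ∑ i, C (c i) * X i := by
  rintro ⟨k, hk⟩
  have hne : (∑ i, C (c i) * X i : MvPolynomial (Fin 3) K) ≠ 0 := by
    intro h
    apply hc
    funext i
    have := congrArg (coeff (Finsupp.single i 1)) h
    simpa [coeff_sum, coeff_C_mul, coeff_X, Finsupp.single_left_inj] using this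
  have h1 := (isHomogeneous_linear c).totalDegree hne
  rw [hk] at hne
  have hf0 := left_ne_zero_of_mul hne
  rw [hk, totalDegree_mul_of_isDomain hf0 (right_ne_zero_of_mul hne), hf.totalDegree hf0] at h1
  lia

theorem IsGenericCurvePoint.linear_ne_zero {f : MvPolynomial (Fin 3) K} {φ : Fin 3 → L}
    (h : IsGenericCurvePoint f φ) {d : ℕ} (hf : f.IsHomogeneous d) (hd : 2 ≤ d)
    {c : Fin 3 → K} (hc : c ≠ 0) : ∑ i, algebraMap K L (c i) * φ i ≠ 0 := by
  intro h0
  apply not_dvd_linear hf hd hc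
  rw [← h.aeval_eq_zero_iff 1 _ (isHomogeneous_linear c), map_sum]
  simpa using h0

/-- The linear forms vanishing at a point form a plane, so any two independent ones span it. -/
theorem exists_eq_combination {c₁ c₂ v : Fin 3 → K} (hv : v ≠ 0) (hli : LinearIndependent K ![c₁, c₂])
    (h₁ : ∑ i, c₁ i * v i = 0) (h₂ : ∑ i, c₂ i * v i = 0) {c : Fin 3 → K}
    (hc : ∑ i, c i * v i = 0) : ∃ a b : K, c = a • c₁ + b • c₂ := by
  let g : (Fin 3 → K) →ₗ[K] K := Fintype.linearCombination K v
  have hg : ∀ c, g c = ∑ i, c i * v i := fun c => by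
    simp [g, Fintype.linearCombination_apply]
  have hrange : LinearMap.range g = ⊤ := by
    rw [LinearMap.range_eq_top]
    apply LinearMap.surjective
    intro h
    apply hv
    funext j
    have := congrArg (fun g => g (Pi.single j 1)) h
    simpa [hg, Pi.single_apply] using this
  have hk : Module.finrank K (LinearMap.ker g) = 2 := by
    have := LinearMap.finrank_range_add_finrank_ker g
    rw [hrange] at this
    simp at this
    lia
  have hle : Submodule.span K (Set.range ![c₁, c₂]) ≤ LinearMap.ker g := by
    rw [Submodule.span_le]
    rintro _ ⟨i, rfl⟩
    rw [SetLike.mem_coe, LinearMap.mem_ker, hg]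
    fin_cases i
    · exact h₁
    · exact h₂
  have heq := Submodule.eq_of_le_of_finrank_eq hle (by rw [finrank_span_eq_card hli, hk]; simp)
  have hmem : c ∈ Submodule.span K (Set.range ![c₁, c₂]) := by
    rw [heq, LinearMap.mem_ker, hg, hc]
  rw [Matrix.range_cons, Matrix.range_cons, Matrix.range_empty, Set.union_empty,
    Set.singleton_union, Submodule.mem_span_pair] at hmem
  obtain ⟨a, b, hab⟩ := hmem
  exact ⟨a, b, hab.symm⟩

namespace GeomIrredPlaneCurve

variable {F : Type*} [Field F] [Algebra F K] {d : ℕ}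

theorem ratio_mem (C : GeomIrredPlaneCurve F K d) {n : ℕ} {a b : MvPolynomial (Fin 3) K}
    (ha : a.IsHomogeneous n) (hb : b.IsHomogeneous n) : C.ratio a b ∈ C.functionField :=
  ⟨n, a, b, ha, hb, rfl⟩

/-- Sending `X i` to `φ i * T` embeds the homogeneous coordinate ring in `L[T]`. In a quotient of
forms of equal degree the powers of `T` cancel, so the function field lands in `L`, onto it because
the ratios of the `φ i` generate `L`. -/
theorem exists_algEquiv (C : GeomIrredPlaneCurve F K d) {φ : Fin 3 → L}
    (h : IsGenericCurvePoint (map (algebraMap F K) C.poly) φ) :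
    ∃ e : C.functionField ≃ₐ[K] L, ∀ (n : ℕ) (a b : MvPolynomial (Fin 3) K)
      (ha : a.IsHomogeneous n) (hb : b.IsHomogeneous n),
      e ⟨C.ratio a b, C.ratio_mem ha hb⟩ = aeval φ a / aeval φ b := by
  have hf : (map (algebraMap F K) C.poly).IsHomogeneous d := C.isHomogeneous.map _
  let Ψ : MvPolynomial (Fin 3) K →ₐ[K] Polynomial L :=
    aeval (fun i => Polynomial.C (φ i) * Polynomial.X)
  have hΨ : ∀ g, Ψ g = 0 ↔ g ∈ C.ideal := fun g => by
    rw [Ideal.mem_span_singleton]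
    exact h.aeval_C_mul_X_eq_zero_iff hf g
  let Ψ₁ : C.coordinateRing →ₐ[K] Polynomial L :=
    Ideal.Quotient.liftₐ C.ideal Ψ fun g hg => (hΨ g).mpr hg
  have hΨ₁ : Function.Injective Ψ₁ := by
    rw [injective_iff_map_eq_zero]
    intro g hg
    obtain ⟨g, rfl⟩ := Ideal.Quotient.mk_surjective g
    rw [Ideal.Quotient.eq_zero_iff_mem, ← hΨ]
    exact hg
  let Ψ₂ : C.coordinateRing →ₐ[K] FractionRing (Polynomial L) :=
    (IsScalarTower.toAlgHom K (Polynomial L) (FractionRing (Polynomial L))).comp Ψ₁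
  have hΨ₂ : Function.Injective Ψ₂ :=
    (IsFractionRing.injective (Polynomial L) (FractionRing (Polynomial L))).comp hΨ₁
  let Φ : FractionRing C.coordinateRing →ₐ[K] FractionRing (Polynomial L) :=
    IsFractionRing.liftAlgHom hΨ₂
  have hΦ : ∀ g, Φ (algebraMap C.coordinateRing _ (Ideal.Quotient.mk C.ideal g)) =
      algebraMap (Polynomial L) _ (Ψ g) := fun g => IsFractionRing.lift_algebraMap hΨ₂ _
  let ι : L →ₐ[K] FractionRing (Polynomial L) :=
    (IsScalarTower.toAlgHom K (Polynomial L) (FractionRing (Polynomial L))).comp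
      (IsScalarTower.toAlgHom K L (Polynomial L))
  have hratio : ∀ (n : ℕ) (a b : MvPolynomial (Fin 3) K) (ha : a.IsHomogeneous n)
      (hb : b.IsHomogeneous n), Φ (C.ratio a b) = ι (aeval φ a / aeval φ b) := by
    intro n a b ha hb
    rw [ratio, map_div₀, hΦ, hΦ, aeval_C_mul_X_of_isHomogeneous ha, aeval_C_mul_X_of_isHomogeneous hb, map_mul, map_mul,
      map_div₀ ι]
    refine mul_div_mul_right _ _ ?_
    rw [Ne, IsFractionRing.to_map_eq_zero_iff]
    exact pow_ne_zero _ Polynomial.X_ne_zero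
  have hmem : ∀ z : C.functionField, Φ z ∈ ι.range := by
    rintro ⟨z, n, a, b, ha, hb, rfl⟩
    exact ⟨_, (hratio n a b ha hb).symm⟩
  let e₀ : C.functionField →ₐ[K] L :=
    ((AlgEquiv.ofInjective ι ι.injective).symm : ι.range →ₐ[K] L).comp
      ((Φ.comp C.functionField.val).codRestrict ι.range hmem)
  have he₀ : ∀ z, ι (e₀ z) = Φ z := by
    intro z
    have := (AlgEquiv.ofInjective ι ι.injective).apply_symm_apply ⟨Φ z, hmem z⟩
    exact congrArg Subtype.val this
  have hval : ∀ (n : ℕ) (a b : MvPolynomial (Fin 3) K) (ha : a.IsHomogeneous n)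
      (hb : b.IsHomogeneous n), e₀ ⟨C.ratio a b, C.ratio_mem ha hb⟩ = aeval φ a / aeval φ b := by
    intro n a b ha hb
    exact ι.injective ((he₀ _).trans (hratio n a b ha hb))
  have hsurj : Function.Surjective e₀ := by
    rw [← AlgHom.fieldRange_eq_top]
    refine top_le_iff.mp ?_
    rw [← h.adjoin_eq_top, adjoin_le_iff]
    rintro _ ⟨i, j, rfl⟩
    refine ⟨⟨C.ratio (X i) (X j), C.ratio_mem (isHomogeneous_X K i) (isHomogeneous_X K j)⟩, ?_⟩
    have := hval 1 (X i) (X j) (isHomogeneous_X K i) (isHomogeneous_X K j)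
    simpa using this
  exact ⟨AlgEquiv.ofBijective e₀ ⟨e₀.injective, hsurj⟩, hval⟩

theorem eval_rep_eq_zero_iff {v : Fin 3 → K} (hv : v ≠ 0) (ℓ : MvPolynomial (Fin 3) K) {n : ℕ}
    (hℓ : ℓ.IsHomogeneous n) :
    eval (Projectivization.mk K v hv).rep ℓ = 0 ↔ eval v ℓ = 0 := by
  obtain ⟨a, ha⟩ := Projectivization.exists_smul_eq_mk_rep K v hv
  rw [← ha]
  have := aeval_smul_of_isHomogeneous hℓ (a : K) v
  rw [aeval_eq_eval] at this
  rw [show a • v = (a : K) • v from rfl, this]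
  simp

/-- Any quotient of two members of the pencil is a fractional linear expression in the quotient of
the two basis forms, so that quotient alone generates the projection field. -/
theorem isGalois_projectionField_iff (C : GeomIrredPlaneCurve F K d) (hd : 2 ≤ d) {φ : Fin 3 → L}
    (h : IsGenericCurvePoint (map (algebraMap F K) C.poly) φ) {v c₁ c₂ : Fin 3 → K} (hv : v ≠ 0)
    (hli : LinearIndependent K ![c₁, c₂])
    (h₁ : ∑ i, c₁ i * v i = 0) (h₂ : ∑ i, c₂ i * v i = 0) :
    Projectivization.mk K v hv ∈ C.galoisPoints ↔
      IsGalois K⟮(∑ i, algebraMap K L (c₁ i) * φ i) / (∑ i, algebraMap K L (c₂ i) * φ i)⟯ L := by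
  have hf : (map (algebraMap F K) C.poly).IsHomogeneous d := C.isHomogeneous.map _
  obtain ⟨e, he⟩ := C.exists_algEquiv h
  set P := Projectivization.mk K v hv with hP
  set z := ∑ i, algebraMap K L (c₁ i) * φ i with hz
  set w := ∑ i, algebraMap K L (c₂ i) * φ i with hw
  have hc₂ : c₂ ≠ 0 := hli.ne_zero 1
  have hw0 : w ≠ 0 := h.linear_ne_zero hf hd hc₂
  have hlin : ∀ c : Fin 3 → K, aeval φ (∑ i, MvPolynomial.C (c i) * X i) =
      ∑ i, algebraMap K L (c i) * φ i := fun c => by simp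
  have heval : ∀ c : Fin 3 → K, eval P.rep (∑ i, MvPolynomial.C (c i) * X i) = 0 ↔
      ∑ i, c i * v i = 0 := fun c => by
    rw [hP, eval_rep_eq_zero_iff hv _ (isHomogeneous_linear c)]
    simp
  have hmap : (C.projectionField P).map e.toAlgHom = K⟮z / w⟯ := by
    rw [projectionField, adjoin_map]
    apply le_antisymm
    · rw [adjoin_le_iff]
      rintro _ ⟨x, ⟨ℓ, m, hℓ, hm, hℓP, hmP, hx⟩, rfl⟩
      obtain ⟨cℓ, rfl⟩ := exists_linear_of_isHomogeneous_one hℓ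
      obtain ⟨cm, rfl⟩ := exists_linear_of_isHomogeneous_one hm
      obtain ⟨a, b, rfl⟩ := exists_eq_combination hv hli h₁ h₂ ((heval _).mp hℓP)
      obtain ⟨a', b', rfl⟩ := exists_eq_combination hv hli h₁ h₂ ((heval _).mp hmP)
      have hx' : x = ⟨C.ratio _ _, C.ratio_mem hℓ hm⟩ := Subtype.ext hx
      have hcomb : ∀ a b : K, ∑ i, algebraMap K L ((a • c₁ + b • c₂) i) * φ i =
          (algebraMap K L a * (z / w) + algebraMap K L b) * w := by
        intro a b
        rw [add_mul, mul_assoc, div_mul_cancel₀ _ hw0, hz, hw, Finset.mul_sum, Finset.mul_sum,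
          ← Finset.sum_add_distrib]
        refine Finset.sum_congr rfl fun i _ => ?_
        simp
        ring
      have hex : e x = (algebraMap K L a * (z / w) + algebraMap K L b) /
          (algebraMap K L a' * (z / w) + algebraMap K L b') := by
        rw [hx', he 1 _ _ hℓ hm, hlin, hlin, hcomb, hcomb, mul_div_mul_right _ _ hw0]
      change e x ∈ K⟮z / w⟯
      rw [hex]
      have hzw := mem_adjoin_simple_self K (z / w)
      exact div_mem
        (add_mem (mul_mem (IntermediateField.algebraMap_mem _ _) hzw)
          (IntermediateField.algebraMap_mem _ _))
        (add_mem (mul_mem (IntermediateField.algebraMap_mem _ _) hzw)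
          (IntermediateField.algebraMap_mem _ _))
    · rw [adjoin_simple_le_iff]
      refine subset_adjoin _ _ ⟨⟨C.ratio _ _, C.ratio_mem (isHomogeneous_linear c₁)
        (isHomogeneous_linear c₂)⟩, ⟨_, _, isHomogeneous_linear c₁, isHomogeneous_linear c₂,
          (heval _).mpr h₁, (heval _).mpr h₂, rfl⟩, ?_⟩
      refine (he 1 _ _ (isHomogeneous_linear c₁) (isHomogeneous_linear c₂)).trans ?_
      rw [hlin, hlin]
  rw [← hmap]
  let g := (C.projectionField P).equivMap e.toAlgHom
  constructor
  · intro hG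
    have : IsGalois (C.projectionField P) C.functionField := hG
    exact IsGalois.of_equiv_equiv (f := g.toRingEquiv) (g := e.toRingEquiv) (by ext x; rfl)
  · intro hG
    have : IsGalois (C.projectionField P) C.functionField :=
      IsGalois.of_equiv_equiv (f := g.symm.toRingEquiv) (g := e.symm.toRingEquiv) (by
        ext x
        obtain ⟨y, rfl⟩ := g.surjective x
        have h1 : g.symm.toRingEquiv (g y) = y := g.symm_apply_apply y
        have h2 : e.symm.toRingEquiv (algebraMap _ L (g y)) = y := e.symm_apply_apply _
        exact congrArg Subtype.val ((congrArg Subtype.val h1).trans h2.symm))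
    exact this

end GeomIrredPlaneCurve

end GenericPoints

/-! ### Functions whose only pole is a given place. -/

section PoleRing

open IntermediateField

variable {K L : Type*} [Field K] [Field L] [Algebra K L]

namespace Place

variable (P : Place K L)

theorem valuation_le_one_iff (z : L) : P.valuation z ≤ 1 ↔ z ∈ P.valuationRing := by
  have := P.isDVR
  constructor
  · intro h
    obtain ⟨y, hy⟩ := IsDiscreteValuationRing.exists_lift_of_le_one (A := P.valuationRing) h
    rw [← hy]
    exact y.2
  · intro h
    exact (IsDiscreteValuationRing.maximalIdeal P.valuationRing).valuation_le_one
      (⟨z, h⟩ : P.valuationRing)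

theorem valuation_lt_one_iff (z : L) : P.valuation z < 1 ↔ z ∈ P.valuationRing.nonunits := by
  rw [ValuationSubring.mem_nonunits_iff_or, ← P.valuation_le_one_iff, map_inv₀]
  by_cases hz : z = 0
  · simp [hz]
  · rw [inv_le_one₀ (zero_lt_iff.mpr ((Valuation.ne_zero_iff _).mpr hz)), not_le]
    simp [hz]

theorem exists_uniformizer : ∃ π : L, P.valuation π = WithZero.exp (-1) :=
  haveI := P.isDVR
  (IsDiscreteValuationRing.maximalIdeal P.valuationRing).valuation_exists_uniformizer L

theorem exists_valuation_eq_exp {z : L} (hz : z ≠ 0) : ∃ n : ℤ, P.valuation z = WithZero.exp n :=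
  ⟨WithZero.log (P.valuation z), (WithZero.exp_log ((Valuation.ne_zero_iff _).mpr hz)).symm⟩

theorem valuation_algebraMap {c : K} (hc : c ≠ 0) : P.valuation (algebraMap K L c) = 1 := by
  refine le_antisymm (P.valuation_algebraMap_le_one c) ?_
  have h := P.valuation_algebraMap_le_one c⁻¹
  rw [map_inv₀, map_inv₀, inv_le_one₀] at h
  · exact h
  · rw [zero_lt_iff]; simpa using hc

theorem valuation_eq_of_uniformizer {v : L → ℤᵐ⁰} {π : L} (hπ : P.valuation π = WithZero.exp (-1))
    (hmul : ∀ x y, v (x * y) = v x * v y) (hunit : ∀ x, P.valuation x = 1 → v x = 1)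
    (h0 : v 0 = 0) (hvπ : v π = WithZero.exp (-1)) (z : L) : v z = P.valuation z := by
  by_cases hz : z = 0
  · rw [hz, h0, map_zero]
  obtain ⟨n, hn⟩ := P.exists_valuation_eq_exp hz
  have hπ0 : π ≠ 0 := by
    rintro rfl
    rw [map_zero] at hπ
    exact WithZero.exp_ne_zero hπ.symm
  have hpow : ∀ k : ℕ, v (π ^ k) = WithZero.exp (-k : ℤ) := by
    intro k
    induction k with
    | zero => simpa using hunit 1 (by simp)
    | succ k ih => rw [pow_succ, hmul, ih, hvπ, ← WithZero.exp_add]; congr 1; push_cast; ring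
  have hPpow : ∀ k : ℕ, P.valuation (π ^ k) = WithZero.exp (-k : ℤ) := by
    intro k
    rw [map_pow, hπ, ← WithZero.exp_nsmul]
    simp
  rcases le_total 0 n with h | h
  · obtain ⟨k, rfl⟩ := Int.eq_ofNat_of_zero_le h
    have h1 := hunit (z * π ^ k) (by rw [map_mul, hn, hPpow, ← WithZero.exp_add]; simp)
    rw [hmul, hpow] at h1
    rw [hn, ← mul_one (v z)]
    have : (WithZero.exp (-(k : ℤ)) : ℤᵐ⁰) * WithZero.exp (k : ℤ) = 1 := by
      rw [← WithZero.exp_add]; simp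
    rw [← this, ← mul_assoc, h1, one_mul]
  · obtain ⟨k, hk⟩ := Int.eq_ofNat_of_zero_le (neg_nonneg.mpr h)
    have hk' : n = -(k : ℤ) := by lia
    have h1 := hunit (z / π ^ k) (by
      rw [map_div₀, hn, hPpow, hk', div_self]
      exact WithZero.exp_ne_zero)
    have h2 := hmul (z / π ^ k) (π ^ k)
    rw [div_mul_cancel₀ _ (pow_ne_zero k hπ0), h1, one_mul, hpow] at h2
    rw [h2, hn, hk']

theorem valuation_apply_of_stable (σ : L ≃ₐ[K] L)
    (hσ : ∀ x, x ∈ P.valuationRing ↔ σ x ∈ P.valuationRing) (z : L) :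
    P.valuation (σ z) = P.valuation z := by
  have hle : ∀ x, P.valuation x ≤ 1 ↔ P.valuation (σ x) ≤ 1 := fun x => by
    rw [P.valuation_le_one_iff, P.valuation_le_one_iff, hσ]
  have hlt : ∀ x, P.valuation x < 1 ↔ P.valuation (σ x) < 1 := by
    intro x
    rw [P.valuation_lt_one_iff, P.valuation_lt_one_iff, ValuationSubring.mem_nonunits_iff_or,
      ValuationSubring.mem_nonunits_iff_or, ← map_inv₀, ← hσ, EmbeddingLike.map_eq_zero_iff]
  have hunit : ∀ x, P.valuation x = 1 → P.valuation (σ x) = 1 := fun x hx =>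
    le_antisymm ((hle x).mp hx.le) (not_lt.mp fun h => ((hlt x).mpr h).ne hx)
  obtain ⟨π, hπ⟩ := P.exists_uniformizer
  have hπ0 : π ≠ 0 := by
    rintro rfl
    rw [map_zero] at hπ
    exact WithZero.exp_ne_zero hπ.symm
  have hone : (WithZero.exp (-1) : ℤᵐ⁰) < 1 := by
    rw [← WithZero.exp_zero, WithZero.exp_lt_exp]; lia
  have hneg : ∀ {x : L}, P.valuation x < 1 → P.valuation x ≤ WithZero.exp (-1) := by
    intro x hx
    by_cases hx0 : x = 0
    · simp [hx0]
    obtain ⟨n, hn⟩ := P.exists_valuation_eq_exp hx0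
    rw [hn, ← WithZero.exp_zero, WithZero.exp_lt_exp] at hx
    rw [hn, WithZero.exp_le_exp]
    lia
  refine P.valuation_eq_of_uniformizer (v := fun z => P.valuation (σ z)) hπ (fun x y => by simp)
    hunit (by simp) ?_ z
  obtain ⟨n, hn⟩ := P.exists_valuation_eq_exp
    (show σ π ≠ 0 from (EmbeddingLike.map_ne_zero_iff (f := σ)).mpr hπ0)
  have h1 := (hlt π).mp (hπ ▸ hone)
  have hn1 : n ≤ -1 := by
    rw [hn, ← WithZero.exp_zero, WithZero.exp_lt_exp] at h1; lia
  rcases hn1.lt_or_eq with h2 | h2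
  -- If `σ π` had order at least two, `π / (σ⁻¹ π) ^ 2` would be integral, its image being `σ π / π
  -- ^ 2`; then `π` would have order at least two.
  · exfalso
    have h3 : P.valuation (σ.symm π) ≤ WithZero.exp (-1) := by
      apply hneg
      rw [hlt, AlgEquiv.apply_symm_apply, hπ]
      exact hone
    have h4 : P.valuation (π / σ.symm π ^ 2) ≤ 1 := by
      rw [hle, map_div₀, map_pow, AlgEquiv.apply_symm_apply, map_div₀, map_pow, hn, hπ,
        ← WithZero.exp_nsmul, ← WithZero.exp_sub, ← WithZero.exp_zero, WithZero.exp_le_exp]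
      simp
      lia
    have hs0 : σ.symm π ≠ 0 := (EmbeddingLike.map_ne_zero_iff (f := σ.symm)).mpr hπ0
    have h5 : P.valuation π ≤ WithZero.exp (-2) := by
      rw [← div_mul_cancel₀ π (pow_ne_zero 2 hs0), map_mul, map_pow]
      refine (mul_le_of_le_one_left' h4).trans ((pow_le_pow_left₀ zero_le h3 2).trans ?_)
      rw [← WithZero.exp_nsmul]
      simp
    rw [hπ, WithZero.exp_le_exp] at h5
    lia
  · change P.valuation (σ π) = _
    rw [hn, h2]

/-- The elements of `L` that are regular at every valuation ring over `K` different from `P`. -/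
def poleRing : Subalgebra K L where
  carrier := {z | ∀ V : ValuationSubring L, (∀ c : K, algebraMap K L c ∈ V) →
    V ≠ P.valuationRing → z ∈ V}
  mul_mem' hx hy V hV hP := V.mul_mem _ _ (hx V hV hP) (hy V hV hP)
  add_mem' hx hy V hV hP := V.add_mem _ _ (hx V hV hP) (hy V hV hP)
  algebraMap_mem' c _ hV _ := hV c

variable {P}

/-- An automorphism fixing `z` permutes the poles of `z`, and `P` is the only one. -/
theorem stable_of_fixed {z : L} (hz : z ∈ P.poleRing) (hv : 1 < P.valuation z) {σ : L ≃ₐ[K] L}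
    (hσ : σ z = z) (x : L) : x ∈ P.valuationRing ↔ σ x ∈ P.valuationRing := by
  have h : P.valuationRing.comap (σ : L →+* L) = P.valuationRing := by
    by_contra hne
    have := hz _ (fun c => by
      rw [ValuationSubring.mem_comap]
      simpa using P.algebraMap_mem c) hne
    rw [ValuationSubring.mem_comap] at this
    change σ z ∈ _ at this
    rw [hσ, ← P.valuation_le_one_iff] at this
    exact this.not_gt hv
  conv_lhs => rw [← h]
  rfl

theorem apply_mem_poleRing {σ : L ≃ₐ[K] L}
    (hσ : ∀ x, x ∈ P.valuationRing ↔ σ x ∈ P.valuationRing) {z : L} (hz : z ∈ P.poleRing) :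
    σ z ∈ P.poleRing := by
  intro V hV hne
  refine hz (V.comap (σ : L →+* L)) (fun c => ?_) fun h => hne ?_
  · rw [ValuationSubring.mem_comap]
    simpa using hV c
  · ext x
    obtain ⟨y, rfl⟩ := σ.surjective x
    rw [← hσ, ← h]
    rfl

/-- A function without poles is constant: if `z - c` vanishes at `P` and is not zero, its inverse is
transcendental and has a zero somewhere, which is a pole of `z - c`. -/
theorem exists_eq_algebraMap [IsAlgClosed K]
    (hres : ∀ z, P.valuation z ≤ 1 → ∃ c : K, P.valuation (z - algebraMap K L c) < 1)
    {z : L} (hz : z ∈ P.poleRing) (hv : P.valuation z ≤ 1) : ∃ c : K, z = algebraMap K L c := by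
  obtain ⟨c, hc⟩ := hres z hv
  refine ⟨c, ?_⟩
  by_contra hne
  set w := z - algebraMap K L c with hw
  have hw0 : w ≠ 0 := sub_ne_zero.mpr hne
  have hwR : w ∈ P.poleRing := sub_mem hz (P.poleRing.algebraMap_mem c)
  have htr : Transcendental K w⁻¹ := by
    intro h
    obtain ⟨a, ha⟩ := mem_range_algebraMap_of_isAlgebraic h
    have ha0 : a ≠ 0 := by
      rintro rfl
      rw [map_zero] at ha
      exact inv_ne_zero hw0 ha.symm
    have := P.valuation_algebraMap ha0
    rw [ha, map_inv₀, inv_eq_one] at this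
    exact hc.ne this
  obtain ⟨V, hV, hn⟩ := exists_valuationSubring_nonunit htr
  have hwV : w ∉ V := by
    rw [ValuationSubring.mem_nonunits_iff_or, inv_inv] at hn
    exact hn.resolve_left (inv_ne_zero hw0)
  apply hwV
  by_cases hVP : V = P.valuationRing
  · rw [hVP, ← P.valuation_le_one_iff]
    exact hc.le
  · exact hwR V hV hVP

theorem exists_valuation_sub_lt
    (hres : ∀ z, P.valuation z ≤ 1 → ∃ c : K, P.valuation (z - algebraMap K L c) < 1)
    {z w : L} (hw : w ≠ 0) (h : P.valuation z = P.valuation w) :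
    ∃ c : K, c ≠ 0 ∧ P.valuation (z - algebraMap K L c * w) < P.valuation w := by
  have hw0 : P.valuation w ≠ 0 := (Valuation.ne_zero_iff _).mpr hw
  have h1 : P.valuation (z / w) = 1 := by rw [map_div₀, h, div_self hw0]
  obtain ⟨c, hc⟩ := hres (z / w) h1.le
  refine ⟨c, ?_, ?_⟩
  · rintro rfl
    rw [map_zero, sub_zero, h1] at hc
    exact hc.false
  · have : z - algebraMap K L c * w = (z / w - algebraMap K L c) * w := by
      rw [sub_mul, div_mul_cancel₀ _ hw]
    rw [this, map_mul]
    exact mul_lt_of_lt_one_left (zero_lt_iff.mpr hw0) hc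

theorem valuation_aeval {z : L} {m : ℕ} (hm : 1 ≤ m) (hz : P.valuation z = WithZero.exp (m : ℤ))
    {r : Polynomial K} (hr : r ≠ 0) :
    P.valuation (Polynomial.aeval z r) = WithZero.exp ((m * r.natDegree : ℕ) : ℤ) := by
  have hz1 : 1 < P.valuation z := by
    rw [hz, ← WithZero.exp_zero, WithZero.exp_lt_exp]
    lia
  have hpow : ∀ k : ℕ, P.valuation (z ^ k) = WithZero.exp ((m * k : ℕ) : ℤ) := fun k => by
    rw [map_pow, hz, ← WithZero.exp_nsmul]
    congr 1
    push_cast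
    rw [nsmul_eq_mul, mul_comm]
  have key : ∀ (n : ℕ) (s : Polynomial K), s.natDegree < n →
      P.valuation (Polynomial.aeval z s) < WithZero.exp ((m * n : ℕ) : ℤ) := by
    intro n s hs
    rw [Polynomial.aeval_eq_sum_range]
    refine Valuation.map_sum_lt _ WithZero.exp_ne_zero fun i hi => ?_
    rw [Algebra.smul_def, map_mul]
    refine (mul_le_of_le_one_left' (P.valuation_algebraMap_le_one _)).trans_lt ?_
    rw [hpow, WithZero.exp_lt_exp, Nat.cast_lt]
    have := Finset.mem_range.mp hi
    exact Nat.mul_lt_mul_of_pos_left (by lia) hm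
  have hlead : P.valuation (algebraMap K L r.leadingCoeff * z ^ r.natDegree) =
      WithZero.exp ((m * r.natDegree : ℕ) : ℤ) := by
    rw [map_mul, P.valuation_algebraMap (Polynomial.leadingCoeff_ne_zero.mpr hr), one_mul, hpow]
  have hsplit : Polynomial.aeval z r = Polynomial.aeval z r.eraseLead +
      algebraMap K L r.leadingCoeff * z ^ r.natDegree := by
    conv_lhs => rw [← r.eraseLead_add_C_mul_X_pow]
    rw [map_add, map_mul, map_pow, Polynomial.aeval_C, Polynomial.aeval_X]
  rw [hsplit]
  by_cases he : r.eraseLead = 0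
  · rw [he, map_zero, zero_add, hlead]
  have hlt : r.eraseLead.natDegree < r.natDegree :=
    Polynomial.eraseLead_natDegree_lt_or_eraseLead_eq_zero r |>.resolve_right he
  rw [Valuation.map_add_eq_of_lt_right _ (by rw [hlead]; exact key _ _ hlt), hlead]

theorem valuation_of_mem_adjoin {z : L} {m : ℕ} (hm : 1 ≤ m)
    (hz : P.valuation z = WithZero.exp (m : ℤ)) {x : L} (hx : x ∈ K⟮z⟯) (hx0 : x ≠ 0) :
    ∃ k : ℤ, P.valuation x = WithZero.exp (m * k) := by
  obtain ⟨r, s, rfl⟩ := (mem_adjoin_simple_iff K x).mp hx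
  have hr : r ≠ 0 := by rintro rfl; simp at hx0
  have hs : s ≠ 0 := by rintro rfl; simp at hx0
  refine ⟨r.natDegree - s.natDegree, ?_⟩
  rw [map_div₀, valuation_aeval hm hz hr, valuation_aeval hm hz hs, ← WithZero.exp_sub]
  congr 1
  push_cast
  ring

/-- The Galois group of `L` over `K(z)` fixes `P`, so all conjugates of `w` have the same value and
the norm of `w` has order `[L : K(z)] * k`. Orders of elements of `K(z)` at `P` are multiples of
`m`. -/
theorem dvd_finrank_mul {z : L} {m : ℕ} (hm : 1 ≤ m) (hz : z ∈ P.poleRing)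
    (hv : P.valuation z = WithZero.exp (m : ℤ)) [FiniteDimensional K⟮z⟯ L] [IsGalois K⟮z⟯ L]
    {w : L} {k : ℤ} (hw : P.valuation w = WithZero.exp k) :
    (m : ℤ) ∣ Module.finrank K⟮z⟯ L * k := by
  have hv1 : 1 < P.valuation z := by
    rw [hv, ← WithZero.exp_zero, WithZero.exp_lt_exp]
    lia
  have hw0 : w ≠ 0 := by
    rintro rfl
    rw [map_zero] at hw
    exact WithZero.exp_ne_zero hw.symm
  have hN := Algebra.norm_eq_prod_automorphisms K⟮z⟯ w
  have hval : ∀ σ : L ≃ₐ[K⟮z⟯] L, P.valuation (σ w) = WithZero.exp k := fun σ => by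
    rw [← hw]
    refine P.valuation_apply_of_stable (σ.restrictScalars K) (stable_of_fixed hz hv1 ?_) w
    exact σ.commutes (AdjoinSimple.gen K z)
  have h1 : P.valuation (algebraMap K⟮z⟯ L (Algebra.norm K⟮z⟯ w)) =
      WithZero.exp (Module.finrank K⟮z⟯ L * k) := by
    rw [hN, map_prod, Finset.prod_congr rfl fun σ _ => hval σ, Finset.prod_const,
      Finset.card_univ, ← Nat.card_eq_fintype_card, IsGalois.card_aut_eq_finrank,
      ← WithZero.exp_nsmul, nsmul_eq_mul]
  obtain ⟨j, hj⟩ := valuation_of_mem_adjoin hm hv (Algebra.norm K⟮z⟯ w).2 (by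
    intro h0
    have h2 : Algebra.norm K⟮z⟯ w = 0 := Subtype.ext h0
    exact hw0 (Algebra.norm_eq_zero_iff.mp h2))
  refine ⟨j, ?_⟩
  rw [← WithZero.exp_inj, ← h1, ← hj]
  rfl

variable (P) in
-- Divisors see only discrete valuation rings while `poleRing` quantifies over all valuation rings;
-- `hdvr` closes this gap.
theorem riemannRochSpace_single_le_poleRing
    (hdvr : ∀ V : ValuationSubring L, (∀ c : K, algebraMap K L c ∈ V) → V ≠ ⊤ →
      IsDiscreteValuationRing V) (n : ℕ) {z : L}
    (hz : z ∈ riemannRochSpace K L (Finsupp.single P (n : ℤ))) :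
    z ∈ P.poleRing ∧ P.valuation z ≤ WithZero.exp (n : ℤ) := by
  constructor
  · intro V hV hne
    by_cases htop : V = ⊤
    · rw [htop]; trivial
    let Q : Place K L := ⟨V, hV, hdvr V hV htop⟩
    have hQ : Q ≠ P := fun h => hne (congrArg Place.valuationRing h)
    have := hz Q
    rw [Finsupp.single_eq_of_ne hQ, WithZero.exp_zero, Q.valuation_le_one_iff] at this
    exact this
  · simpa using hz P

/-- The divisors `n P` in the definition of the genus give `dim L(n P) ≥ n`. Without a function of
pole order one, `L(P)` consists of constants, so `L(2P)` and then `L(3P)` must contain functions of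
the full pole order. -/
theorem exists_of_genus_le_one [IsAlgClosed K]
    (hres : ∀ z, P.valuation z ≤ 1 → ∃ c : K, P.valuation (z - algebraMap K L c) < 1)
    (hdvr : ∀ V : ValuationSubring L, (∀ c : K, algebraMap K L c ∈ V) → V ≠ ⊤ →
      IsDiscreteValuationRing V) (hgenus : functionFieldGenus K L ≤ 1) :
    (∃ t ∈ P.poleRing, P.valuation t = WithZero.exp 1) ∨
    ((∀ t ∈ P.poleRing, P.valuation t ≠ WithZero.exp 1) ∧
      (∃ u ∈ P.poleRing, P.valuation u = WithZero.exp 2) ∧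
      ∃ w ∈ P.poleRing, P.valuation w = WithZero.exp 3) := by
  have hdim : ∀ n : ℕ, n ≤ Module.finrank K (riemannRochSpace K L (Finsupp.single P (n : ℤ))) := by
    intro n
    have h1 := (le_iSup (fun D : Place K L →₀ ℤ => ((divisorDegree D + 1 -
      (Module.finrank K (riemannRochSpace K L D) : ℤ)).toNat : ℕ∞))
      (Finsupp.single P (n : ℤ))).trans hgenus
    simp only [divisorDegree, Finsupp.sum_single_index] at h1
    have h2 := Nat.cast_le.mp (h1.trans_eq Nat.cast_one.symm)
    lia
  by_cases ht : ∃ t ∈ P.poleRing, P.valuation t = WithZero.exp 1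
  · exact Or.inl ht
  refine Or.inr ⟨fun t h1 h2 => ht ⟨t, h1, h2⟩, ?_⟩
  push Not at ht
  have hne : ∀ (S : Finset L) (n : ℕ), S.card < n →
      ∃ z ∈ P.poleRing, P.valuation z ≤ WithZero.exp (n : ℤ) ∧ z ∉ Submodule.span K (S : Set L) := by
    intro S n hS
    by_contra! hcon
    have hle : riemannRochSpace K L (Finsupp.single P (n : ℤ)) ≤ Submodule.span K (S : Set L) :=
      fun z hz => hcon z (P.riemannRochSpace_single_le_poleRing hdvr n hz).1
        (P.riemannRochSpace_single_le_poleRing hdvr n hz).2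
    have := (hdim n).trans (Submodule.finrank_mono hle)
    have := this.trans (finrank_span_finset_le_card S)
    lia
  classical
  have hle1 : ∀ z ∈ P.poleRing, P.valuation z ≤ WithZero.exp 1 → z ∈ Submodule.span K {(1 : L)} := by
    intro z hz hv
    have hv1 : P.valuation z ≤ 1 := by
      by_cases hz0 : z = 0
      · simp [hz0]
      obtain ⟨n, hn⟩ := P.exists_valuation_eq_exp hz0
      have h3 := ht z hz
      rw [hn] at hv h3 ⊢
      rw [WithZero.exp_le_exp] at hv
      rw [ne_eq, WithZero.exp_inj] at h3
      rw [← WithZero.exp_zero, WithZero.exp_le_exp]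
      lia
    obtain ⟨c, rfl⟩ := exists_eq_algebraMap hres hz hv1
    rw [Algebra.algebraMap_eq_smul_one]
    exact Submodule.smul_mem _ _ (Submodule.subset_span rfl)
  have heq : ∀ (n : ℤ) (z : L), P.valuation z ≤ WithZero.exp (n + 1) →
      ¬ P.valuation z ≤ WithZero.exp n → P.valuation z = WithZero.exp (n + 1) := by
    intro n z h1 h2
    have hz0 : z ≠ 0 := by rintro rfl; simp at h2
    obtain ⟨k, hk⟩ := P.exists_valuation_eq_exp hz0
    rw [hk, WithZero.exp_le_exp] at h1 h2
    rw [hk, WithZero.exp_inj]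
    lia
  obtain ⟨u, huR, huv, hus⟩ := hne {1} 2 (by simp)
  have hu2 : P.valuation u = WithZero.exp 2 :=
    heq 1 u huv fun h => hus (by simpa using hle1 u huR h)
  have hu0 : u ≠ 0 := by rintro rfl; simp at hus
  obtain ⟨w, hwR, hwv, hws⟩ := hne {1, u} 3 (Finset.card_le_two.trans_lt (by lia))
  refine ⟨⟨u, huR, hu2⟩, w, hwR, heq 2 w hwv fun h => hws ?_⟩
  have h1s : Submodule.span K {(1 : L)} ≤ Submodule.span K (({1, u} : Finset L) : Set L) :=
    Submodule.span_mono (by simp)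
  have hmem : u ∈ Submodule.span K (({1, u} : Finset L) : Set L) := Submodule.subset_span (by simp)
  by_cases h1 : P.valuation w ≤ WithZero.exp 1
  · exact h1s (hle1 w hwR h1)
  have hw2 := heq 1 w h h1
  obtain ⟨c, -, hc⟩ := exists_valuation_sub_lt hres hu0 (hw2.trans hu2.symm)
  have h3 : w - algebraMap K L c * u ∈ Submodule.span K {(1 : L)} := by
    refine hle1 _ (sub_mem hwR (mul_mem (P.poleRing.algebraMap_mem c) huR)) ?_
    by_cases h0 : w - algebraMap K L c * u = 0
    · simp [h0]
    obtain ⟨k, hk⟩ := P.exists_valuation_eq_exp h0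
    rw [hk, hu2, WithZero.exp_lt_exp] at hc
    rw [hk, WithZero.exp_le_exp]
    lia
  have h4 : w = (w - algebraMap K L c * u) + c • u := by
    rw [Algebra.smul_def]; ring
  rw [h4]
  exact add_mem (h1s h3) (Submodule.smul_mem _ _ hmem)

end Place

end PoleRing

/-! ### The elliptic case: Weierstrass equations. -/

section EllipticCase

open IntermediateField

variable {K L : Type*} [Field K] [Field L] [Algebra K L]

namespace Place

/-- The automorphisms of `L` over `K` that preserve the valuation ring of `P`. -/
def stabilizer (P : Place K L) : Subgroup (L ≃ₐ[K] L) where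
  carrier := {σ | ∀ x, x ∈ P.valuationRing ↔ σ x ∈ P.valuationRing}
  mul_mem' {σ τ} hσ hτ x := by rw [hτ, hσ]; rfl
  one_mem' x := Iff.rfl
  inv_mem' {σ} hσ x := by
    rw [hσ (σ⁻¹ x)]
    rw [show σ (σ⁻¹ x) = x from σ.apply_symm_apply x]

variable {P : Place K L}

theorem valuation_apply {σ : L ≃ₐ[K] L} (hσ : σ ∈ P.stabilizer) (z : L) :
    P.valuation (σ z) = P.valuation z :=
  P.valuation_apply_of_stable σ hσ z

theorem fixingSubgroup_le_stabilizer {z : L} (hz : z ∈ P.poleRing) (hv : 1 < P.valuation z) :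
    fixingSubgroup K⟮z⟯ ≤ P.stabilizer := fun _ hσ =>
  stable_of_fixed hz hv
    ((IntermediateField.mem_fixingSubgroup_iff _ _).mp hσ z (mem_adjoin_simple_self K z))

theorem exists_sub_le
    (hres : ∀ z, P.valuation z ≤ 1 → ∃ c : K, P.valuation (z - algebraMap K L c) < 1)
    {z b : L} {n : ℤ} (hb : b ∈ P.poleRing) (hbv : P.valuation b = WithZero.exp (n + 1))
    (hz : z ∈ P.poleRing) (hzv : P.valuation z ≤ WithZero.exp (n + 1)) :
    ∃ c : K, z - algebraMap K L c * b ∈ P.poleRing ∧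
      P.valuation (z - algebraMap K L c * b) ≤ WithZero.exp n := by
  have hlt : ∀ x, P.valuation x < WithZero.exp (n + 1) → P.valuation x ≤ WithZero.exp n := by
    intro x hx
    by_cases hx0 : x = 0
    · simp [hx0]
    obtain ⟨k, hk⟩ := P.exists_valuation_eq_exp hx0
    rw [hk, WithZero.exp_lt_exp] at hx
    rw [hk, WithZero.exp_le_exp]
    lia
  rcases hzv.lt_or_eq with h | h
  · exact ⟨0, by simpa using hz, by simpa using hlt z h⟩
  have hb0 : b ≠ 0 := by
    rintro rfl
    rw [map_zero] at hbv
    exact WithZero.exp_ne_zero hbv.symm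
  obtain ⟨c, -, hc⟩ := exists_valuation_sub_lt hres hb0 (h.trans hbv.symm)
  exact ⟨c, sub_mem hz (mul_mem (P.poleRing.algebraMap_mem c) hb), hlt _ (hbv ▸ hc)⟩

variable [IsAlgClosed K]

theorem exists_eq_algebraMap_of_le_one
    (hres : ∀ z, P.valuation z ≤ 1 → ∃ c : K, P.valuation (z - algebraMap K L c) < 1)
    (hno : ∀ t ∈ P.poleRing, P.valuation t ≠ WithZero.exp 1)
    {z : L} (hz : z ∈ P.poleRing) (hv : P.valuation z ≤ WithZero.exp 1) :
    ∃ c : K, z = algebraMap K L c := by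
  refine exists_eq_algebraMap hres hz ?_
  by_cases hz0 : z = 0
  · simp [hz0]
  obtain ⟨n, hn⟩ := P.exists_valuation_eq_exp hz0
  have h3 := hno z hz
  rw [hn] at hv h3 ⊢
  rw [WithZero.exp_le_exp] at hv
  rw [ne_eq, WithZero.exp_inj] at h3
  rw [← WithZero.exp_zero, WithZero.exp_le_exp]
  lia

variable (hres : ∀ z, P.valuation z ≤ 1 → ∃ c : K, P.valuation (z - algebraMap K L c) < 1)
  (hno : ∀ t ∈ P.poleRing, P.valuation t ≠ WithZero.exp 1)
  {u w : L} (hu : u ∈ P.poleRing) (huv : P.valuation u = WithZero.exp 2)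
  (hw : w ∈ P.poleRing) (hwv : P.valuation w = WithZero.exp 3)

include hres hno hu huv in
theorem exists_eq_of_le_two {z : L} (hz : z ∈ P.poleRing) (hv : P.valuation z ≤ WithZero.exp 2) :
    ∃ a b : K, z = algebraMap K L a * u + algebraMap K L b := by
  obtain ⟨a, ha, hav⟩ := exists_sub_le (n := 1) hres hu huv hz hv
  obtain ⟨b, hb⟩ := exists_eq_algebraMap_of_le_one hres hno ha hav
  exact ⟨a, b, by rw [← hb]; ring⟩

include hres hno hu huv hw hwv in
theorem exists_eq_of_le_three {z : L} (hz : z ∈ P.poleRing)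
    (hv : P.valuation z ≤ WithZero.exp 3) :
    ∃ a b c : K, z = algebraMap K L a * w + algebraMap K L b * u + algebraMap K L c := by
  obtain ⟨a, ha, hav⟩ := exists_sub_le (n := 2) hres hw hwv hz hv
  obtain ⟨b, c, hb⟩ := exists_eq_of_le_two hres hno hu huv ha hav
  exact ⟨a, b, c, by rw [add_assoc, ← hb]; ring⟩

include huv hwv in
omit [IsAlgClosed K] in
-- Polynomials in `u` have even pole order, and such polynomials times `w` have odd pole order, so
-- nothing cancels between the two.
theorem coeff_eq_zero {a₀ a₁ a₂ a₃ b₀ b₁ : K}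
    (h : algebraMap K L a₀ + algebraMap K L a₁ * u + algebraMap K L a₂ * u ^ 2 +
      algebraMap K L a₃ * u ^ 3 + (algebraMap K L b₀ + algebraMap K L b₁ * u) * w = 0) :
    a₀ = 0 ∧ a₁ = 0 ∧ a₂ = 0 ∧ a₃ = 0 ∧ b₀ = 0 ∧ b₁ = 0 := by
  set A : Polynomial K := Polynomial.C a₃ * Polynomial.X ^ 3 + Polynomial.C a₂ * Polynomial.X ^ 2 +
    Polynomial.C a₁ * Polynomial.X + Polynomial.C a₀ with hA
  set B : Polynomial K := Polynomial.C b₁ * Polynomial.X + Polynomial.C b₀ with hB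
  have h1 : Polynomial.aeval u A + Polynomial.aeval u B * w = 0 := by
    rw [← h, hA, hB]
    simp only [map_add, map_mul, map_pow, Polynomial.aeval_C, Polynomial.aeval_X]
    ring
  have hw0 : w ≠ 0 := by
    rintro rfl
    rw [map_zero] at hwv
    exact WithZero.exp_ne_zero hwv.symm
  have hB0 : B = 0 := by
    by_contra hB0
    have h2 : P.valuation (Polynomial.aeval u A) = P.valuation (Polynomial.aeval u B * w) := by
      rw [eq_neg_of_add_eq_zero_left h1, Valuation.map_neg]
    rw [map_mul, valuation_aeval (m := 2) (by simp) (by simpa using huv) hB0, hwv,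
      ← WithZero.exp_add] at h2
    by_cases hA0 : A = 0
    · rw [hA0, map_zero, map_zero] at h2
      exact WithZero.exp_ne_zero h2.symm
    · rw [valuation_aeval (m := 2) (by simp) (by simpa using huv) hA0, WithZero.exp_inj] at h2
      lia
  have hA0 : A = 0 := by
    by_contra hA0
    have h2 := valuation_aeval (P := P) (m := 2) (by simp) (by simpa using huv) hA0
    rw [hB0, map_zero, zero_mul, add_zero] at h1
    rw [h1, map_zero] at h2
    exact WithZero.exp_ne_zero h2.symm
  have cA : ∀ n, A.coeff n = 0 := by simp [hA0]
  have cB : ∀ n, B.coeff n = 0 := by simp [hB0]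
  refine ⟨by simpa [hA, Polynomial.coeff_X, Polynomial.coeff_C] using cA 0,
    by simpa [hA, Polynomial.coeff_X, Polynomial.coeff_C] using cA 1,
    by simpa [hA, Polynomial.coeff_X, Polynomial.coeff_C] using cA 2,
    by simpa [hA, Polynomial.coeff_X, Polynomial.coeff_C] using cA 3,
    by simpa [hB, Polynomial.coeff_X, Polynomial.coeff_C] using cB 0,
    by simpa [hB, Polynomial.coeff_X, Polynomial.coeff_C] using cB 1⟩

include hno in
omit [IsAlgClosed K] in
-- The pole ring is integrally closed, as an intersection of valuation rings. This excludes singular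
-- Weierstrass equations, which would produce a function of pole order one.
theorem valuation_ne_of_sq_mem {z : L} (hz : z ^ 2 ∈ P.poleRing) :
    P.valuation z ≠ WithZero.exp 1 := by
  refine hno z fun V hV hne => ?_
  rcases V.mem_or_inv_mem z with h | h
  · exact h
  · by_cases hz0 : z = 0
    · rw [hz0]; exact V.zero_mem
    have := V.mul_mem _ _ (hz V hV hne) h
    rwa [pow_two, mul_assoc, mul_inv_cancel₀ hz0, mul_one] at this

include hres hno hu huv hw hwv in
theorem exists_weierstrass : ∃ a₀ a₁ c₀ c₁ c₂ c₃ : K, c₃ ≠ 0 ∧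
    w ^ 2 + (algebraMap K L a₁ * u + algebraMap K L a₀) * w =
      algebraMap K L c₃ * u ^ 3 + algebraMap K L c₂ * u ^ 2 + algebraMap K L c₁ * u +
        algebraMap K L c₀ := by
  have h2 : P.valuation (w ^ 2) = WithZero.exp 6 := by
    rw [map_pow, hwv, ← WithZero.exp_nsmul]; simp
  obtain ⟨c₃, h3, h3v⟩ := exists_sub_le (n := 5) (b := u ^ 3) hres (pow_mem hu 3)
    (by rw [map_pow, huv, ← WithZero.exp_nsmul]; simp) (pow_mem hw 2) (by rw [h2]; rfl)
  obtain ⟨b₁, h4, h4v⟩ := exists_sub_le (n := 4) (b := u * w) hres (mul_mem hu hw)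
    (by rw [map_mul, huv, hwv, ← WithZero.exp_add]; rfl) h3 h3v
  obtain ⟨c₂, h5, h5v⟩ := exists_sub_le (n := 3) (b := u ^ 2) hres (pow_mem hu 2)
    (by rw [map_pow, huv, ← WithZero.exp_nsmul]; simp) h4 h4v
  obtain ⟨b₀, c₁, c₀, h6⟩ := exists_eq_of_le_three hres hno hu huv hw hwv h5 h5v
  refine ⟨-b₀, -b₁, c₀, c₁, c₂, c₃, ?_, ?_⟩
  -- `w ^ 2` has pole order exactly six, so the multiple of `u ^ 3` removed first is nonzero.
  · rintro rfl
    rw [map_zero, zero_mul, sub_zero, h2, WithZero.exp_le_exp] at h3v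
    lia
  · rw [map_neg, map_neg]
    linear_combination h6

include hres hno hu huv hw hwv in
-- The monomials `u ^ k` and `u ^ k * w` realize every pole order from two on, so by induction on
-- the pole order the pole ring is generated by `u` and `w`.
theorem apply_eq_self {σ : L ≃ₐ[K] L} (hσu : σ u = u) (hσw : σ w = w) {z : L}
    (hz : z ∈ P.poleRing) : σ z = z := by
  have key : ∀ n : ℕ, ∀ z ∈ P.poleRing, P.valuation z ≤ WithZero.exp (n : ℤ) → σ z = z := by
    intro n
    induction n using Nat.strong_induction_on with
    | _ n ih =>
      intro z hz hv
      rcases Nat.lt_or_ge n 2 with h | h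
      · obtain ⟨c, rfl⟩ := exists_eq_algebraMap_of_le_one hres hno hz
          (hv.trans (WithZero.exp_le_exp.mpr (by lia)))
        exact σ.commutes c
      obtain ⟨b, hb, hbv, hσb⟩ : ∃ b ∈ P.poleRing, P.valuation b = WithZero.exp (n : ℤ) ∧ σ b = b := by
        rcases Nat.even_or_odd' n with ⟨k, hk | hk⟩
        · refine ⟨u ^ k, pow_mem hu k, ?_, by rw [map_pow, hσu]⟩
          rw [map_pow, huv, ← WithZero.exp_nsmul, WithZero.exp_inj, nsmul_eq_mul]
          lia
        · refine ⟨u ^ (k - 1) * w, mul_mem (pow_mem hu _) hw, ?_, by rw [map_mul, map_pow, hσu, hσw]⟩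
          rw [map_mul, map_pow, huv, hwv, ← WithZero.exp_nsmul, ← WithZero.exp_add,
            WithZero.exp_inj, nsmul_eq_mul]
          lia
      obtain ⟨c, hc, hcv⟩ := exists_sub_le (n := (n - 1 : ℕ)) hres hb
        (by rw [hbv]; congr 1; lia) hz (hv.trans (WithZero.exp_le_exp.mpr (by lia)))
      have := ih (n - 1) (by lia) _ hc hcv
      rw [map_sub, map_mul, hσb, AlgEquiv.commutes] at this
      exact sub_left_injective this
  by_cases hz0 : z = 0
  · rw [hz0, map_zero]
  obtain ⟨n, hn⟩ := P.exists_valuation_eq_exp hz0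
  exact key n.toNat z hz (by rw [hn, WithZero.exp_le_exp]; lia)

include hres hno hu huv in
theorem exists_apply_eq_two {σ : L ≃ₐ[K] L} (hσ : σ ∈ P.stabilizer) :
    ∃ α β : K, α ≠ 0 ∧ σ u = algebraMap K L α * u + algebraMap K L β := by
  obtain ⟨α, β, h⟩ := exists_eq_of_le_two hres hno hu huv (apply_mem_poleRing hσ hu)
    (by rw [valuation_apply hσ, huv])
  refine ⟨α, β, ?_, h⟩
  rintro rfl
  have h1 := valuation_apply hσ u
  rw [h, map_zero, zero_mul, zero_add, huv] at h1
  have h2 := P.valuation_algebraMap_le_one β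
  rw [h1, ← WithZero.exp_zero, WithZero.exp_le_exp] at h2
  lia

include hres hno hu huv hw hwv in
theorem exists_apply_eq_three {σ : L ≃ₐ[K] L} (hσ : σ ∈ P.stabilizer) :
    ∃ γ δ ε : K, γ ≠ 0 ∧
      σ w = algebraMap K L γ * w + algebraMap K L δ * u + algebraMap K L ε := by
  obtain ⟨γ, δ, ε, h⟩ := exists_eq_of_le_three hres hno hu huv hw hwv (apply_mem_poleRing hσ hw)
    (by rw [valuation_apply hσ, hwv])
  refine ⟨γ, δ, ε, ?_, h⟩
  rintro rfl
  have h1 := valuation_apply hσ w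
  have h2 : P.valuation (algebraMap K L δ * u) ≤ WithZero.exp 2 := by
    rw [map_mul, huv]
    exact mul_le_of_le_one_left' (P.valuation_algebraMap_le_one δ)
  have h3 : P.valuation (algebraMap K L ε) ≤ WithZero.exp 2 :=
    (P.valuation_algebraMap_le_one ε).trans (by
      rw [← WithZero.exp_zero, WithZero.exp_le_exp]; lia)
  have h4 := P.valuation.map_add_le h2 h3
  rw [h, map_zero, zero_mul, zero_add, hwv] at h1
  rw [h1, WithZero.exp_le_exp] at h4
  lia

end Place

end EllipticCase

/-! ### Automorphisms fixing a place of an elliptic function field. -/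

section EllipticAutomorphisms

open IntermediateField

variable {K L : Type*} [Field K] [Field L] [Algebra K L]

namespace Place

variable {P : Place K L} {u w : L} {a₀ a₁ c₀ c₁ c₂ c₃ : K}

theorem apply_eq_or_of_apply_eq
    (heq : w ^ 2 + (algebraMap K L a₁ * u + algebraMap K L a₀) * w =
      algebraMap K L c₃ * u ^ 3 + algebraMap K L c₂ * u ^ 2 + algebraMap K L c₁ * u +
        algebraMap K L c₀)
    {σ : L ≃ₐ[K] L} (hσ : σ u = u) :
    σ w = w ∨ σ w = -w - (algebraMap K L a₁ * u + algebraMap K L a₀) := by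
  have h := congrArg σ heq
  simp only [map_add, map_mul, map_pow, AlgEquiv.commutes, hσ] at h
  have h2 : (σ w - w) * (σ w - (-w - (algebraMap K L a₁ * u + algebraMap K L a₀))) = 0 := by
    linear_combination h - heq
  rcases mul_eq_zero.mp h2 with h3 | h3
  · exact Or.inl (sub_eq_zero.mp h3)
  · exact Or.inr (sub_eq_zero.mp h3)

theorem sq_eq_one_of_apply_eq
    (hgen : ∀ σ : L ≃ₐ[K] L, σ u = u → σ w = w → σ = 1)
    (heq : w ^ 2 + (algebraMap K L a₁ * u + algebraMap K L a₀) * w =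
      algebraMap K L c₃ * u ^ 3 + algebraMap K L c₂ * u ^ 2 + algebraMap K L c₁ * u +
        algebraMap K L c₀)
    {σ : L ≃ₐ[K] L} (hσ : σ u = u) : σ ^ 2 = 1 := by
  refine hgen _ (by rw [pow_two, AlgEquiv.mul_apply, hσ, hσ]) ?_
  rw [pow_two, AlgEquiv.mul_apply]
  rcases apply_eq_or_of_apply_eq heq hσ with h | h
  · rw [h, h]
  · rw [h, map_sub, map_neg, h, map_add, map_mul, hσ, AlgEquiv.commutes, AlgEquiv.commutes]
    ring

/-- Over `K(u)` the function `w` is a root of the Weierstrass quadratic; the only nontrivial choice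
is the other root, which is the inversion of the group law. -/
theorem eq_of_apply_eq
    (hgen : ∀ σ : L ≃ₐ[K] L, σ u = u → σ w = w → σ = 1)
    (heq : w ^ 2 + (algebraMap K L a₁ * u + algebraMap K L a₀) * w =
      algebraMap K L c₃ * u ^ 3 + algebraMap K L c₂ * u ^ 2 + algebraMap K L c₁ * u +
        algebraMap K L c₀)
    {σ τ : L ≃ₐ[K] L} (hσ : σ u = u) (hτ : τ u = u) (hσ1 : σ ≠ 1) (hτ1 : τ ≠ 1) : σ = τ := by
  have h1 := (apply_eq_or_of_apply_eq heq hσ).resolve_left fun h => hσ1 (hgen _ hσ h)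
  have h2 := (apply_eq_or_of_apply_eq heq hτ).resolve_left fun h => hτ1 (hgen _ hτ h)
  have h3 : τ * σ = 1 := by
    refine hgen _ (by rw [AlgEquiv.mul_apply, hσ, hτ]) ?_
    rw [AlgEquiv.mul_apply, h1, map_sub, map_neg, h2, map_add, map_mul, hτ, AlgEquiv.commutes,
      AlgEquiv.commutes]
    ring
  have h4 := sq_eq_one_of_apply_eq hgen heq hτ
  rw [pow_two] at h4
  exact mul_left_cancel (h3.trans h4.symm)

theorem eq_one_of_odd_of_pow_two_pow {G : Type*} [Group G] {H : Subgroup G}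
    (hodd : Odd (Nat.card H)) {σ : G} (hσ : σ ∈ H) {k : ℕ} (h : σ ^ 2 ^ k = 1) : σ = 1 := by
  have h1 : orderOf σ ∣ 2 ^ k := orderOf_dvd_of_pow_eq_one h
  have h2 : orderOf σ ∣ Nat.card H := by
    have := orderOf_dvd_natCard (⟨σ, hσ⟩ : H)
    rwa [Subgroup.orderOf_mk] at this
  have h3 : Nat.Coprime (2 ^ k) (Nat.card H) :=
    Nat.Coprime.pow_left k (Nat.coprime_two_left.mpr hodd)
  exact orderOf_eq_one_iff.mp (Nat.eq_one_of_dvd_coprimes h3 h1 h2)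

theorem exists_involution {G : Type*} [Group G] {H : Subgroup G} [Finite H]
    (heven : ¬ Odd (Nat.card H)) : ∃ σ ∈ H, σ ≠ 1 ∧ σ ^ 2 = 1 := by
  rw [Nat.not_odd_iff_even, even_iff_two_dvd] at heven
  have : Fact (Nat.Prime 2) := ⟨Nat.prime_two⟩
  obtain ⟨σ, hσ⟩ := exists_prime_orderOf_dvd_card' 2 heven
  refine ⟨σ, σ.2, ?_, ?_⟩
  · intro h
    rw [show σ = 1 from Subtype.ext h, orderOf_one] at hσ
    lia
  · have := pow_orderOf_eq_one σ
    rw [hσ] at this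
    exact congrArg Subtype.val this

variable [IsAlgClosed K]
  (hres : ∀ z, P.valuation z ≤ 1 → ∃ c : K, P.valuation (z - algebraMap K L c) < 1)
  (hno : ∀ t ∈ P.poleRing, P.valuation t ≠ WithZero.exp 1)
  (hu : u ∈ P.poleRing) (huv : P.valuation u = WithZero.exp 2)
  (hw : w ∈ P.poleRing) (hwv : P.valuation w = WithZero.exp 3)
  (hgen : ∀ σ : L ≃ₐ[K] L, σ u = u → σ w = w → σ = 1)

/-! ### Characteristic different from two. -/

section OddCharacteristic

variable (h2 : (2 : K) ≠ 0)
  (heq : w ^ 2 = algebraMap K L c₃ * u ^ 3 + algebraMap K L c₂ * u ^ 2 + algebraMap K L c₁ * u +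
    algebraMap K L c₀)

include hres hno hu huv hw hwv h2 heq in
-- Compare coefficients after applying `σ` to the equation: the terms `2 * γ * δ` at `u * w` and `2
-- * γ * ε` at `w` must vanish, so `w` is only scaled.
theorem apply_eq_of_two_ne_zero {σ : L ≃ₐ[K] L} (hσ : σ ∈ P.stabilizer) :
    ∃ α β γ : K, α ≠ 0 ∧ γ ≠ 0 ∧ σ u = algebraMap K L α * u + algebraMap K L β ∧
      σ w = algebraMap K L γ * w ∧ γ ^ 2 * c₃ = c₃ * α ^ 3 ∧
      γ ^ 2 * c₂ = c₃ * 3 * α ^ 2 * β + c₂ * α ^ 2 ∧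
      γ ^ 2 * c₁ = c₃ * 3 * α * β ^ 2 + c₂ * 2 * α * β + c₁ * α ∧
      γ ^ 2 * c₀ = c₃ * β ^ 3 + c₂ * β ^ 2 + c₁ * β + c₀ := by
  obtain ⟨α, β, hα, h1⟩ := exists_apply_eq_two hres hno hu huv hσ
  obtain ⟨γ, δ, ε, hγ, h3⟩ := exists_apply_eq_three hres hno hu huv hw hwv hσ
  have h := congrArg σ heq
  simp only [map_add, map_mul, map_pow, AlgEquiv.commutes, h1, h3] at h
  obtain ⟨e0, e1, e2, e3, e4, e5⟩ := coeff_eq_zero huv hwv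
    (a₀ := γ ^ 2 * c₀ + ε ^ 2 - (c₃ * β ^ 3 + c₂ * β ^ 2 + c₁ * β + c₀))
    (a₁ := γ ^ 2 * c₁ + 2 * δ * ε - (c₃ * 3 * α * β ^ 2 + c₂ * 2 * α * β + c₁ * α))
    (a₂ := γ ^ 2 * c₂ + δ ^ 2 - (c₃ * 3 * α ^ 2 * β + c₂ * α ^ 2))
    (a₃ := γ ^ 2 * c₃ - c₃ * α ^ 3) (b₀ := 2 * γ * ε) (b₁ := 2 * γ * δ) (by
      simp only [map_add, map_sub, map_mul, map_pow, map_ofNat]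
      linear_combination h - algebraMap K L γ ^ 2 * heq)
  have hδ : δ = 0 := by simpa [h2, hγ] using e5
  have hε : ε = 0 := by simpa [h2, hγ] using e4
  subst hδ hε
  refine ⟨α, β, γ, hα, hγ, h1, by simpa using h3, ?_, ?_, ?_, ?_⟩
  · linear_combination e3
  · linear_combination e2
  · linear_combination e1
  · linear_combination e0

include hres hno hu huv hw hwv h2 heq in
-- From `σ ^ 2 = 1` come `α ^ 2 = 1`, `γ ^ 2 = 1` and `(α + 1) * β = 0`; with `γ ^ 2 = α ^ 3` this
-- gives `α = 1` and then `2 * β = 0`.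
theorem apply_eq_self_of_sq_eq_one (hc : c₃ ≠ 0) {σ : L ≃ₐ[K] L} (hσ : σ ∈ P.stabilizer)
    (hsq : σ ^ 2 = 1) : σ u = u := by
  obtain ⟨α, β, γ, hα, hγ, h1, h3, e3, -⟩ :=
    apply_eq_of_two_ne_zero hres hno hu huv hw hwv h2 heq hσ
  have hu2 : σ (σ u) = u := by rw [← AlgEquiv.mul_apply, ← pow_two, hsq]; rfl
  have hw2 : σ (σ w) = w := by rw [← AlgEquiv.mul_apply, ← pow_two, hsq]; rfl
  rw [h1, map_add, map_mul, AlgEquiv.commutes, AlgEquiv.commutes, h1] at hu2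
  rw [h3, map_mul, AlgEquiv.commutes, h3] at hw2
  obtain ⟨f0, f1, -⟩ := coeff_eq_zero huv hwv (a₀ := α * β + β) (a₁ := α ^ 2 - 1)
    (a₂ := 0) (a₃ := 0) (b₀ := 0) (b₁ := 0) (by
      simp only [map_add, map_sub, map_mul, map_pow, map_one, map_zero]
      linear_combination hu2)
  obtain ⟨-, -, -, -, g0, -⟩ := coeff_eq_zero huv hwv (a₀ := 0) (a₁ := 0)
    (a₂ := 0) (a₃ := 0) (b₀ := γ ^ 2 - 1) (b₁ := 0) (by
      simp only [map_sub, map_pow, map_one, map_zero]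
      linear_combination hw2)
  have hα1 : α = 1 := by
    have h4 : α ^ 3 = 1 := mul_left_cancel₀ hc (by linear_combination -e3 + c₃ * g0)
    linear_combination h4 - α * f1
  subst hα1
  have hβ : β = 0 := by
    have : 2 * β = 0 := by linear_combination f0
    simpa [h2] using this
  rw [h1, hβ]
  simp

include hno hu huv hwv heq in
omit [IsAlgClosed K] in
-- A double root `r` would make `w / (u - r)` a function with square in the pole ring and pole order
-- `3 - 2 = 1`.
theorem discriminant_condition (hc : c₃ ≠ 0) {f : Polynomial K}
    (hf : f = Polynomial.C c₃ * Polynomial.X ^ 3 + Polynomial.C c₂ * Polynomial.X ^ 2 +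
      Polynomial.C c₁ * Polynomial.X + Polynomial.C c₀) : f.roots.Nodup := by
  classical
  have hf0 : f ≠ 0 := by
    intro h
    have := congrArg (fun p => Polynomial.coeff p 3) h
    simp [hf] at this
    exact hc this
  rw [Multiset.nodup_iff_count_le_one]
  intro r
  rw [Polynomial.count_roots]
  by_contra! h
  obtain ⟨g, hg⟩ := (Polynomial.le_rootMultiplicity_iff hf0).mp (show 2 ≤ _ from h)
  have hw2 : w ^ 2 = (u - algebraMap K L r) ^ 2 * Polynomial.aeval u g := by
    have := congrArg (Polynomial.aeval u) hg
    simp only [hf, map_add, map_mul, map_sub, map_pow, Polynomial.aeval_C, Polynomial.aeval_X]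
      at this
    rw [heq, ← this]
  have hur : P.valuation (u - algebraMap K L r) = WithZero.exp 2 := by
    rw [Valuation.map_sub_eq_of_lt_left, huv]
    refine (P.valuation_algebraMap_le_one r).trans_lt ?_
    rw [huv, ← WithZero.exp_zero, WithZero.exp_lt_exp]
    lia
  have hur0 : u - algebraMap K L r ≠ 0 := by
    intro h0
    rw [h0, map_zero] at hur
    exact WithZero.exp_ne_zero hur.symm
  refine valuation_ne_of_sq_mem (z := w / (u - algebraMap K L r)) hno ?_ ?_
  · rw [div_pow, hw2, mul_div_cancel_left₀ _ (pow_ne_zero 2 hur0)]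
    exact (Subalgebra.aeval_coe P.poleRing ⟨u, hu⟩ g) ▸ Subtype.mem _
  · rw [map_div₀, hwv, hur, ← WithZero.exp_sub]
    rfl

include hres hno hu huv hw hwv h2 heq hgen in
-- The group permutes the three roots of the cubic. An element acting trivially fixes `u`, hence has
-- square one and is trivial in a group of odd order. So the order is odd and divides `6`.
theorem card_le_three_of_two_ne_zero (hc : c₃ ≠ 0) {G : Subgroup (L ≃ₐ[K] L)}
    (hG : G ≤ P.stabilizer) (hodd : Odd (Nat.card G)) : Nat.card G ≤ 3 := by
  classical
  obtain ⟨f, hf⟩ : ∃ f : Polynomial K, f = Polynomial.C c₃ * Polynomial.X ^ 3 +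
    Polynomial.C c₂ * Polynomial.X ^ 2 + Polynomial.C c₁ * Polynomial.X + Polynomial.C c₀ :=
    ⟨_, rfl⟩
  have hnodup := discriminant_condition hno hu huv hwv heq hc hf
  have hcard : f.roots.toFinset.card = 3 := by
    rw [Multiset.toFinset_card_of_nodup hnodup, ← (IsAlgClosed.splits f).natDegree_eq_card_roots, hf]
    exact Polynomial.natDegree_cubic hc
  have hf0 : f ≠ 0 := by
    rintro rfl
    simp at hcard
  have hroot : ∀ r, r ∈ f.roots.toFinset ↔ c₃ * r ^ 3 + c₂ * r ^ 2 + c₁ * r + c₀ = 0 := by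
    intro r
    rw [Multiset.mem_toFinset, Polynomial.mem_roots hf0, Polynomial.IsRoot, hf]
    simp
  choose! α β γ hα hγ h1 h3 e3 e2 e1 e0 using
    fun (σ : L ≃ₐ[K] L) (hσ : σ ∈ P.stabilizer) =>
      apply_eq_of_two_ne_zero hres hno hu huv hw hwv h2 heq hσ
  have hαβ : ∀ σ ∈ P.stabilizer, ∀ a b : K, σ u = algebraMap K L a * u + algebraMap K L b →
      α σ = a ∧ β σ = b := by
    intro σ hσ a b h
    obtain ⟨f0, f1, -⟩ := coeff_eq_zero huv hwv (a₀ := β σ - b) (a₁ := α σ - a)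
      (a₂ := 0) (a₃ := 0) (b₀ := 0) (b₁ := 0) (by
        simp only [map_sub, map_zero]
        linear_combination h - h1 σ hσ)
    exact ⟨sub_eq_zero.mp f1, sub_eq_zero.mp f0⟩
  have hmem : ∀ σ ∈ P.stabilizer, ∀ r ∈ f.roots.toFinset, (r - β σ) / α σ ∈ f.roots.toFinset := by
    intro σ hσ r hr
    rw [hroot] at hr ⊢
    have ha := hα σ hσ
    obtain ⟨s, hs⟩ : ∃ s, r = α σ * s + β σ := ⟨(r - β σ) / α σ, by field_simp; ring⟩
    rw [hs] at hr ⊢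
    rw [add_sub_cancel_right, mul_div_cancel_left₀ _ ha]
    have : γ σ ^ 2 * (c₃ * s ^ 3 + c₂ * s ^ 2 + c₁ * s + c₀) = 0 := by
      linear_combination hr + e0 σ hσ + s * e1 σ hσ + s ^ 2 * e2 σ hσ + s ^ 3 * e3 σ hσ
    exact (mul_eq_zero.mp this).resolve_left (pow_ne_zero 2 (hγ σ hσ))
  -- The substitutions `u ↦ α u + β` compose in the reverse order, so the inverse substitution on
  -- roots gives a left action.
  let act : MulAction G f.roots.toFinset :=
    { smul := fun σ r => ⟨(r - β σ) / α σ, hmem σ (hG σ.2) r r.2⟩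
      one_smul := by
        intro r
        obtain ⟨ha, hb⟩ := hαβ 1 (one_mem _) 1 0 (by simp)
        apply Subtype.ext
        change (r - β 1) / α 1 = (r : K)
        rw [ha, hb, sub_zero, div_one]
      mul_smul := by
        intro σ τ r
        have hσ := hG σ.2
        have hτ := hG τ.2
        obtain ⟨ha, hb⟩ := hαβ (σ * τ) (mul_mem hσ hτ) (α τ * α σ) (α τ * β σ + β τ) (by
          rw [AlgEquiv.mul_apply, h1 _ hτ, map_add, map_mul, AlgEquiv.commutes, AlgEquiv.commutes,
            h1 _ hσ]
          simp only [map_add, map_mul]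
          ring)
        apply Subtype.ext
        change (r - β (σ * τ)) / α (σ * τ) = ((r - β τ) / α τ - β σ) / α σ
        rw [ha, hb]
        have := hα σ hσ
        have := hα τ hτ
        field_simp
        ring }
  have hinj : Function.Injective (MulAction.toPermHom G f.roots.toFinset) := by
    rw [injective_iff_map_eq_one]
    intro σ hσ
    have hst := hG σ.2
    have ha := hα σ hst
    have hfix : ∀ r ∈ f.roots.toFinset, (r - β σ) / α σ = r := fun r hr =>
      congrArg Subtype.val (Equiv.congr_fun hσ ⟨r, hr⟩)
    obtain ⟨r, s, hr, hs, hrs⟩ := Finset.one_lt_card_iff.mp (hcard ▸ (by lia : 1 < 3))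
    have hr' := hfix r hr
    have hs' := hfix s hs
    rw [div_eq_iff ha] at hr' hs'
    have hα1 : α σ = 1 := by
      have : (α σ - 1) * (r - s) = 0 := by linear_combination hs' - hr'
      exact sub_eq_zero.mp ((mul_eq_zero.mp this).resolve_right (sub_ne_zero.mpr hrs))
    have hβ0 : β σ = 0 := by
      rw [hα1] at hr'
      linear_combination -hr'
    have hfixu : (σ : L ≃ₐ[K] L) u = u := by
      rw [h1 σ hst, hα1, hβ0]
      simp
    apply Subtype.ext
    refine eq_one_of_odd_of_pow_two_pow hodd σ.2 (k := 1) ?_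
    rw [pow_one]
    exact sq_eq_one_of_apply_eq (a₀ := 0) (a₁ := 0) hgen (by simpa using heq) hfixu
  have hdvd := Subgroup.card_dvd_of_injective _ hinj
  rw [Nat.card_eq_fintype_card (α := Equiv.Perm _), Fintype.card_perm, Fintype.card_coe, hcard] at hdvd
  have h6 : Nat.factorial 3 = 2 * 3 := rfl
  rw [h6] at hdvd
  exact Nat.le_of_dvd (by lia) ((Nat.coprime_two_right.mpr hodd).dvd_of_dvd_mul_left hdvd)

end OddCharacteristic

/-! ### Characteristic two. -/

section EvenCharacteristic

variable (h2 : (2 : K) = 0)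
  (heq : w ^ 2 + (algebraMap K L a₁ * u + algebraMap K L a₀) * w =
    algebraMap K L c₃ * u ^ 3 + algebraMap K L c₁ * u + algebraMap K L c₀)

include hres hno hu huv hw hwv h2 heq in
theorem apply_eq_of_two_eq_zero (hc : c₃ ≠ 0) {σ : L ≃ₐ[K] L} (hσ : σ ∈ P.stabilizer) :
    ∃ α β γ δ ε : K, α ≠ 0 ∧ γ ≠ 0 ∧ σ u = algebraMap K L α * u + algebraMap K L β ∧
      σ w = algebraMap K L γ * w + algebraMap K L δ * u + algebraMap K L ε ∧
      γ ^ 2 = α ^ 3 ∧ a₁ * (γ - α) = 0 ∧ a₁ * β + a₀ * (1 - γ) = 0 ∧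
      (a₁ = 0 → δ ^ 2 = c₃ * α ^ 2 * β) := by
  obtain ⟨α, β, hα, h1⟩ := exists_apply_eq_two hres hno hu huv hσ
  obtain ⟨γ, δ, ε, hγ, h3⟩ := exists_apply_eq_three hres hno hu huv hw hwv hσ
  have h := congrArg σ heq
  simp only [map_add, map_mul, map_pow, AlgEquiv.commutes, h1, h3] at h
  obtain ⟨-, -, e2, e3, e4, e5⟩ := coeff_eq_zero huv hwv
    (a₀ := γ ^ 2 * c₀ + ε ^ 2 + (a₁ * β + a₀) * ε - (c₃ * β ^ 3 + c₁ * β + c₀))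
    (a₁ := γ ^ 2 * c₁ + 2 * δ * ε + a₁ * α * ε + (a₁ * β + a₀) * δ -
      (c₃ * 3 * α * β ^ 2 + c₁ * α))
    (a₂ := δ ^ 2 + a₁ * α * δ - c₃ * 3 * α ^ 2 * β)
    (a₃ := γ ^ 2 * c₃ - c₃ * α ^ 3)
    (b₀ := 2 * γ * ε + (a₁ * β + a₀) * γ - γ ^ 2 * a₀)
    (b₁ := 2 * γ * δ + a₁ * α * γ - γ ^ 2 * a₁) (by
      simp only [map_add, map_sub, map_mul, map_pow, map_ofNat]
      linear_combination h - algebraMap K L γ ^ 2 * heq)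
  refine ⟨α, β, γ, δ, ε, hα, hγ, h1, h3, mul_left_cancel₀ hc (by linear_combination e3),
    mul_left_cancel₀ hγ (by linear_combination -e5 + γ * δ * h2),
    mul_left_cancel₀ hγ (by linear_combination e4 - γ * ε * h2), ?_⟩
  rintro rfl
  linear_combination e2 + c₃ * α ^ 2 * β * h2

include hno hu huv hwv h2 heq in
-- If both `a₀` and `a₁` vanish, then `(w + √c₀) ^ 2 = u * (√c₃ * u + √c₁) ^ 2`, and the resulting
-- square root of `u` has pole order one.
theorem coeff_ne_zero_of_two_eq_zero (hc : c₃ ≠ 0) (h1 : a₁ = 0) : a₀ ≠ 0 := by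
  rintro rfl
  subst h1
  obtain ⟨s, hs⟩ := IsAlgClosed.exists_pow_nat_eq c₀ (n := 2) (by lia)
  obtain ⟨e, he⟩ := IsAlgClosed.exists_pow_nat_eq c₃ (n := 2) (by lia)
  obtain ⟨f, hf⟩ := IsAlgClosed.exists_pow_nat_eq c₁ (n := 2) (by lia)
  have he0 : e ≠ 0 := by
    rintro rfl
    simp at he
    exact hc he.symm
  have h2L : (2 : L) = 0 := by rw [← map_ofNat (algebraMap K L) 2, h2, map_zero]
  set d := algebraMap K L e * u + algebraMap K L f with hd
  have hsmall : ∀ c : K, ∀ n : ℤ, 0 < n → P.valuation (algebraMap K L c) < WithZero.exp n := by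
    intro c n hn
    refine (P.valuation_algebraMap_le_one c).trans_lt ?_
    rwa [← WithZero.exp_zero, WithZero.exp_lt_exp]
  have heu : P.valuation (algebraMap K L e * u) = WithZero.exp 2 := by
    rw [map_mul, P.valuation_algebraMap he0, huv, one_mul]
  have hdv : P.valuation d = WithZero.exp 2 := by
    rw [hd, Valuation.map_add_eq_of_lt_left, heu]
    rw [heu]
    exact hsmall f 2 (by lia)
  have hd0 : d ≠ 0 := by
    intro h0
    rw [h0, map_zero] at hdv
    exact WithZero.exp_ne_zero hdv.symm
  have hsq : (w + algebraMap K L s) ^ 2 = u * d ^ 2 := by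
    rw [hd]
    have hs' := congrArg (algebraMap K L) hs
    have he' := congrArg (algebraMap K L) he
    have hf' := congrArg (algebraMap K L) hf
    rw [map_pow] at hs' he' hf'
    rw [map_zero] at heq
    linear_combination heq + hs' - u ^ 3 * he' - u * hf' +
      (w * algebraMap K L s - u ^ 2 * algebraMap K L e * algebraMap K L f
        + algebraMap K L c₀) * h2L
  refine valuation_ne_of_sq_mem (z := (w + algebraMap K L s) / d) hno ?_ ?_
  · rw [div_pow, hsq, mul_div_cancel_right₀ _ (pow_ne_zero 2 hd0)]
    exact hu
  · rw [map_div₀, hdv, Valuation.map_add_eq_of_lt_left, hwv, ← WithZero.exp_sub]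
    · rfl
    · rw [hwv]
      exact hsmall s 3 (by lia)

include hres hno hu huv hw hwv h2 heq in
-- If `a₁ ≠ 0`, then `γ = α`, and `γ ^ 2 = α ^ 3` gives `α = 1`, whence `a₁ * β = 0`. If `a₁ = 0`,
-- then `γ = 1`, and `α ^ 3 = α ^ 2 = 1`; the square of `σ` on `w` gives `δ * β = 0`, while `δ ^ 2 =
-- c₃ * β`.
theorem apply_eq_self_of_sq_eq_one' (hc : c₃ ≠ 0) {σ : L ≃ₐ[K] L} (hσ : σ ∈ P.stabilizer)
    (hsq : σ ^ 2 = 1) : σ u = u := by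
  obtain ⟨α, β, γ, δ, ε, hα, hγ, h1, h3, k1, k2, k3, k4⟩ :=
    apply_eq_of_two_eq_zero hres hno hu huv hw hwv h2 heq hc hσ
  suffices hs : α = 1 ∧ β = 0 by
    rw [h1, hs.1, hs.2]
    simp
  by_cases ha : a₁ = 0
  · have ha0 := coeff_ne_zero_of_two_eq_zero hno hu huv hwv h2 heq hc ha
    have hγ1 : γ = 1 := by
      have : a₀ * (1 - γ) = 0 := by simpa [ha] using k3
      linear_combination -(mul_eq_zero.mp this).resolve_left ha0
    subst hγ1
    have hu2 : σ (σ u) = u := by rw [← AlgEquiv.mul_apply, ← pow_two, hsq]; rfl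
    have hw2 : σ (σ w) = w := by rw [← AlgEquiv.mul_apply, ← pow_two, hsq]; rfl
    rw [h1, map_add, map_mul, AlgEquiv.commutes, AlgEquiv.commutes, h1] at hu2
    rw [h3] at hw2
    simp only [map_add, map_mul, AlgEquiv.commutes, h1, h3] at hw2
    obtain ⟨f0, f1, -⟩ := coeff_eq_zero huv hwv (a₀ := α * β + β) (a₁ := α ^ 2 - 1)
      (a₂ := 0) (a₃ := 0) (b₀ := 0) (b₁ := 0) (by
        simp only [map_add, map_sub, map_mul, map_pow, map_one, map_zero]
        linear_combination hu2)
    obtain ⟨g0, -⟩ := coeff_eq_zero huv hwv (a₀ := 2 * ε + δ * β) (a₁ := δ + δ * α)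
      (a₂ := 0) (a₃ := 0) (b₀ := 0) (b₁ := 0) (by
        simp only [map_add, map_mul, map_ofNat, map_zero]
        simp only [map_one] at hw2
        linear_combination hw2)
    have hα1 : α = 1 := by linear_combination -k1 - α * f1
    refine ⟨hα1, ?_⟩
    have h5 : δ * β = 0 := by linear_combination g0 - ε * h2
    have h6 := k4 ha
    rcases mul_eq_zero.mp h5 with h | h
    · rw [h, hα1] at h6
      have : c₃ * β = 0 := by linear_combination -h6
      exact (mul_eq_zero.mp this).resolve_left hc
    · exact h
  · have hγα : γ = α := sub_eq_zero.mp ((mul_eq_zero.mp k2).resolve_left ha)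
    have hα1 : α = 1 := by
      rw [hγα] at k1
      have : α ^ 2 * (α - 1) = 0 := by linear_combination -k1
      exact sub_eq_zero.mp ((mul_eq_zero.mp this).resolve_left (pow_ne_zero 2 hα))
    refine ⟨hα1, ?_⟩
    rw [hγα, hα1, sub_self, mul_zero, add_zero] at k3
    exact (mul_eq_zero.mp k3).resolve_left ha

include hres hno hu huv hw hwv h2 heq hgen in
-- The multiplier `α` is a homomorphism to the cube roots of unity. Its kernel is trivial in odd
-- order: with `α = 1` the square of `σ` fixes `u`, because `2 * β = 0`, and so `σ ^ 4 = 1`.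
theorem card_le_three_of_two_eq_zero (hc : c₃ ≠ 0) {G : Subgroup (L ≃ₐ[K] L)}
    (hG : G ≤ P.stabilizer) (hodd : Odd (Nat.card G)) : Nat.card G ≤ 3 := by
  classical
  choose! α β γ δ ε hα hγ h1 h3 k1 k2 k3 k4 using
    fun (σ : L ≃ₐ[K] L) (hσ : σ ∈ P.stabilizer) =>
      apply_eq_of_two_eq_zero hres hno hu huv hw hwv h2 heq hc hσ
  have hcube : ∀ σ ∈ P.stabilizer, α σ ^ 3 = 1 := by
    intro σ hσ
    by_cases ha : a₁ = 0
    · have ha0 := coeff_ne_zero_of_two_eq_zero hno hu huv hwv h2 heq hc ha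
      have h5 : a₀ * (1 - γ σ) = 0 := by simpa [ha] using k3 σ hσ
      have h6 := (mul_eq_zero.mp h5).resolve_left ha0
      rw [← k1 σ hσ]
      linear_combination (-1 - γ σ) * h6
    · have hγα : γ σ = α σ := sub_eq_zero.mp ((mul_eq_zero.mp (k2 σ hσ)).resolve_left ha)
      have h5 := k1 σ hσ
      rw [hγα] at h5
      have h6 : α σ ^ 2 * (α σ - 1) = 0 := by linear_combination -h5
      have h7 := (mul_eq_zero.mp h6).resolve_left (pow_ne_zero 2 (hα σ hσ))
      linear_combination (1 + α σ + α σ ^ 2) * h7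
  have hone : ∀ σ ∈ G, α σ = 1 → σ = 1 := by
    intro σ hσG hα1
    have hσ := hG hσG
    have h2L : (2 : L) = 0 := by rw [← map_ofNat (algebraMap K L) 2, h2, map_zero]
    have hfix : (σ ^ 2) u = u := by
      rw [pow_two, AlgEquiv.mul_apply, h1 σ hσ, map_add, map_mul, AlgEquiv.commutes,
        AlgEquiv.commutes, h1 σ hσ, hα1, map_one]
      linear_combination algebraMap K L (β σ) * h2L
    have h5 := sq_eq_one_of_apply_eq (c₀ := c₀) (c₁ := c₁) (c₂ := 0) (c₃ := c₃) hgen (by rw [heq]; simp) hfix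
    refine eq_one_of_odd_of_pow_two_pow hodd hσG (k := 2) ?_
    rw [← h5, ← pow_mul]
    rfl
  have hαinj : ∀ σ ∈ G, ∀ τ ∈ G, α σ = α τ → σ = τ := by
    intro σ hσG τ hτG h
    have hinv := G.inv_mem hσG
    have hmul := G.mul_mem hinv hτG
    have key : ∀ ρ ∈ G, ∀ ρ' ∈ G, α (ρ * ρ') = α ρ' * α ρ := by
      intro ρ hρ ρ' hρ'
      have h6 := h1 (ρ * ρ') (hG (mul_mem hρ hρ'))
      rw [AlgEquiv.mul_apply, h1 _ (hG hρ'), map_add, map_mul, AlgEquiv.commutes,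
        AlgEquiv.commutes, h1 _ (hG hρ)] at h6
      obtain ⟨-, f1, -⟩ := coeff_eq_zero huv hwv (a₀ := α ρ' * β ρ + β ρ' - β (ρ * ρ'))
        (a₁ := α ρ' * α ρ - α (ρ * ρ')) (a₂ := 0) (a₃ := 0) (b₀ := 0) (b₁ := 0) (by
          simp only [map_add, map_sub, map_mul, map_zero]
          linear_combination h6)
      exact (sub_eq_zero.mp f1).symm
    have hone' : α 1 = 1 := by
      have := key 1 (one_mem _) 1 (one_mem _)
      rw [mul_one] at this
      exact mul_left_cancel₀ (hα 1 (one_mem _)) (by rw [← this, mul_one])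
    have h7 : α (σ⁻¹ * τ) = 1 := by
      rw [key _ hinv _ hτG, ← h, ← key _ hinv _ hσG, inv_mul_cancel, hone']
    exact (inv_mul_eq_one.mp (hone _ hmul h7))
  have hfin : Finite G := Nat.finite_of_card_ne_zero hodd.pos.ne'
  have := Fintype.ofFinite G
  rw [Nat.card_eq_fintype_card, ← Finset.card_univ]
  refine (Finset.card_le_card_of_injOn (t := (Polynomial.nthRoots 3 (1 : K)).toFinset)
    (fun σ : G => α σ) (fun σ _ => ?_) fun σ _ τ _ h =>
      Subtype.ext (hαinj σ σ.2 τ τ.2 h)).trans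
    ((Multiset.toFinset_card_le _).trans (Polynomial.card_nthRoots 3 1))
  simp only [Finset.mem_coe, Multiset.mem_toFinset]
  exact (Polynomial.mem_nthRoots (by lia)).mpr (hcube σ (hG σ.2))

end EvenCharacteristic

include hres hno hu huv hw hwv in
/-- Two subgroups of order at least `4` of the stabilizer of a place of an elliptic function field
have a common non-trivial element. -/
theorem exists_ne_one_mem_inf
    (hrigid : ∀ σ : L ≃ₐ[K] L, (∀ z ∈ P.poleRing, σ z = z) → σ = 1)
    {G H : Subgroup (L ≃ₐ[K] L)} [Finite G] [Finite H] (hG : G ≤ P.stabilizer)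
    (hH : H ≤ P.stabilizer) (hG4 : 4 ≤ Nat.card G) (hH4 : 4 ≤ Nat.card H) :
    ∃ σ ∈ G ⊓ H, σ ≠ 1 := by
  -- Both groups have order at least four, so even order, and each contains an involution. Both
  -- involutions fix `u`, so they coincide.
  have main : ∀ (w : L) (a₀ a₁ c₀ c₁ c₂ c₃ : K), w ∈ P.poleRing → P.valuation w = WithZero.exp 3 →
      w ^ 2 + (algebraMap K L a₁ * u + algebraMap K L a₀) * w =
      algebraMap K L c₃ * u ^ 3 + algebraMap K L c₂ * u ^ 2 + algebraMap K L c₁ * u +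
        algebraMap K L c₀ →
      (∀ σ ∈ P.stabilizer, σ ^ 2 = 1 → σ u = u) →
      (∀ G : Subgroup (L ≃ₐ[K] L), G ≤ P.stabilizer → Odd (Nat.card G) → Nat.card G ≤ 3) →
      ∃ σ ∈ G ⊓ H, σ ≠ 1 := by
    intro w a₀ a₁ c₀ c₁ c₂ c₃ hw hwv heq hinv hcard
    obtain ⟨σ, hσ, hσ1, hσ2⟩ := exists_involution fun h => by
      have := hcard G hG h
      lia
    obtain ⟨τ, hτ, hτ1, hτ2⟩ := exists_involution fun h => by
      have := hcard H hH h
      lia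
    have hgen : ∀ σ : L ≃ₐ[K] L, σ u = u → σ w = w → σ = 1 := fun σ h1 h2 =>
      hrigid σ fun z hz => apply_eq_self hres hno hu huv hw hwv h1 h2 hz
    have := eq_of_apply_eq hgen heq (hinv σ (hG hσ) hσ2) (hinv τ (hH hτ) hτ2) hσ1 hτ1
    exact ⟨σ, ⟨hσ, this ▸ hτ⟩, hσ1⟩
  have hlow : ∀ a b : K,
      P.valuation (w + (algebraMap K L a * u + algebraMap K L b)) = WithZero.exp 3 := by
    intro a b
    rw [Valuation.map_add_eq_of_lt_left, hwv]
    rw [hwv]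
    refine (P.valuation.map_add_le (g := WithZero.exp 2) ?_ ?_).trans_lt (by
      rw [WithZero.exp_lt_exp]; lia)
    · rw [map_mul, huv]
      exact mul_le_of_le_one_left' (P.valuation_algebraMap_le_one a)
    · refine (P.valuation_algebraMap_le_one b).trans ?_
      rw [← WithZero.exp_zero, WithZero.exp_le_exp]
      lia
  have hlowR : ∀ a b : K, w + (algebraMap K L a * u + algebraMap K L b) ∈ P.poleRing := fun a b =>
    add_mem hw (add_mem (mul_mem (P.poleRing.algebraMap_mem a) hu) (P.poleRing.algebraMap_mem b))
  obtain ⟨a₀, a₁, c₀, c₁, c₂, c₃, hc, heq⟩ := exists_weierstrass hres hno hu huv hw hwv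
  by_cases h2 : (2 : K) = 0
  · have h2L : (2 : L) = 0 := by rw [← map_ofNat (algebraMap K L) 2, h2, map_zero]
    -- Replacing `w` by `w + s * u` then removes the `u ^ 2` term.
    obtain ⟨s, hs⟩ : ∃ s : K, s ^ 2 + a₁ * s = c₂ := by
      obtain ⟨s, hs⟩ := IsAlgClosed.exists_root
        (Polynomial.C 1 * Polynomial.X ^ 2 + Polynomial.C a₁ * Polynomial.X + Polynomial.C (-c₂))
        (by rw [Polynomial.degree_quadratic one_ne_zero]; decide)
      refine ⟨s, ?_⟩
      simp [Polynomial.IsRoot] at hs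
      linear_combination hs
    have hs' := congrArg (algebraMap K L) hs
    simp only [map_add, map_mul, map_pow] at hs'
    have heq' : (w + (algebraMap K L s * u + algebraMap K L 0)) ^ 2 +
        (algebraMap K L a₁ * u + algebraMap K L a₀) *
          (w + (algebraMap K L s * u + algebraMap K L 0)) =
        algebraMap K L c₃ * u ^ 3 + algebraMap K L (c₁ + a₀ * s) * u + algebraMap K L c₀ := by
      simp only [map_add, map_mul, map_zero]
      linear_combination heq + u ^ 2 * hs' +
        (algebraMap K L s * u * w + algebraMap K L c₂ * u ^ 2) * h2L
    have hgen : ∀ σ : L ≃ₐ[K] L, σ u = u →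
        σ (w + (algebraMap K L s * u + algebraMap K L 0)) =
          w + (algebraMap K L s * u + algebraMap K L 0) → σ = 1 := fun σ h1 h2 =>
      hrigid σ fun z hz => apply_eq_self hres hno hu huv (hlowR s 0) (hlow s 0) h1 h2 hz
    exact main _ _ _ c₀ (c₁ + a₀ * s) 0 c₃ (hlowR s 0) (hlow s 0) (by rw [heq']; simp)
      (fun σ hσ => apply_eq_self_of_sq_eq_one' hres hno hu huv (hlowR s 0) (hlow s 0) h2 heq' hc hσ)
      fun G hG => card_le_three_of_two_eq_zero hres hno hu huv (hlowR s 0) (hlow s 0) hgen h2 heq'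
        hc hG
  -- Completing the square in `w`.
  · obtain ⟨b₁, hb₁⟩ : ∃ b : K, 2 * b = a₁ := ⟨a₁ / 2, mul_div_cancel₀ _ h2⟩
    obtain ⟨b₀, hb₀⟩ : ∃ b : K, 2 * b = a₀ := ⟨a₀ / 2, mul_div_cancel₀ _ h2⟩
    have hb₁' := congrArg (algebraMap K L) hb₁
    have hb₀' := congrArg (algebraMap K L) hb₀
    simp only [map_mul, map_ofNat] at hb₁' hb₀'
    have heq' : (w + (algebraMap K L b₁ * u + algebraMap K L b₀)) ^ 2 =
        algebraMap K L c₃ * u ^ 3 + algebraMap K L (c₂ + b₁ ^ 2) * u ^ 2 +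
          algebraMap K L (c₁ + 2 * b₁ * b₀) * u + algebraMap K L (c₀ + b₀ ^ 2) := by
      simp only [map_add, map_mul, map_pow, map_ofNat]
      linear_combination heq + (u * w) * hb₁' + w * hb₀'
    have hgen : ∀ σ : L ≃ₐ[K] L, σ u = u →
        σ (w + (algebraMap K L b₁ * u + algebraMap K L b₀)) =
          w + (algebraMap K L b₁ * u + algebraMap K L b₀) → σ = 1 := fun σ h1 h2 =>
      hrigid σ fun z hz => apply_eq_self hres hno hu huv (hlowR b₁ b₀) (hlow b₁ b₀) h1 h2 hz
    exact main _ 0 0 _ _ _ _ (hlowR b₁ b₀) (hlow b₁ b₀) (by rw [← heq']; simp)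
      (fun σ hσ => apply_eq_self_of_sq_eq_one hres hno hu huv (hlowR b₁ b₀) (hlow b₁ b₀) h2 heq'
        hc hσ)
      fun G hG => card_le_three_of_two_ne_zero hres hno hu huv (hlowR b₁ b₀) (hlow b₁ b₀) hgen h2
        heq' hc hG

end Place

end EllipticAutomorphisms

/-! ### The rational case: polynomials defining Galois extensions. -/

section RationalCase

open IntermediateField

variable {K L : Type*} [Field K] [Field L] [Algebra K L]

namespace Place

variable {P : Place K L} {t : L} (ht : t ∈ P.poleRing) (htv : P.valuation t = WithZero.exp 1)

include htv in
theorem aeval_injective {f g : Polynomial K}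
    (h : Polynomial.aeval t f = Polynomial.aeval t g) : f = g := by
  by_contra hne
  have := valuation_aeval (P := P) (m := 1) le_rfl (by simpa using htv) (sub_ne_zero.mpr hne)
  rw [map_sub, h, sub_self, map_zero] at this
  exact WithZero.exp_ne_zero this.symm

include ht htv in
-- Removing leading terms at the pole, one power of `t` at a time, shows that the pole ring is
-- `K[t]`; the pole order is the degree.
theorem exists_eq_aeval [IsAlgClosed K]
    (hres : ∀ z, P.valuation z ≤ 1 → ∃ c : K, P.valuation (z - algebraMap K L c) < 1)
    {z : L} {n : ℕ} (hz : z ∈ P.poleRing) (hv : P.valuation z = WithZero.exp (n : ℤ)) :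
    ∃ f : Polynomial K, f.natDegree = n ∧ z = Polynomial.aeval t f := by
  have key : ∀ n : ℕ, ∀ z ∈ P.poleRing, P.valuation z ≤ WithZero.exp (n : ℤ) →
      ∃ f : Polynomial K, z = Polynomial.aeval t f := by
    intro n
    induction n with
    | zero =>
      intro z hz hv
      obtain ⟨c, rfl⟩ := exists_eq_algebraMap hres hz (by simpa using hv)
      exact ⟨Polynomial.C c, by simp⟩
    | succ n ih =>
      intro z hz hv
      obtain ⟨c, hc, hcv⟩ := exists_sub_le (n := n) (b := t ^ (n + 1)) hres (pow_mem ht _)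
        (by rw [map_pow, htv, ← WithZero.exp_nsmul]; simp) hz (by simpa using hv)
      obtain ⟨f, hf⟩ := ih _ hc hcv
      refine ⟨f + Polynomial.C c * Polynomial.X ^ (n + 1), ?_⟩
      rw [map_add, ← hf]
      simp
  obtain ⟨f, hf⟩ := key n z hz hv.le
  refine ⟨f, ?_, hf⟩
  have hf0 : f ≠ 0 := by
    rintro rfl
    rw [hf, map_zero, map_zero] at hv
    exact WithZero.exp_ne_zero hv.symm
  rw [hf, valuation_aeval (m := 1) le_rfl (by simpa using htv) hf0, WithZero.exp_inj] at hv
  lia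

include ht htv in
theorem exists_apply_eq_affine [IsAlgClosed K]
    (hres : ∀ z, P.valuation z ≤ 1 → ∃ c : K, P.valuation (z - algebraMap K L c) < 1)
    {σ : L ≃ₐ[K] L} (hσ : σ ∈ P.stabilizer) :
    ∃ α β : K, α ≠ 0 ∧ σ t = algebraMap K L α * t + algebraMap K L β := by
  obtain ⟨f, hf, h⟩ := exists_eq_aeval ht htv hres (n := 1) (apply_mem_poleRing hσ ht)
    (by rw [valuation_apply hσ, htv]; rfl)
  obtain ⟨a, ha, b, rfl⟩ := Polynomial.natDegree_eq_one.mp hf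
  exact ⟨a, b, ha, by simpa using h⟩

include ht htv in
/-- The affine automorphisms of a polynomial whose associated extension is Galois. -/
theorem exists_affine_invariance [IsAlgClosed K] {p : ℕ} [Fact p.Prime] [CharP K p]
    (hres : ∀ z, P.valuation z ≤ 1 → ∃ c : K, P.valuation (z - algebraMap K L c) < 1)
    (htop : K⟮t⟯ = ⊤) {f : Polynomial K} (hf : 1 ≤ f.natDegree)
    {z : L} (hz : z = Polynomial.aeval t f) [FiniteDimensional K⟮z⟯ L] [IsGalois K⟮z⟯ L] :
    ∃ (e k : ℕ) (T : Finset K) (ζ β : K), f.natDegree = p ^ e * k ∧ ¬ p ∣ k ∧ T.card = p ^ e ∧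
      0 ∈ T ∧ (∀ τ ∈ T, f.comp (Polynomial.X + Polynomial.C τ) = f) ∧ IsPrimitiveRoot ζ k ∧
      f.comp (Polynomial.C ζ * Polynomial.X + Polynomial.C β) = f ∧ (∀ τ ∈ T, τ / ζ ∈ T) ∧
      ∀ σ ∈ T, ∀ τ ∈ T, τ - σ ∈ T := by
  classical
  have hf0 : f ≠ 0 := by
    rintro rfl
    simp at hf
  have hzv : P.valuation z = WithZero.exp (f.natDegree : ℤ) := by
    rw [hz]
    simpa using valuation_aeval (P := P) (m := 1) le_rfl (by simpa using htv) hf0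
  have hzR : z ∈ P.poleRing := by
    rw [hz]
    exact (Subalgebra.aeval_coe P.poleRing ⟨t, ht⟩ f) ▸ Subtype.mem _
  have hz1 : 1 < P.valuation z := by
    rw [hzv, ← WithZero.exp_zero, WithZero.exp_lt_exp]
    lia
  set G := fixingSubgroup K⟮z⟯ with hG
  have hcardG : Nat.card G = Module.finrank K⟮z⟯ L := by
    rw [Nat.card_congr (fixingSubgroupEquiv K⟮z⟯).toEquiv, IsGalois.card_aut_eq_finrank]
  have hfin : Finite G := Nat.finite_of_card_ne_zero (hcardG ▸ Module.finrank_pos.ne')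
  -- Apply the norm argument to `t`, whose pole order is one.
  have hdvd : f.natDegree ∣ Nat.card G := by
    have := dvd_finrank_mul hf hzR hzv (w := t) htv
    rw [mul_one] at this
    rw [hcardG]
    exact_mod_cast this
  have hGz : ∀ σ ∈ G, σ z = z := fun σ hσ =>
    (IntermediateField.mem_fixingSubgroup_iff _ _).mp hσ z (mem_adjoin_simple_self K z)
  have hst : ∀ σ : G, (σ : L ≃ₐ[K] L) ∈ P.stabilizer := fun σ =>
    fixingSubgroup_le_stabilizer hzR hz1 σ.2
  choose α β hα hαβ using fun σ : G => exists_apply_eq_affine ht htv hres (hst σ)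
  have huniq : ∀ a b c d : K, algebraMap K L a * t + algebraMap K L b =
      algebraMap K L c * t + algebraMap K L d → a = c ∧ b = d := by
    intro a b c d h
    have := aeval_injective htv (f := Polynomial.C a * Polynomial.X + Polynomial.C b)
      (g := Polynomial.C c * Polynomial.X + Polynomial.C d) (by simpa using h)
    have h0 := congrArg (fun p => Polynomial.coeff p 0) this
    have h1 := congrArg (fun p => Polynomial.coeff p 1) this
    simp [Polynomial.coeff_C] at h0 h1
    exact ⟨h1, h0⟩
  have hext : ∀ σ τ : G, α σ = α τ → β σ = β τ → σ = τ := by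
    intro σ τ h1 h2
    have h3 : (σ : L ≃ₐ[K] L) t = (τ : L ≃ₐ[K] L) t := by rw [hαβ, hαβ, h1, h2]
    apply Subtype.ext
    refine AlgEquiv.ext fun x => ?_
    obtain ⟨r, s, rfl⟩ := (mem_adjoin_simple_iff K x).mp (by rw [htop]; trivial)
    rw [map_div₀, map_div₀, ← Polynomial.aeval_algHom_apply, ← Polynomial.aeval_algHom_apply,
      ← Polynomial.aeval_algHom_apply, ← Polynomial.aeval_algHom_apply, h3]
  have hmul : ∀ σ τ : G, α (σ * τ) = α τ * α σ ∧ β (σ * τ) = α τ * β σ + β τ := by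
    intro σ τ
    refine huniq _ _ _ _ ?_
    rw [← hαβ, Subgroup.coe_mul, AlgEquiv.mul_apply, hαβ τ, map_add, map_mul, AlgEquiv.commutes,
      AlgEquiv.commutes, hαβ σ]
    simp only [map_add, map_mul]
    ring
  have hone : α 1 = 1 ∧ β 1 = 0 := by
    refine huniq _ _ _ _ ?_
    rw [← hαβ]
    simp
  have hinv : ∀ σ : G, f.comp (Polynomial.C (α σ) * Polynomial.X + Polynomial.C (β σ)) = f := by
    intro σ
    refine aeval_injective htv ?_
    rw [Polynomial.aeval_comp]
    simp only [map_add, map_mul, Polynomial.aeval_C, Polynomial.aeval_X]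
    rw [← hαβ]
    rw [show Polynomial.aeval ((σ : L ≃ₐ[K] L) t) f = (σ : L ≃ₐ[K] L) z by
      rw [hz]; exact Polynomial.aeval_algHom_apply ((σ : L ≃ₐ[K] L) : L →ₐ[K] L) t f, hGz σ σ.2, hz]
  -- The conjugates of `t` are distinct roots of `f(X) - z`, which bounds the order from above.
  have hcard : Nat.card G = f.natDegree := by
    refine le_antisymm ?_ (Nat.le_of_dvd Nat.card_pos hdvd)
    have := Fintype.ofFinite G
    set g : Polynomial L := f.map (algebraMap K L) - Polynomial.C z with hg
    have hgdeg : g.natDegree = f.natDegree := by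
      rw [hg, Polynomial.natDegree_sub_C, Polynomial.natDegree_map]
    have hg0 : g ≠ 0 := by
      intro h
      rw [h] at hgdeg
      simp at hgdeg
      lia
    rw [← hgdeg, Nat.card_eq_fintype_card, ← Finset.card_univ]
    refine (Finset.card_le_card_of_injOn (t := g.roots.toFinset)
      (fun σ : G => (σ : L ≃ₐ[K] L) t) (fun σ _ => ?_) fun σ _ τ _ h => ?_).trans
      ((Multiset.toFinset_card_le _).trans (Polynomial.card_roots' g))
    · simp only [Finset.mem_coe, Multiset.mem_toFinset]
      rw [Polynomial.mem_roots hg0, Polynomial.IsRoot, hg, Polynomial.eval_sub, Polynomial.eval_C,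
        Polynomial.eval_map_algebraMap]
      rw [show Polynomial.aeval ((σ : L ≃ₐ[K] L) t) f = (σ : L ≃ₐ[K] L) z by
        rw [hz]; exact Polynomial.aeval_algHom_apply ((σ : L ≃ₐ[K] L) : L →ₐ[K] L) t f, hGz σ σ.2, sub_self]
    · have h' : (σ : L ≃ₐ[K] L) t = (τ : L ≃ₐ[K] L) t := h
      rw [hαβ, hαβ] at h'
      obtain ⟨h1, h2⟩ := huniq _ _ _ _ h'
      exact hext σ τ h1 h2
  -- The multiplier of the affine substitution. Its kernel consists of translations, hence is a
  -- `p`-group and yields `T`; its image is cyclic of order prime to `p`, and `ζ` generates it.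
  let χ : G →* Kˣ :=
    { toFun := fun σ => Units.mk0 (α σ) (hα σ)
      map_one' := Units.ext hone.1
      map_mul' := fun σ τ => Units.ext (by simpa [mul_comm] using (hmul σ τ).1) }
  have hker : ∀ σ : G, σ ∈ χ.ker ↔ α σ = 1 := by
    intro σ
    rw [MonoidHom.mem_ker, ← Units.val_inj]
    rfl
  have hpg : IsPGroup p χ.ker := by
    intro σ
    have hσ := (hker σ).mp σ.2
    have hpow : ∀ j : ℕ, α ((σ : G) ^ j) = 1 ∧ β ((σ : G) ^ j) = j * β σ := by
      intro j
      induction j with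
      | zero => simpa using hone
      | succ j ih =>
        rw [pow_succ, (hmul _ _).1, (hmul _ _).2, ih.1, ih.2, hσ]
        refine ⟨by simp, ?_⟩
        push_cast
        ring
    refine ⟨1, Subtype.ext (hext _ _ ?_ ?_)⟩
    · rw [pow_one, Subgroup.coe_pow, (hpow p).1, Subgroup.coe_one, hone.1]
    · rw [pow_one, Subgroup.coe_pow, (hpow p).2, Subgroup.coe_one, hone.2, CharP.cast_eq_zero,
        zero_mul]
  obtain ⟨e, he⟩ := IsPGroup.iff_card.mp hpg
  have hfr : Finite χ.range := Finite.of_surjective _ χ.rangeRestrict_surjective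
  obtain ⟨ζ, hζ⟩ := IsCyclic.exists_ofOrder_eq_natCard (α := χ.range)
  obtain ⟨ρ, hρ⟩ := ζ.2
  have hζρ : ((ζ : Kˣ) : K) = α ρ := by rw [← hρ]; rfl
  have := Fintype.ofFinite χ.ker
  refine ⟨e, Nat.card χ.range, Finset.univ.image fun σ : χ.ker => β σ, α ρ, β ρ, ?_, ?_, ?_, ?_, ?_,
    ?_, hinv ρ, ?_, ?_⟩
  · rw [← he, ← hcard, ← Subgroup.card_mul_index χ.ker, Subgroup.index_ker]
  · intro hp
    obtain ⟨a, ha⟩ := exists_prime_orderOf_dvd_card' p hp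
    have h1 : ((a : Kˣ) : K) ^ p = 1 := by
      have := pow_orderOf_eq_one a
      rw [ha] at this
      have h2 := congrArg (fun a : χ.range => ((a : Kˣ) : K)) this
      simpa using h2
    have h2 : ((a : Kˣ) : K) = 1 := by
      have h3 : (((a : Kˣ) : K) - 1) ^ p = 0 := by rw [sub_pow_char, h1, one_pow, sub_self]
      exact sub_eq_zero.mp (pow_eq_zero_iff (Fact.out : p.Prime).ne_zero |>.mp h3)
    have h3 : a = 1 := Subtype.ext (Units.ext h2)
    rw [h3, orderOf_one] at ha
    exact (Fact.out : p.Prime).one_lt.ne ha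
  · rw [Finset.card_image_of_injective, Finset.card_univ, ← Nat.card_eq_fintype_card, he]
    intro σ τ h
    exact Subtype.ext (hext _ _ (((hker σ).mp σ.2).trans ((hker τ).mp τ.2).symm) h)
  · exact Finset.mem_image.mpr ⟨1, Finset.mem_univ _, hone.2⟩
  · intro τ hτ
    obtain ⟨σ, -, rfl⟩ := Finset.mem_image.mp hτ
    have := hinv σ
    rwa [(hker σ).mp σ.2, Polynomial.C_1, one_mul] at this
  · rw [← hζρ, IsPrimitiveRoot.coe_units_iff, ← hζ, ← Subgroup.orderOf_coe]
    exact IsPrimitiveRoot.orderOf _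
  -- Conjugating a translation by the substitution with multiplier `ζ` divides its step by `ζ`.
  · intro τ hτ
    obtain ⟨σ, -, rfl⟩ := Finset.mem_image.mp hτ
    refine Finset.mem_image.mpr ⟨⟨ρ * σ * ρ⁻¹, χ.normal_ker.conj_mem σ σ.2 ρ⟩, Finset.mem_univ _, ?_⟩
    change β (ρ * σ * ρ⁻¹) = β σ / α ρ
    have h1 := hmul (ρ * σ * ρ⁻¹) ρ
    rw [inv_mul_cancel_right, (hmul ρ σ).2, (hker σ).mp σ.2] at h1
    rw [eq_div_iff (hα ρ)]
    linear_combination -h1.2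
  · intro σ hσ τ hτ
    obtain ⟨σ, -, rfl⟩ := Finset.mem_image.mp hσ
    obtain ⟨τ, -, rfl⟩ := Finset.mem_image.mp hτ
    refine Finset.mem_image.mpr ⟨τ * σ⁻¹, Finset.mem_univ _, ?_⟩
    have h1 := (hmul ((τ * σ⁻¹ : χ.ker) : G) σ).2
    rw [(hker σ).mp σ.2, ← Subgroup.coe_mul, inv_mul_cancel_right] at h1
    linear_combination -h1

end Place

end RationalCase

/-! ### Polynomials invariant under affine substitutions. -/

section PolynomialSymmetry

open Polynomial

variable {K : Type*} [Field K]

/-- Recentred at the fixed point `c` of the substitution, the polynomial is invariant under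
multiplication by `ζ`, so only exponents `0` and the degree survive. -/
theorem Polynomial.exists_eq_of_comp_primitiveRoot {f : K[X]} {ζ β : K} (hf : 2 ≤ f.natDegree)
    (hζ : IsPrimitiveRoot ζ f.natDegree) (h : f.comp (C ζ * X + C β) = f) :
    ∃ κ c δ : K, κ ≠ 0 ∧ f = C κ * (X - C c) ^ f.natDegree + C δ := by
  have hζ1 : 1 - ζ ≠ 0 := by
    intro h1
    have : ζ = 1 := by linear_combination -h1
    rw [this] at hζ
    have := hζ.unique IsPrimitiveRoot.one
    lia
  obtain ⟨c, hc⟩ : ∃ c, ζ * c + β = c := ⟨β / (1 - ζ), by field_simp; ring⟩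
  set g := f.comp (X + C c) with hg
  have hgζ : g.comp (C ζ * X) = g := by
    conv_rhs => rw [hg, ← h]
    rw [hg, comp_assoc, comp_assoc]
    congr 1
    simp only [add_comp, mul_comp, X_comp, C_comp]
    conv_lhs => rw [← hc]
    simp only [map_add, map_mul]
    ring
  have hgdeg : g.natDegree = f.natDegree := by
    rw [hg, natDegree_comp, natDegree_X_add_C, mul_one]
  have hcoeff : ∀ i, i ≠ 0 → i ≠ f.natDegree → g.coeff i = 0 := by
    intro i h0 h1
    rcases Nat.lt_or_ge f.natDegree i with h2 | h2
    · exact coeff_eq_zero_of_natDegree_lt (hgdeg ▸ h2)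
    have h3 := congrArg (fun p => coeff p i) hgζ
    simp only [comp_C_mul_X_coeff] at h3
    have h4 : g.coeff i * (ζ ^ i - 1) = 0 := by linear_combination h3
    refine (mul_eq_zero.mp h4).resolve_right fun h5 => ?_
    exact hζ.pow_ne_one_of_pos_of_lt h0 (lt_of_le_of_ne h2 h1) (sub_eq_zero.mp h5)
  have hgform : g = C (g.coeff f.natDegree) * X ^ f.natDegree + C (g.coeff 0) := by
    ext i
    rw [coeff_add, coeff_C_mul_X_pow, coeff_C]
    by_cases h0 : i = 0
    · rw [h0, if_neg (by lia), if_pos rfl, zero_add]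
    by_cases h1 : i = f.natDegree
    · rw [h1, if_pos rfl, if_neg (by lia), add_zero]
    · rw [if_neg h1, if_neg h0, hcoeff i h0 h1, add_zero]
  refine ⟨g.coeff f.natDegree, c, g.coeff 0, ?_, ?_⟩
  · rw [← hgdeg]
    refine leadingCoeff_ne_zero.mpr ?_
    intro h0
    rw [h0] at hgdeg
    simp at hgdeg
    lia
  · have h1 : f = g.comp (X - C c) := by
      rw [hg, comp_assoc]
      simp
    conv_lhs => rw [h1, hgform]
    simp

/-- `f - f(0)` vanishes on `T`, so `∏ (X - τ)` divides it. That product is itself invariant, hence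
so is the quotient, and induction on the degree applies. -/
theorem Polynomial.card_dvd_natDegree_of_translation {T : Finset K} (h0 : (0 : K) ∈ T)
    (hsub : ∀ σ ∈ T, ∀ τ ∈ T, τ - σ ∈ T) (f : K[X]) (hf : ∀ τ ∈ T, f.comp (X + C τ) = f) :
    T.card ∣ f.natDegree := by
  induction hn : f.natDegree using Nat.strong_induction_on generalizing f with
  | _ n ih =>
    set h := ∏ τ ∈ T, (X - C τ) with hh
    have hhT : ∀ σ ∈ T, h.comp (X + C σ) = h := by
      intro σ hσ
      rw [hh, prod_comp]
      refine Finset.prod_nbij' (fun τ => τ - σ) (fun τ => τ - (0 - σ)) (fun τ hτ => hsub σ hσ τ hτ)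
        (fun τ hτ => hsub _ (hsub σ hσ 0 h0) τ hτ) (by simp) (by simp) (fun τ _ => ?_)
      simp only [sub_comp, X_comp, C_comp, map_sub]
      ring
    have hmonic : h.Monic := monic_prod_of_monic _ _ fun τ _ => monic_X_sub_C τ
    have hdeg : h.natDegree = T.card := by
      rw [hh, natDegree_prod_of_monic _ _ fun τ _ => monic_X_sub_C τ]
      simp
    have hdvd : h ∣ f - C (f.eval 0) := by
      refine Finset.prod_dvd_of_coprime (fun σ _ τ _ hne =>
        pairwise_coprime_X_sub_C Function.injective_id hne) fun τ hτ => ?_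
      rw [dvd_iff_isRoot, IsRoot, eval_sub, eval_C, sub_eq_zero]
      conv_rhs => rw [← hf τ hτ]
      simp
    obtain ⟨g, hg⟩ := hdvd
    have hgT : ∀ σ ∈ T, g.comp (X + C σ) = g := by
      intro σ hσ
      have h1 := congrArg (fun p => p.comp (X + C σ)) hg
      simp only [sub_comp, C_comp, mul_comp, hhT σ hσ, hf σ hσ] at h1
      exact mul_left_cancel₀ hmonic.ne_zero (h1.symm.trans hg)
    have hfg : f.natDegree = (h * g).natDegree := by rw [← hg, natDegree_sub_C]
    by_cases hg0 : g = 0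
    · rw [← hn, hfg, hg0]
      simp
    rw [hmonic.natDegree_mul' hg0, hdeg, hn] at hfg
    have hpos : 0 < T.card := Finset.card_pos.mpr ⟨0, h0⟩
    rw [hfg]
    exact (Nat.dvd_refl _).add (ih g.natDegree (by lia) g hgT rfl)

/-- The roots of `X ^ k - (X - 1) ^ k` are not permuted by an affine map of order `k ≥ 3`. -/
theorem not_affine_symmetric {k : ℕ} (hk : (k : K) ≠ 0) (hk3 : 3 ≤ k) {ζ β : K}
    (hζ : IsPrimitiveRoot ζ k) :
    ¬ ∀ r : K, r ^ k = (r - 1) ^ k → (ζ * r + β) ^ k = (ζ * r + β - 1) ^ k := by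
  classical
  intro h
  set E : K[X] := X ^ k - (X - C 1) ^ k with hE
  have hcoeff : E.coeff (k - 1) = k := by
    rw [hE, coeff_sub, coeff_X_pow, if_neg (by lia), sub_eq_add_neg X, ← C_neg, coeff_X_add_C_pow, Nat.choose_symm (by lia : 1 ≤ k), Nat.choose_one_right,
      show k - (k - 1) = 1 by lia]
    simp
  have hE0 : E ≠ 0 := by
    intro h0
    rw [h0] at hcoeff
    exact hk (by simpa using hcoeff.symm)
  have hEdeg : E.natDegree < k := by
    rw [Polynomial.natDegree_lt_iff_degree_lt hE0]
    have h1 : (X ^ k : K[X]).degree = ((X - C (1 : K)) ^ k).degree := by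
      rw [degree_pow, degree_pow, degree_X, degree_X_sub_C]
    have h2 := degree_sub_lt_left h1 (pow_ne_zero k X_ne_zero) (by
      rw [leadingCoeff_pow, leadingCoeff_pow, leadingCoeff_X, leadingCoeff_X_sub_C])
    rwa [degree_X_pow] at h2
  have hroot : ∀ r : K, r ∈ E.roots ↔ r ^ k = (r - 1) ^ k := by
    intro r
    rw [mem_roots hE0, IsRoot, hE]
    simp [sub_eq_zero]
  have hζ1 : ∀ i, 0 < i → i < k → 1 - ζ ^ i ≠ 0 := fun i h1 h2 h3 =>
    hζ.pow_ne_one_of_pos_of_lt h1.ne' h2 (sub_eq_zero.mp h3).symm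
  have hr : ∀ i, 0 < i → i < k → (1 / (1 - ζ ^ i)) ∈ E.roots := by
    intro i h1 h2
    have h3 := hζ1 i h1 h2
    rw [hroot, show 1 / (1 - ζ ^ i) - 1 = ζ ^ i * (1 / (1 - ζ ^ i)) by field_simp; ring, mul_pow,
      ← pow_mul, mul_comm i, pow_mul, hζ.pow_eq_one, one_pow, one_mul]
  have hζ1' : 1 - ζ ≠ 0 := by simpa using hζ1 1 (by lia) (by lia)
  obtain ⟨c, hc⟩ : ∃ c, ζ * c + β = c := ⟨β / (1 - ζ), by field_simp; ring⟩
  -- For `i = 1, 2` the roots `1 / (1 - ζ ^ i)` differ, so one of them is not the fixed point `c`.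
  -- Its orbit would give `k` roots of a polynomial of degree less than `k`.
  obtain ⟨r, hrE, hrc⟩ : ∃ r ∈ E.roots, r ≠ c := by
    by_contra! hcon
    have h1 := hcon _ (hr 1 (by lia) (by lia))
    have h2 := hcon _ (hr 2 (by lia) (by lia))
    have h3 := h1.trans h2.symm
    have h4 := hζ1 2 (by lia) (by lia)
    rw [pow_one] at h3
    rw [div_eq_div_iff hζ1' h4, one_mul, one_mul] at h3
    have h5 : ζ * (1 - ζ) = 0 := by linear_combination h3
    rcases mul_eq_zero.mp h5 with h6 | h6
    · have := hζ.pow_eq_one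
      rw [h6, zero_pow (by lia)] at this
      exact zero_ne_one this
    · exact hζ1' h6
  have horb : ∀ i, c + ζ ^ i * (r - c) ∈ E.roots := by
    intro i
    induction i with
    | zero => simpa using hrE
    | succ i ih =>
      rw [hroot] at ih ⊢
      have := h _ ih
      have h1 : ζ * (c + ζ ^ i * (r - c)) + β = c + ζ ^ (i + 1) * (r - c) := by
        linear_combination hc
      rwa [h1] at this
  have hle : k ≤ E.roots.toFinset.card := by
    rw [← Finset.card_range k]
    refine Finset.card_le_card_of_injOn (fun i => c + ζ ^ i * (r - c)) (fun i _ => ?_)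
      fun i hi j hj hij => ?_
    · simpa only [Finset.mem_coe, Multiset.mem_toFinset] using horb i
    · have h1 : ζ ^ i * (r - c) = ζ ^ j * (r - c) := add_left_cancel hij
      exact hζ.pow_inj (by simpa using hi) (by simpa using hj)
        (mul_right_cancel₀ (sub_ne_zero.mpr hrc) h1)
  have := hle.trans ((Multiset.toFinset_card_le _).trans (card_roots' E))
  lia

end PolynomialSymmetry

/-! ### The normal form in the rational case. -/

section RationalNormalForm

open IntermediateField Polynomial

variable {K L : Type*} [Field K] [Field L] [Algebra K L]

namespace Place

variable {P : Place K L} [IsAlgClosed K] {p : ℕ} [Fact p.Prime] [CharP K p]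
  (hres : ∀ z, P.valuation z ≤ 1 → ∃ c : K, P.valuation (z - algebraMap K L c) < 1)

include hres in
theorem exists_eq_of_not_dvd {t : L} (ht : t ∈ P.poleRing) (htv : P.valuation t = WithZero.exp 1)
    (htop : K⟮t⟯ = ⊤) {f : K[X]} (hf : 2 ≤ f.natDegree) (hp : ¬ p ∣ f.natDegree)
    {z : L} (hz : z = aeval t f) [FiniteDimensional K⟮z⟯ L] [IsGalois K⟮z⟯ L] :
    ∃ κ c δ : K, κ ≠ 0 ∧ f = C κ * (X - C c) ^ f.natDegree + C δ := by
  obtain ⟨e, k, T, ζ, β, hdeg, -, -, -, -, hζ, hinv, -⟩ :=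
    exists_affine_invariance (p := p) ht htv hres htop (by lia) hz
  have he : e = 0 := by
    by_contra he
    exact hp (hdeg ▸ (dvd_pow_self p he).mul_right k)
  rw [he, pow_zero, one_mul] at hdeg
  rw [← hdeg] at hζ
  exact exists_eq_of_comp_primitiveRoot hf hζ hinv

include hres in
-- The derivative is invariant under the `p ^ e` translations, so its degree is a multiple of `p ^
-- e`, as is the larger degree of `f`. The gap is thus at least `p ^ e`, which is at least three.
theorem natDegree_derivative_le_of_dvd {t : L} (ht : t ∈ P.poleRing)
    (htv : P.valuation t = WithZero.exp 1)
    (htop : K⟮t⟯ = ⊤) {f : K[X]} (hf : 3 ≤ f.natDegree) (hp : p ∣ f.natDegree)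
    {z : L} (hz : z = aeval t f) [FiniteDimensional K⟮z⟯ L] [IsGalois K⟮z⟯ L] :
    f.derivative.natDegree + 3 ≤ f.natDegree := by
  classical
  obtain ⟨e, k, T, ζ, β, hdeg, hpk, hT, h0, htr, hζ, hinv, hdiv, hsub⟩ :=
    exists_affine_invariance (p := p) ht htv hres htop (by lia) hz
  have he : e ≠ 0 := by
    rintro rfl
    rw [pow_zero, one_mul] at hdeg
    exact hpk (hdeg ▸ hp)
  have h2 : 2 ≤ p ^ e := (Fact.out : p.Prime).two_le.trans (Nat.le_self_pow he p)
  -- If `T = {0, τ}`, then division by `ζ` fixes `τ`, so `ζ = 1`, `k = 1`, and `f` would have degree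
  -- two.
  have h3 : p ^ e ≠ 2 := by
    intro h2
    rw [h2] at hT hdeg
    obtain ⟨τ, hτ, hτ0⟩ := Finset.exists_mem_ne (s := T) (by lia) (0 : K)
    have hτζ := hdiv τ hτ
    have hk0 : k ≠ 0 := by rintro rfl; exact hpk (dvd_zero p)
    have hζ0 := hζ.ne_zero hk0
    have hτ1 : τ / ζ = τ := by
      by_contra hne
      have : ({0, τ, τ / ζ} : Finset K) ⊆ T := by
        intro a ha
        simp only [Finset.mem_insert, Finset.mem_singleton] at ha
        rcases ha with rfl | rfl | rfl <;> assumption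
      have := Finset.card_le_card this
      rw [Finset.card_eq_three.mpr ⟨0, τ, τ / ζ, hτ0.symm, (div_ne_zero hτ0 hζ0).symm,
        (Ne.symm hne), rfl⟩] at this
      lia
    rw [div_eq_iff hζ0] at hτ1
    have hζ1 : ζ = 1 := mul_left_cancel₀ hτ0 (by rw [mul_one, ← hτ1])
    rw [hζ1] at hζ
    have := hζ.unique IsPrimitiveRoot.one
    lia
  have hder : T.card ∣ f.derivative.natDegree := by
    refine card_dvd_natDegree_of_translation h0 hsub _ fun τ hτ => ?_
    have := congrArg derivative (htr τ hτ)
    rw [derivative_comp] at this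
    simpa using this
  rw [hT] at hder
  have hlt : f.derivative.natDegree < f.natDegree := natDegree_derivative_lt (by lia)
  obtain ⟨a, ha⟩ := hder
  rw [ha, hdeg] at hlt
  have hak := Nat.lt_of_mul_lt_mul_left hlt
  have : p ^ e * (a + 1) ≤ p ^ e * k := Nat.mul_le_mul_left _ hak
  rw [mul_add, mul_one] at this
  lia

include hres in
/-- If two polynomials `x`, `y` of consecutive degrees in a uniformizing variable are such that
`x`, `y` and `y - x` define Galois extensions, they are, up to affine changes, `s ^ n + s` and
`s ^ (n + 1)` for a power `n` of the characteristic. -/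
theorem exists_normal_form {t x y : L} (ht : t ∈ P.poleRing) (htv : P.valuation t = WithZero.exp 1)
    (htop : K⟮t⟯ = ⊤) {m : ℕ} (hm : 4 ≤ m) (hx : x ∈ P.poleRing) (hy : y ∈ P.poleRing)
    (hxv : P.valuation x = WithZero.exp ((m - 1 : ℕ) : ℤ))
    (hyv : P.valuation y = WithZero.exp (m : ℤ))
    (hxyv : P.valuation (y - x) = WithZero.exp (m : ℤ))
    [FiniteDimensional K⟮x⟯ L] [IsGalois K⟮x⟯ L] [FiniteDimensional K⟮y⟯ L] [IsGalois K⟮y⟯ L]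
    [FiniteDimensional K⟮y - x⟯ L] [IsGalois K⟮y - x⟯ L] :
    ∃ (s : L) (e : ℕ) (κ γ δ : K), s ∈ P.poleRing ∧ P.valuation s = WithZero.exp 1 ∧ K⟮s⟯ = ⊤ ∧
      m = p ^ e + 1 ∧ κ ≠ 0 ∧ x = algebraMap K L κ * (s ^ p ^ e + s) + algebraMap K L γ ∧
      y = algebraMap K L κ * s ^ (p ^ e + 1) + algebraMap K L δ := by
  classical
  obtain ⟨fx, hfx, hx'⟩ := exists_eq_aeval ht htv hres hx hxv
  obtain ⟨fy, hfy, hy'⟩ := exists_eq_aeval ht htv hres hy hyv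
  obtain ⟨fw, hfw, hw'⟩ := exists_eq_aeval ht htv hres (sub_mem hy hx) hxyv
  have hsub : fx = fy - fw := by
    refine aeval_injective htv ?_
    rw [map_sub, ← hx', ← hy', ← hw', sub_sub_cancel]
  have hcast : ∀ n : ℕ, (n : K) = 0 ↔ p ∣ n := CharP.cast_eq_zero_iff K p
  -- If `p` divides `m`, the derivatives of `y` and `y - x` have degree at most `m - 3`, but that of
  -- `x` has degree `m - 2`, since `p` does not divide `m - 1`.
  have hpm : ¬ p ∣ m := by
    intro hpm
    have h1 := natDegree_derivative_le_of_dvd (p := p) hres ht htv htop (by lia) (hfy ▸ hpm) hy'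
    have h2 := natDegree_derivative_le_of_dvd (p := p) hres ht htv htop (by lia) (hfw ▸ hpm) hw'
    have h3 : fx.derivative.natDegree ≤ m - 3 := by
      rw [hsub, derivative_sub]
      exact (natDegree_sub_le_of_le (le_refl _) (le_refl _)).trans (max_le (by lia) (by lia))
    have h4 : fx.derivative.coeff (m - 2) ≠ 0 := by
      rw [coeff_derivative, show m - 2 + 1 = m - 1 by lia]
      refine mul_ne_zero ?_ ?_
      · rw [← hfx]
        refine leadingCoeff_ne_zero.mpr ?_
        rintro h0
        rw [h0] at hfx
        simp at hfx
        lia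
      · have : ((m - 2 : ℕ) : K) + 1 = ((m - 1 : ℕ) : K) := by
          rw [← Nat.cast_succ]
          congr 1
          lia
        rw [this, ne_eq, hcast]
        intro h5
        have h6 := (Nat.dvd_sub hpm h5)
        rw [show m - (m - 1) = 1 by lia] at h6
        exact (Fact.out : p.Prime).one_lt.ne' (Nat.dvd_one.mp h6)
    have := le_natDegree_of_ne_zero h4
    lia
  obtain ⟨κ, c, δ, hκ, hfyc⟩ := exists_eq_of_not_dvd (p := p) hres ht htv htop (by lia)
    (hfy ▸ hpm) hy'
  obtain ⟨κ', c', δ', hκ', hfwc⟩ := exists_eq_of_not_dvd (p := p) hres ht htv htop (by lia)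
    (hfw ▸ hpm) hw'
  rw [hfy] at hfyc
  rw [hfw] at hfwc
  have hlead : ∀ a b d : K, (C a * (X - C b) ^ m + C d).coeff m = a := by
    intro a b d
    rw [coeff_add, coeff_C_mul, coeff_C, if_neg (by lia), add_zero]
    have h := (monic_X_sub_C b).pow m
    have h1 := h.coeff_natDegree
    rw [natDegree_pow, natDegree_X_sub_C, mul_one] at h1
    rw [h1, mul_one]
  have hκκ : κ' = κ := by
    have h1 : fx.coeff m = 0 := coeff_eq_zero_of_natDegree_lt (by lia)
    rw [hsub, hfyc, hfwc, coeff_sub, hlead, hlead] at h1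
    exact (sub_eq_zero.mp h1).symm
  subst hκκ
  have hcc : c' - c ≠ 0 := by
    intro h
    have h1 : c' = c := sub_eq_zero.mp h
    rw [hfyc, hfwc, h1] at hsub
    have h2 : fx = C (δ - δ') := by rw [hsub, map_sub]; ring
    rw [h2, natDegree_C] at hfx
    lia
  -- the normalized variable
  obtain ⟨s, hs⟩ : ∃ s, t = algebraMap K L (c' - c) * s + algebraMap K L c :=
    ⟨(t - algebraMap K L c) / algebraMap K L (c' - c), by
      rw [mul_div_cancel₀ _ ((_root_.map_ne_zero _).mpr hcc)]; ring⟩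
  have hs' : s = algebraMap K L (c' - c)⁻¹ * (t - algebraMap K L c) := by
    rw [hs, add_sub_cancel_right, ← mul_assoc, ← map_mul, inv_mul_cancel₀ hcc, map_one, one_mul]
  have hsR : s ∈ P.poleRing := by
    rw [hs']
    exact mul_mem (P.poleRing.algebraMap_mem _) (sub_mem ht (P.poleRing.algebraMap_mem _))
  have hsv : P.valuation s = WithZero.exp 1 := by
    rw [hs', map_mul, P.valuation_algebraMap (inv_ne_zero hcc), one_mul,
      Valuation.map_sub_eq_of_lt_left, htv]
    refine (P.valuation_algebraMap_le_one c).trans_lt ?_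
    rw [htv, ← WithZero.exp_zero, WithZero.exp_lt_exp]
    lia
  have hsgen : K⟮s⟯ = ⊤ := by
    rw [← htop, hs, adjoin_affine hcc]
  set μ := κ' * (c' - c) ^ m with hμ
  have hμ0 : μ ≠ 0 := mul_ne_zero hκ (pow_ne_zero m hcc)
  have hys : y = algebraMap K L μ * s ^ m + algebraMap K L δ := by
    rw [hy', hfyc, hμ]
    simp only [map_add, map_mul, map_pow, map_sub, aeval_C, aeval_X]
    rw [hs, add_sub_cancel_right, mul_pow, map_sub]
    ring
  have hws : y - x = algebraMap K L μ * (s - 1) ^ m + algebraMap K L δ' := by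
    rw [hw', hfwc, hμ]
    simp only [map_add, map_mul, map_pow, map_sub, aeval_C, aeval_X]
    have h1 : t - algebraMap K L c' = algebraMap K L (c' - c) * (s - 1) := by
      rw [hs, map_sub]
      ring
    rw [h1, mul_pow, map_sub]
    ring
  set g : K[X] := C μ * (X ^ m - (X - C 1) ^ m) + C (δ - δ') with hg
  have hxs : x = aeval s g := by
    rw [hg]
    simp only [map_add, map_mul, map_pow, map_sub, aeval_C, aeval_X, map_one]
    linear_combination hys - hws
  have hgdeg : g.natDegree = m - 1 := by
    have hg0 : g ≠ 0 := by
      intro h0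
      rw [hxs, h0, map_zero, map_zero] at hxv
      exact WithZero.exp_ne_zero hxv.symm
    have h1 := hxv
    rw [hxs, valuation_aeval (m := 1) le_rfl (by simpa using hsv) hg0, WithZero.exp_inj] at h1
    lia
  obtain ⟨e, k, T, ζ, β, hdeg, hpk, hT, h0, htr, hζ, hinv, hdiv, hTsub⟩ :=
    exists_affine_invariance (p := p) hsR hsv hres hsgen (by lia) hxs
  rw [hgdeg] at hdeg
  have hmK : (m : K) ≠ 0 := by rwa [ne_eq, hcast]
  have hkK : (k : K) ≠ 0 := by rwa [ne_eq, hcast]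
  -- Differentiation gives `s ^ (m - 1) - (s - 1) ^ (m - 1)`, and `m - 1 = p ^ e * k` turns it into
  -- a `p ^ e`-th power.
  have hgder : g.derivative = C (μ * m) * (X ^ k - (X - C 1) ^ k) ^ p ^ e := by
    rw [sub_pow_char_pow, ← pow_mul, ← pow_mul, mul_comm k, ← hdeg, hg]
    simp only [derivative_add, derivative_C, derivative_C_mul, derivative_sub, derivative_X_pow,
      derivative_X_sub_C_pow, map_mul]
    simp
    ring
  have hzero : ∀ r : K, g.derivative.eval r = 0 ↔ r ^ k = (r - 1) ^ k := by
    intro r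
    rw [hgder, eval_mul, eval_C, eval_pow, mul_eq_zero, or_iff_right (mul_ne_zero hμ0 hmK),
      pow_eq_zero_iff (pow_ne_zero e (Fact.out : p.Prime).ne_zero)]
    simp [sub_eq_zero]
  have hk0 : k ≠ 0 := by rintro rfl; exact hpk (dvd_zero p)
  have hk1 : k = 1 := by
    by_contra hk1
    -- For `k = 2` the derivative vanishes only at `1 / 2`, so no nonzero translation preserves it:
    -- `p ^ e = 1` and `m = 3`, too small. For `k ≥ 3` the affine map of order `k` cannot permute
    -- its zeros.
    by_cases hk2 : k = 2
    · subst hk2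
      have h2 : (2 : K) ≠ 0 := by simpa using hkK
      have hT0 : ∀ τ ∈ T, τ = 0 := by
        intro τ hτ
        have h3 := congrArg derivative (htr τ hτ)
        rw [derivative_comp] at h3
        have h4 := congrArg (eval (1 / 2 : K)) h3
        have h5 : g.derivative.eval (1 / 2 : K) = 0 := (hzero _).mpr (by field_simp; norm_num)
        rw [h5] at h4
        simp only [derivative_add, derivative_X, derivative_C, add_zero, one_mul, eval_comp,
          eval_add, eval_X, eval_C] at h4
        have h6 := (hzero _).mp (by simpa using h4)
        have h7 : 2 * τ = 0 := by
          have h8 : (2 : K) * (1 / 2) = 1 := by field_simp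
          linear_combination h6 - h8
        exact (mul_eq_zero.mp h7).resolve_left h2
      have hle : T.card ≤ 1 := Finset.card_le_one.mpr fun a ha b hb =>
        (hT0 a ha).trans (hT0 b hb).symm
      rw [hT] at hle
      have : p ^ e * 2 ≤ 1 * 2 := Nat.mul_le_mul_right 2 hle
      lia
    · refine not_affine_symmetric hkK (by lia) hζ (β := β) fun r hr => ?_
      rw [← hzero] at hr ⊢
      have h3 := congrArg derivative hinv
      rw [derivative_comp] at h3
      have h4 := congrArg (eval r) h3
      rw [hr] at h4
      simp only [derivative_add, derivative_X, derivative_C, add_zero, derivative_C_mul, mul_one,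
        eval_mul, eval_C, eval_comp, eval_add, eval_X] at h4
      exact (mul_eq_zero.mp h4).resolve_left (hζ.ne_zero hk0)
  rw [hk1, mul_one] at hdeg
  have hme : m = p ^ e + 1 := by lia
  have hpL : CharP L p := charP_of_injective_algebraMap (algebraMap K L).injective p
  -- Now `(s - 1) ^ (p ^ e + 1) = s ^ (p ^ e + 1) - s ^ p ^ e - s + 1`; its constant term, times
  -- `-μ`, joins `δ - δ'` in the constant of `x`.
  refine ⟨s, e, μ, δ - δ' - μ, δ, hsR, hsv, hsgen, hme, hμ0, ?_, ?_⟩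
  · have h1 : (s - 1) ^ (p ^ e + 1) = (s ^ p ^ e - 1) * (s - 1) := by
      rw [pow_succ, sub_pow_char_pow, one_pow]
    rw [hme, h1] at hws
    rw [hme] at hys
    simp only [map_sub]
    linear_combination hys - hws
  · rw [← hme]
    exact hys

end Place

end RationalNormalForm

/-! ### Excluding the elliptic case. -/

section GenusAtMostOne

open IntermediateField Polynomial

variable {K L : Type*} [Field K] [Field L] [Algebra K L]

theorem algEquiv_eq_one_of_adjoin_eq_top {S : Set L} (htop : adjoin K S = ⊤) {σ : L ≃ₐ[K] L}
    (h : ∀ x ∈ S, σ x = x) : σ = 1 := by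
  refine AlgEquiv.ext fun x => ?_
  have hx : x ∈ adjoin K S := htop ▸ mem_top
  induction hx using adjoin_induction with
  | mem x hx => exact h x hx
  | algebraMap c => exact σ.commutes c
  | add x y _ _ hx hy => rw [map_add, hx, hy]; rfl
  | inv x _ hx => rw [map_inv₀, hx]; rfl
  | mul x y _ _ hx hy => rw [map_mul, hx, hy]; rfl

namespace Place

variable {P : Place K L} [IsAlgClosed K] {p : ℕ} [Fact p.Prime] [CharP K p]
  (hres : ∀ z, P.valuation z ≤ 1 → ∃ c : K, P.valuation (z - algebraMap K L c) < 1)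

include hres in
theorem exists_normal_form_of_genus_le_one {x y : L} {m : ℕ} (hm : 4 ≤ m) (hx : x ∈ P.poleRing)
    (hy : y ∈ P.poleRing) (hxv : P.valuation x = WithZero.exp ((m - 1 : ℕ) : ℤ))
    (hyv : P.valuation y = WithZero.exp (m : ℤ)) (htop : adjoin K {x, y} = ⊤)
    [IsGalois K⟮x⟯ L] [IsGalois K⟮y⟯ L] [IsGalois K⟮y - x⟯ L]
    (hdvr : ∀ V : ValuationSubring L, (∀ c : K, algebraMap K L c ∈ V) → V ≠ ⊤ →
      IsDiscreteValuationRing V) (hgenus : functionFieldGenus K L ≤ 1) :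
    ∃ (s : L) (e : ℕ) (κ γ δ : K), s ∈ P.poleRing ∧ P.valuation s = WithZero.exp 1 ∧ K⟮s⟯ = ⊤ ∧
      m = p ^ e + 1 ∧ κ ≠ 0 ∧ x = algebraMap K L κ * (s ^ p ^ e + s) + algebraMap K L γ ∧
      y = algebraMap K L κ * s ^ (p ^ e + 1) + algebraMap K L δ := by
  have hxyv : P.valuation (y - x) = WithZero.exp (m : ℤ) := by
    rw [Valuation.map_sub_eq_of_lt_left, hyv]
    rw [hxv, hyv, WithZero.exp_lt_exp]
    lia
  have hSfin : ({x, y} : Set L).Finite := by simp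
  have := finiteDimensional_of_adjoin_eq_top hSfin htop K⟮x⟯
  have := finiteDimensional_of_adjoin_eq_top hSfin htop K⟮y⟯
  have := finiteDimensional_of_adjoin_eq_top hSfin htop K⟮y - x⟯
  rcases exists_of_genus_le_one hres hdvr hgenus with
    ⟨t, ht, htv⟩ | ⟨hno, ⟨u, hu, huv⟩, w, hw, hwv⟩
  · have httop : K⟮t⟯ = ⊤ := by
      rw [eq_top_iff, ← htop, adjoin_le_iff]
      have hmem : ∀ f : K[X], aeval t f ∈ K⟮t⟯ := fun f =>
        algebra_adjoin_le_adjoin K _ (aeval_mem_adjoin_singleton K t)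
      obtain ⟨fx, -, hfx⟩ := exists_eq_aeval ht htv hres hx hxv
      obtain ⟨fy, -, hfy⟩ := exists_eq_aeval ht htv hres hy hyv
      rintro z (rfl | rfl)
      · exact hfx ▸ hmem fx
      · exact hfy ▸ hmem fy
    exact exists_normal_form hres ht htv httop hm hx hy hxv hyv hxyv
  -- The groups of `y` and `y - x` are too large for the stabilizer of a place: they share a
  -- nontrivial automorphism, which fixes `x` and `y` and hence `L`.
  · exfalso
    have hext : ∀ σ : L ≃ₐ[K] L, σ x = x → σ y = y → σ = 1 := fun σ h1 h2 =>
      algEquiv_eq_one_of_adjoin_eq_top htop (by rintro z (rfl | rfl) <;> assumption)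
    have hone : (1 : ℤᵐ⁰) < WithZero.exp (m : ℤ) := by
      rw [← WithZero.exp_zero, WithZero.exp_lt_exp]
      lia
    have hcard : ∀ z ∈ P.poleRing, P.valuation z = WithZero.exp (m : ℤ) →
        ∀ [FiniteDimensional K⟮z⟯ L] [IsGalois K⟮z⟯ L],
        4 ≤ Nat.card (fixingSubgroup K⟮z⟯) := by
      intro z hz hzv _ _
      rw [Nat.card_congr (fixingSubgroupEquiv K⟮z⟯).toEquiv, IsGalois.card_aut_eq_finrank]
      -- The pole orders two and three of `u` and `w` are coprime, so `m` divides the degree itself.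
      have h2 := dvd_finrank_mul (by lia) hz hzv huv
      have h3 := dvd_finrank_mul (by lia) hz hzv hwv
      have h4 : (m : ℤ) ∣ (Module.finrank K⟮z⟯ L : ℤ) := by
        have := dvd_sub h3 h2
        rwa [← mul_sub, show (3 : ℤ) - 2 = 1 by norm_num, mul_one] at this
      exact hm.trans (Nat.le_of_dvd Module.finrank_pos (by exact_mod_cast h4))
    have hfix : ∀ (z : L), ∀ σ ∈ fixingSubgroup K⟮z⟯, σ z = z := fun z σ hσ =>
      (IntermediateField.mem_fixingSubgroup_iff _ _).mp hσ z (mem_adjoin_simple_self K z)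
    have hcy := hcard y hy hyv
    have hcw := hcard (y - x) (sub_mem hy hx) hxyv
    have := Nat.finite_of_card_ne_zero (α := fixingSubgroup K⟮y⟯) (by lia)
    have := Nat.finite_of_card_ne_zero (α := fixingSubgroup K⟮y - x⟯) (by lia)
    obtain ⟨σ, ⟨hσ1, hσ2⟩, hne⟩ := exists_ne_one_mem_inf hres hno hu huv hw hwv
      (fun σ h => hext σ (h x hx) (h y hy))
      (fixingSubgroup_le_stabilizer hy (hyv ▸ hone))
      (fixingSubgroup_le_stabilizer (sub_mem hy hx) (hxyv ▸ hone)) hcy hcw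
    have h1 := hfix y σ hσ1
    have h2 := hfix (y - x) σ hσ2
    rw [map_sub, h1] at h2
    exact hne (hext σ (sub_right_injective h2) h1)

end Place

end GenusAtMostOne

/-! ### Existence, coordinate changes and specialization of generic points. -/

section GenericPointConstructions

open IntermediateField MvPolynomial

variable {K L : Type*} [Field K] [Field L] [Algebra K L]

theorem IsGenericCurvePoint.smul {f : MvPolynomial (Fin 3) K} {φ : Fin 3 → L}
    (h : IsGenericCurvePoint f φ) {c : L} (hc : c ≠ 0) : IsGenericCurvePoint f (c • φ) where
  aeval_eq_zero_iff n g hg := by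
    rw [aeval_smul_of_isHomogeneous hg, mul_eq_zero, or_iff_right (pow_ne_zero n hc),
      h.aeval_eq_zero_iff n g hg]
  adjoin_eq_top := by
    rw [← h.adjoin_eq_top]
    congr 1
    ext z
    simp only [Pi.smul_apply, smul_eq_mul, mul_div_mul_left _ _ hc]

theorem GeomIrredPlaneCurve.exists_isGenericCurvePoint {F : Type*} [Field F] [Algebra F K] {d : ℕ}
    (C : GeomIrredPlaneCurve F K d) (hd : 2 ≤ d) :
    ∃ φ : Fin 3 → C.functionField, IsGenericCurvePoint (map (algebraMap F K) C.poly) φ := by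
  have hhom : (map (algebraMap F K) C.poly).IsHomogeneous d := C.isHomogeneous.map _
  have hX : ∀ g : MvPolynomial (Fin 3) K,
      (algebraMap C.coordinateRing (FractionRing C.coordinateRing) (Ideal.Quotient.mk C.ideal g) = 0
        ↔ map (algebraMap F K) C.poly ∣ g) := by
    intro g
    rw [map_eq_zero_iff _ (IsFractionRing.injective C.coordinateRing _), Ideal.Quotient.eq_zero_iff_mem,
      Ideal.mem_span_singleton]
  have hX1 : ¬ map (algebraMap F K) C.poly ∣ (X 1 : MvPolynomial (Fin 3) K) := by
    have := not_dvd_linear hhom hd (c := Pi.single 1 1) (by simp)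
    simpa [Fin.sum_univ_three, Pi.single_apply] using this
  set ψ : Fin 3 → FractionRing C.coordinateRing := fun i =>
    algebraMap C.coordinateRing _ (Ideal.Quotient.mk C.ideal (X i)) with hψ
  have hψ1 : ψ 1 ≠ 0 := fun h => hX1 ((hX _).mp h)
  have haeval : ∀ g : MvPolynomial (Fin 3) K, aeval ψ g =
      algebraMap C.coordinateRing _ (Ideal.Quotient.mk C.ideal g) := by
    intro g
    have : (aeval ψ : MvPolynomial (Fin 3) K →ₐ[K] FractionRing C.coordinateRing) =
        (IsScalarTower.toAlgHom K C.coordinateRing (FractionRing C.coordinateRing)).comp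
          (Ideal.Quotient.mkₐ K C.ideal) := by
      apply MvPolynomial.algHom_ext
      intro i
      rw [aeval_X]
      rfl
    rw [this]
    rfl
  let φ : Fin 3 → C.functionField := fun i =>
    ⟨C.ratio (X i) (X 1), 1, X i, X 1, isHomogeneous_X K i, isHomogeneous_X K 1, rfl⟩
  have hφ : (fun i => ((φ i : C.functionField) : FractionRing C.coordinateRing)) = (ψ 1)⁻¹ • ψ := by
    funext i
    simp only [φ, Pi.smul_apply, smul_eq_mul]
    rw [inv_mul_eq_div]
    rfl
  have hval : ∀ (n : ℕ) (g : MvPolynomial (Fin 3) K), g.IsHomogeneous n →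
      ((aeval φ g : C.functionField) : FractionRing C.coordinateRing) =
        (ψ 1)⁻¹ ^ n * algebraMap C.coordinateRing _ (Ideal.Quotient.mk C.ideal g) := by
    intro n g hg
    rw [← haeval, ← aeval_smul_of_isHomogeneous hg, ← hφ]
    exact comp_aeval_apply φ C.functionField.val g
  refine ⟨φ, ⟨fun n g hg => ?_, ?_⟩⟩
  · rw [← hX, ← ZeroMemClass.coe_eq_zero, hval n g hg, mul_eq_zero,
      or_iff_right (pow_ne_zero n (inv_ne_zero hψ1))]
  · rw [eq_top_iff]
    rintro ⟨z, n, a, b, ha, hb, rfl⟩ -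
    have hφ1 : φ 1 = 1 := by
      apply Subtype.ext
      exact div_self hψ1
    have hmem : ∀ g : MvPolynomial (Fin 3) K, aeval φ g ∈ adjoin K {z | ∃ i j, z = φ i / φ j} := by
      intro g
      refine algebra_adjoin_le_adjoin K _ ?_
      refine Algebra.adjoin_mono (s := Set.range φ) ?_ ?_
      · rintro _ ⟨i, rfl⟩
        exact ⟨i, 1, by rw [hφ1, div_one]⟩
      · rw [Algebra.adjoin_range_eq_range_aeval]
        exact ⟨g, rfl⟩
    have : (⟨C.ratio a b, n, a, b, ha, hb, rfl⟩ : C.functionField) = aeval φ a / aeval φ b := by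
      apply Subtype.ext
      change C.ratio a b = ((aeval φ a : C.functionField) : FractionRing C.coordinateRing) /
        ((aeval φ b : C.functionField) : FractionRing C.coordinateRing)
      rw [hval n a ha, hval n b hb, mul_div_mul_left _ _ (pow_ne_zero n (inv_ne_zero hψ1))]
      rfl
    have h2 := div_mem (hmem a) (hmem b)
    rw [← this] at h2
    exact h2

/-- The pullback of a polynomial under a linear map of the coordinates. -/
noncomputable def MvPolynomial.linearPullback (M : Matrix (Fin 3) (Fin 3) K) :
    MvPolynomial (Fin 3) K →ₐ[K] MvPolynomial (Fin 3) K :=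
  aeval fun i => ∑ j, C (M i j) * X j

theorem aeval_linearPullback {A : Type*} [CommRing A] [Algebra K A] (M : Matrix (Fin 3) (Fin 3) K)
    (φ : Fin 3 → A) (g : MvPolynomial (Fin 3) K) :
    aeval φ (linearPullback M g) = aeval ((M.map (algebraMap K A)).mulVec φ) g := by
  have : (aeval φ).comp (linearPullback M) =
      aeval (R := K) ((M.map (algebraMap K A)).mulVec φ) := by
    apply MvPolynomial.algHom_ext
    intro i
    rw [AlgHom.comp_apply, linearPullback, aeval_X, aeval_X, map_sum]
    simp [Matrix.mulVec, dotProduct]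
  rw [← this]
  rfl

theorem linearPullback_mul (M N : Matrix (Fin 3) (Fin 3) K) (g : MvPolynomial (Fin 3) K) :
    linearPullback N (linearPullback M g) = linearPullback (M * N) g := by
  have : (linearPullback N).comp (linearPullback M) = linearPullback (M * N) := by
    apply MvPolynomial.algHom_ext
    intro i
    simp only [linearPullback, AlgHom.comp_apply, aeval_X, map_sum, map_mul, aeval_C,
      Matrix.mul_apply, Finset.mul_sum, Finset.sum_mul, algebraMap_eq]
    rw [Finset.sum_comm]
    exact Finset.sum_congr rfl fun j _ => Finset.sum_congr rfl fun k _ => (mul_assoc _ _ _).symm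
  rw [← this]
  rfl

theorem linearPullback_one (g : MvPolynomial (Fin 3) K) : linearPullback 1 g = g := by
  have : linearPullback (1 : Matrix (Fin 3) (Fin 3) K) = AlgHom.id K _ := by
    apply MvPolynomial.algHom_ext
    intro i
    rw [linearPullback, aeval_X]
    simp [Matrix.one_apply]
  rw [this]
  rfl

theorem isHomogeneous_linearPullback (M : Matrix (Fin 3) (Fin 3) K) {g : MvPolynomial (Fin 3) K}
    {n : ℕ} (hg : g.IsHomogeneous n) : (linearPullback M g).IsHomogeneous n := by
  have := IsHomogeneous.aeval hg (fun i => ∑ j, C (M i j) * X j : Fin 3 → MvPolynomial (Fin 3) K)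
    fun i => isHomogeneous_linear (M i)
  rwa [one_mul] at this

theorem IsGenericCurvePoint.linear_change {f : MvPolynomial (Fin 3) K} {φ ψ : Fin 3 → L}
    (h : IsGenericCurvePoint f φ) {M N : Matrix (Fin 3) (Fin 3) K} (hMN : M * N = 1)
    (hNM : N * M = 1) (hψ : φ = (M.map (algebraMap K L)).mulVec ψ) :
    IsGenericCurvePoint (linearPullback M f) ψ := by
  have hψφ : ψ = (N.map (algebraMap K L)).mulVec φ := by
    rw [hψ, Matrix.mulVec_mulVec, ← Matrix.map_mul, hNM]
    simp
  refine ⟨fun n g hg => ?_, ?_⟩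
  · have h1 := h.aeval_eq_zero_iff n _ (isHomogeneous_linearPullback N hg)
    rw [aeval_linearPullback, ← hψφ] at h1
    rw [h1]
    constructor
    · intro h2
      have := map_dvd (linearPullback M) h2
      rwa [linearPullback_mul, hNM, linearPullback_one] at this
    · intro h2
      have := map_dvd (linearPullback N) h2
      rwa [linearPullback_mul, hMN, linearPullback_one] at this
  · rw [eq_top_iff, ← h.adjoin_eq_top, adjoin_le_iff]
    rintro _ ⟨i, j, rfl⟩
    obtain ⟨l, hl⟩ : ∃ l, ψ l ≠ 0 ∨ ∀ i, φ i = 0 := by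
      by_contra! hcon
      obtain ⟨i, hi⟩ := (hcon 0).2
      apply hi
      rw [hψ]
      simp [Matrix.mulVec, dotProduct, fun l => (hcon l).1]
    rcases hl with hl | hl
    · have key : ∀ i, φ i / ψ l ∈ adjoin K {z | ∃ i j, z = ψ i / ψ j} := by
        intro i
        rw [hψ]
        simp only [Matrix.mulVec, dotProduct, Matrix.map_apply, Finset.sum_div, mul_div_assoc]
        exact sum_mem fun k _ => mul_mem (IntermediateField.algebraMap_mem _ _)
          (subset_adjoin _ _ ⟨k, l, rfl⟩)
      have := div_mem (key i) (key j)
      rwa [div_div_div_cancel_right₀ hl] at this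
    · simp only [SetLike.mem_coe]
      rw [hl i, zero_div]
      exact zero_mem _

/-- Homogenize `g` with `X j`, whose value is `1` at both points; a form that vanishes at the
generic point is divisible by `f`. -/
theorem IsGenericCurvePoint.eval_eq_zero {f : MvPolynomial (Fin 3) K} {φ : Fin 3 → L}
    (h : IsGenericCurvePoint f φ) {j : Fin 3} (hφ : φ j = 1) {e : Fin 3 → K} (he : e j = 1)
    (hfe : eval e f = 0) {g : MvPolynomial (Fin 3) K} (hg : aeval φ g = 0) : eval e g = 0 := by
  set N := g.totalDegree
  set G : MvPolynomial (Fin 3) K :=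
    ∑ i ∈ Finset.range (N + 1), homogeneousComponent i g * X j ^ (N - i) with hG
  have hGhom : G.IsHomogeneous N := by
    refine IsHomogeneous.sum _ _ _ fun i hi => ?_
    have := (homogeneousComponent_isHomogeneous i g).mul (isHomogeneous_X_pow (R := K) j (N - i))
    have hi' := Finset.mem_range.mp hi
    rwa [show i + (N - i) = N by lia] at this
  have h1 : aeval φ G = 0 := by
    rw [← hg]
    conv_rhs => rw [← sum_homogeneousComponent g]
    rw [hG, map_sum, map_sum]
    refine Finset.sum_congr rfl fun i _ => ?_
    rw [map_mul, map_pow, aeval_X, hφ, one_pow, mul_one]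
  obtain ⟨k, hk⟩ := (h.aeval_eq_zero_iff N G hGhom).mp h1
  have h2 : eval e G = eval e g := by
    conv_rhs => rw [← sum_homogeneousComponent g]
    rw [hG, map_sum, map_sum]
    refine Finset.sum_congr rfl fun i _ => ?_
    rw [map_mul, map_pow, eval_X, he, one_pow, mul_one]
  rw [← h2, hk, map_mul, hfe, zero_mul]

/-- A generic point specializes to every point of the curve along some valuation ring. -/
theorem IsGenericCurvePoint.exists_valuationSubring {f : MvPolynomial (Fin 3) K} {φ : Fin 3 → L}
    (h : IsGenericCurvePoint f φ) {j : Fin 3} (hφ : φ j = 1) {e : Fin 3 → K} (he : e j = 1)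
    (hfe : eval e f = 0) : ∃ V : ValuationSubring L, (∀ c : K, algebraMap K L c ∈ V) ∧
      ∀ i, φ i - algebraMap K L (e i) ∈ V.nonunits := by
  set A : Subring L := (aeval φ : MvPolynomial (Fin 3) K →ₐ[K] L).toRingHom.range with hA
  set π : MvPolynomial (Fin 3) K →+* A := (aeval φ : MvPolynomial (Fin 3) K →ₐ[K] L).toRingHom.rangeRestrict
  -- The maximal ideal of the point stays proper in the affine coordinate ring, because every
  -- relation at the generic point holds at the special one.
  have hI : Ideal.map π (RingHom.ker (eval e)) ≠ ⊤ := by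
    intro htop
    rw [Ideal.eq_top_iff_one, Ideal.mem_map_iff_of_surjective π (RingHom.rangeRestrict_surjective _)]
      at htop
    obtain ⟨g, hg, hg1⟩ := htop
    have h1 : aeval φ g = 1 := congrArg Subtype.val hg1
    have h2 := h.eval_eq_zero hφ he hfe (g := g - 1) (by rw [map_sub, h1, map_one, sub_self])
    rw [map_sub, map_one, (RingHom.mem_ker).mp hg, zero_sub] at h2
    exact neg_ne_zero.mpr one_ne_zero h2
  obtain ⟨V, hAV, hIV⟩ := Ideal.image_subset_nonunits_valuationSubring _ hI
  refine ⟨V, fun c => hAV ⟨C c, by simp⟩, fun i => hIV ⟨π (X i - C (e i)), ?_, ?_⟩⟩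
  · exact Ideal.mem_map_of_mem _ (by simp)
  · change aeval φ (X i - C (e i)) = _
    simp

end GenericPointConstructions

/-! ### The place of a smooth point. -/

section SmoothPoint

open IntermediateField MvPolynomial

variable {K L : Type*} [Field K] [Field L] [Algebra K L]

theorem MvPolynomial.aeval_congr_mod {A : Type*} [CommRing A] [Algebra K A] (I : Ideal A)
    {φ ψ : Fin 3 → A} (h : ∀ i, φ i - ψ i ∈ I) (g : MvPolynomial (Fin 3) K) :
    aeval φ g - aeval ψ g ∈ I := by
  rw [← Ideal.Quotient.eq_zero_iff_mem, map_sub, sub_eq_zero]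
  have h1 := comp_aeval_apply φ (Ideal.Quotient.mkₐ K I) g
  have h2 := comp_aeval_apply ψ (Ideal.Quotient.mkₐ K I) g
  have h3 : (fun i => Ideal.Quotient.mkₐ K I (φ i)) = fun i => Ideal.Quotient.mkₐ K I (ψ i) := by
    funext i
    exact Ideal.Quotient.eq.mpr (h i)
  rw [h3, ← h2] at h1
  exact h1

theorem exists_aeval_eq_of_eval_eq_zero {φ : Fin 3 → L} (hφ : φ 1 = 1)
    {g : MvPolynomial (Fin 3) K} (hg : eval ![0, 1, 0] g = 0) :
    ∃ a b : MvPolynomial (Fin 3) K, aeval φ g = φ 0 * aeval φ a + φ 2 * aeval φ b := by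
  have h1 := MvPolynomial.aeval_congr_mod (Ideal.span {X 0, X 2, X 1 - 1})
    (φ := (X : Fin 3 → MvPolynomial (Fin 3) K)) (ψ := fun i => C ((![0, 1, 0] : Fin 3 → K) i))
    (by
      intro i
      fin_cases i
      · simpa using Ideal.subset_span (by simp)
      · simpa using Ideal.subset_span (by simp)
      · simpa using Ideal.subset_span (by simp)) g
  have h2 : aeval (fun i => C ((![0, 1, 0] : Fin 3 → K) i)) g =
      (C (eval ![0, 1, 0] g) : MvPolynomial (Fin 3) K) := by
    have := comp_aeval_apply (![0, 1, 0] : Fin 3 → K) (Algebra.ofId K (MvPolynomial (Fin 3) K)) g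
    exact this.symm
  rw [h2, hg, map_zero, sub_zero, aeval_X_left_apply, Ideal.mem_span_insert] at h1
  obtain ⟨a, y, hy, hgy⟩ := h1
  obtain ⟨b, c, hbc⟩ := Ideal.mem_span_pair.mp hy
  refine ⟨a, b, ?_⟩
  rw [hgy, ← hbc]
  simp [hφ]
  ring

theorem ValuationSubring.aeval_sub_mem_nonunits (V : ValuationSubring L)
    (hV : ∀ c : K, algebraMap K L c ∈ V) {φ : Fin 3 → L} {e : Fin 3 → K}
    (h : ∀ i, φ i - algebraMap K L (e i) ∈ V.nonunits) (g : MvPolynomial (Fin 3) K) :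
    aeval φ g - algebraMap K L (eval e g) ∈ V.nonunits := by
  simp only [ValuationSubring.mem_nonunits_iff] at h ⊢
  have hc : ∀ c : K, V.valuation (algebraMap K L c) ≤ 1 := fun c =>
    (V.valuation_le_one_iff _).mpr (hV c)
  induction g using MvPolynomial.induction_on with
  | C a => simp
  | add p q hp hq =>
    rw [map_add, map_add, map_add, add_sub_add_comm]
    exact Valuation.map_add_lt _ hp hq
  | mul_X p i hp =>
    have : aeval φ (p * X i) - algebraMap K L (eval e (p * X i)) =
        (aeval φ p - algebraMap K L (eval e p)) * φ i +
          algebraMap K L (eval e p) * (φ i - algebraMap K L (e i)) := by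
      simp only [map_mul, aeval_X, eval_X]
      ring
    rw [this]
    have hφi : V.valuation (φ i) ≤ 1 := by
      rw [← sub_add_cancel (φ i) (algebraMap K L (e i))]
      exact V.valuation.map_add_le (h i).le (hc _)
    refine Valuation.map_add_lt _ ?_ ?_
    · rw [map_mul]
      exact (mul_le_of_le_one_right' hφi).trans_lt hp
    · rw [map_mul]
      exact (mul_le_of_le_one_left' (hc _)).trans_lt (h i)

theorem Place.valuation_aeval_eq_one (P : Place K L) {φ : Fin 3 → L} {e : Fin 3 → K}
    (h : ∀ i, φ i - algebraMap K L (e i) ∈ P.valuationRing.nonunits)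
    {g : MvPolynomial (Fin 3) K} (hg : eval e g ≠ 0) : P.valuation (aeval φ g) = 1 := by
  have h1 := P.valuationRing.aeval_sub_mem_nonunits P.algebraMap_mem h g
  rw [← P.valuation_lt_one_iff] at h1
  have h2 := P.valuation_algebraMap hg
  rw [← sub_add_cancel (aeval φ g) (algebraMap K L (eval e g)),
    Valuation.map_add_eq_of_lt_right _ (h2 ▸ h1), h2]

/-- The local ring of a plane curve at a smooth point is a place. -/
theorem IsGenericCurvePoint.exists_place_of_smooth {f : MvPolynomial (Fin 3) K} {φ : Fin 3 → L}
    (h : IsGenericCurvePoint f φ) (hφ : φ 1 = 1) (hu0 : φ 0 ≠ 0) {F₁ F₂ : MvPolynomial (Fin 3) K}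
    (hf : f = X 0 * F₁ + X 2 * F₂) (hF₁ : eval ![0, 1, 0] F₁ = 0) (hF₂ : eval ![0, 1, 0] F₂ ≠ 0)
    (hfhom : ∃ d, f.IsHomogeneous d)
    (hdvr : ∀ V : ValuationSubring L, (∀ c : K, algebraMap K L c ∈ V) → V ≠ ⊤ →
      IsDiscreteValuationRing V) :
    ∃ P : Place K L, (∀ z, P.valuation z ≤ 1 → ∃ c : K, P.valuation (z - algebraMap K L c) < 1) ∧
      P.valuation (φ 0) = WithZero.exp (-1) ∧ P.valuation (φ 2) ≤ WithZero.exp (-2) ∧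
      (∀ V : ValuationSubring L, (∀ c : K, algebraMap K L c ∈ V) → φ 0 ∈ V.nonunits →
        φ 2 ∈ V.nonunits → V = P.valuationRing) := by
  set e : Fin 3 → K := ![0, 1, 0] with he
  have he1 : e 1 = 1 := rfl
  have hfe : eval e f = 0 := by rw [hf]; simp [he]
  obtain ⟨d, hfd⟩ := hfhom
  have hfφ : φ 0 * aeval φ F₁ + φ 2 * aeval φ F₂ = 0 := by
    have := (h.aeval_eq_zero_iff d f hfd).mpr dvd_rfl
    rw [hf] at this
    simpa using this
  have hne : ∀ g : MvPolynomial (Fin 3) K, eval e g ≠ 0 → aeval φ g ≠ 0 := fun g hg h0 =>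
    hg (h.eval_eq_zero hφ he1 hfe h0)
  -- On the curve `φ 2 * F₂ = -φ 0 * F₁` with `F₂` a unit at the point. So, up to that unit, every
  -- function vanishing at the point is divisible by `φ 0`.
  have hstep : ∀ g : MvPolynomial (Fin 3) K, eval e g = 0 →
      ∃ g' : MvPolynomial (Fin 3) K, aeval φ g * aeval φ F₂ = φ 0 * aeval φ g' := by
    intro g hg
    obtain ⟨a, b, hab⟩ := exists_aeval_eq_of_eval_eq_zero hφ hg
    refine ⟨a * F₂ - b * F₁, ?_⟩
    rw [hab, map_sub, map_mul, map_mul]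
    linear_combination aeval φ b * hfφ
  have hplace : ∀ V : ValuationSubring L, (∀ c : K, algebraMap K L c ∈ V) → φ 0 ∈ V.nonunits →
      φ 2 ∈ V.nonunits → ∃ Q : Place K L, Q.valuationRing = V ∧
        ∀ i, φ i - algebraMap K L (e i) ∈ Q.valuationRing.nonunits := by
    intro V hV h0 h2
    have htop : V ≠ ⊤ := by
      rintro rfl
      rw [ValuationSubring.mem_nonunits_iff_or] at h0
      exact h0.elim hu0 fun h => h trivial
    refine ⟨⟨V, hV, hdvr V hV htop⟩, rfl, fun i => ?_⟩
    fin_cases i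
    · simpa [he] using h0
    · simp [he, hφ]
    · simpa [he] using h2
  obtain ⟨V₀, hV₀, hc₀⟩ := h.exists_valuationSubring hφ he1 hfe
  obtain ⟨P, hPV, hP⟩ := hplace V₀ hV₀ (by simpa [he] using hc₀ 0) (by simpa [he] using hc₀ 2)
  have hPu : P.valuation (φ 0) < 1 := by
    have := hP 0
    rw [← P.valuation_lt_one_iff] at this
    simpa [he] using this
  have hmem : ∀ g : MvPolynomial (Fin 3) K, P.valuation (aeval φ g) ≤ 1 := by
    intro g
    have h1 := P.valuationRing.aeval_sub_mem_nonunits P.algebraMap_mem hP g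
    rw [← P.valuation_lt_one_iff] at h1
    rw [← sub_add_cancel (aeval φ g) (algebraMap K L (eval e g))]
    exact P.valuation.map_add_le h1.le (P.valuation_algebraMap_le_one _)
  obtain ⟨j, hj⟩ := P.exists_valuation_eq_exp hu0
  have hj1 : j ≤ -1 := by
    rw [hj, ← WithZero.exp_zero, WithZero.exp_lt_exp] at hPu
    lia
  -- Splitting off factors `φ 0` terminates, as each lowers the order at `P`.
  have hpoly : ∀ n : ℕ, ∀ g : MvPolynomial (Fin 3) K, P.valuation (aeval φ g) = WithZero.exp (-n : ℤ) →
      ∃ (k : ℕ) (G H : MvPolynomial (Fin 3) K), eval e G ≠ 0 ∧ eval e H ≠ 0 ∧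
        aeval φ g * aeval φ H = φ 0 ^ k * aeval φ G := by
    intro n
    induction n using Nat.strong_induction_on with
    | _ n ih =>
      intro g hg
      by_cases hge : eval e g = 0
      · obtain ⟨g', hg'⟩ := hstep g hge
        have hv := congrArg P.valuation hg'
        rw [map_mul, map_mul, P.valuation_aeval_eq_one hP hF₂, mul_one, hg, hj] at hv
        have hg'0 : aeval φ g' ≠ 0 := by
          intro h0
          rw [h0, map_zero, mul_zero] at hv
          exact WithZero.exp_ne_zero hv
        obtain ⟨i, hi⟩ := P.exists_valuation_eq_exp hg'0
        have hi0 := hmem g'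
        rw [hi, ← WithZero.exp_zero, WithZero.exp_le_exp] at hi0
        rw [hi, ← WithZero.exp_add, WithZero.exp_inj] at hv
        obtain ⟨k, G, H, hG, hH, hGH⟩ := ih (-i).toNat (by lia) g' (by
          rw [hi, WithZero.exp_inj]
          lia)
        refine ⟨k + 1, G, H * F₂, hG, by rw [map_mul]; exact mul_ne_zero hH hF₂, ?_⟩
        rw [map_mul]
        linear_combination aeval φ H * hg' + φ 0 * hGH
      · exact ⟨0, g, 1, hge, by simp, by simp⟩
  have hpoly' : ∀ g : MvPolynomial (Fin 3) K, aeval φ g ≠ 0 →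
      ∃ (k : ℕ) (G H : MvPolynomial (Fin 3) K), eval e G ≠ 0 ∧ eval e H ≠ 0 ∧
        aeval φ g * aeval φ H = φ 0 ^ k * aeval φ G := by
    intro g hg
    obtain ⟨i, hi⟩ := P.exists_valuation_eq_exp hg
    have hi0 := hmem g
    rw [hi, ← WithZero.exp_zero, WithZero.exp_le_exp] at hi0
    exact hpoly (-i).toNat g (by rw [hi, WithZero.exp_inj]; lia)
  have hfrac : ∀ z : L, ∃ a b : MvPolynomial (Fin 3) K, z = aeval φ a / aeval φ b := by
    intro z
    have hz : z ∈ adjoin K (Set.range φ) := by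
      have h1 : adjoin K (Set.range φ) = ⊤ := by
        rw [eq_top_iff, ← h.adjoin_eq_top, adjoin_le_iff]
        rintro _ ⟨i, j, rfl⟩
        exact div_mem (subset_adjoin _ _ ⟨i, rfl⟩) (subset_adjoin _ _ ⟨j, rfl⟩)
      rw [h1]
      trivial
    obtain ⟨a, b, hab⟩ := (mem_adjoin_range_iff K φ z).mp hz
    exact ⟨a, b, hab⟩
  have hz : ∀ z : L, z ≠ 0 → ∃ (k : ℤ) (G H : MvPolynomial (Fin 3) K), eval e G ≠ 0 ∧
      eval e H ≠ 0 ∧ z = φ 0 ^ k * (aeval φ G / aeval φ H) := by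
    intro z hz0
    obtain ⟨a, b, rfl⟩ := hfrac z
    obtain ⟨ha, hb⟩ := div_ne_zero_iff.mp hz0
    obtain ⟨k, G, H, hG, hH, hGH⟩ := hpoly' a ha
    obtain ⟨k', G', H', hG', hH', hGH'⟩ := hpoly' b hb
    refine ⟨k - k', G * H', H * G', by rw [map_mul]; exact mul_ne_zero hG hH',
      by rw [map_mul]; exact mul_ne_zero hH hG', ?_⟩
    rw [zpow_sub₀ hu0, zpow_natCast, zpow_natCast, map_mul, map_mul, div_mul_div_comm,
      div_eq_div_iff hb (mul_ne_zero (pow_ne_zero _ hu0) (mul_ne_zero (hne H hH) (hne G' hG')))]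
    linear_combination (aeval φ G' * φ 0 ^ k') * hGH - (φ 0 ^ k * aeval φ G) * hGH'
  have hval : ∀ Q : Place K L, (∀ i, φ i - algebraMap K L (e i) ∈ Q.valuationRing.nonunits) →
      ∀ (k : ℤ) (G H : MvPolynomial (Fin 3) K), eval e G ≠ 0 → eval e H ≠ 0 →
        Q.valuation (φ 0 ^ k * (aeval φ G / aeval φ H)) = Q.valuation (φ 0) ^ k := by
    intro Q hQ k G H hG hH
    rw [map_mul, map_zpow₀, map_div₀, Q.valuation_aeval_eq_one hQ hG,
      Q.valuation_aeval_eq_one hQ hH, div_one, mul_one]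
  have hle : ∀ Q : Place K L, (∀ i, φ i - algebraMap K L (e i) ∈ Q.valuationRing.nonunits) →
      ∀ k : ℤ, Q.valuation (φ 0) ^ k ≤ 1 ↔ 0 ≤ k := by
    intro Q hQ k
    have hQu : Q.valuation (φ 0) < 1 := by
      have := hQ 0
      rw [← Q.valuation_lt_one_iff] at this
      simpa [he] using this
    obtain ⟨j, hj⟩ := Q.exists_valuation_eq_exp hu0
    rw [hj, ← WithZero.exp_zero, WithZero.exp_lt_exp] at hQu
    rw [hj, ← WithZero.exp_zsmul, ← WithZero.exp_zero, WithZero.exp_le_exp, smul_eq_mul]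
    constructor
    · intro h1
      by_contra! h2
      nlinarith
    · intro h1
      nlinarith
  -- Every element is a power of `φ 0` times a unit, so a uniformizer forces `φ 0` to have order
  -- one.
  have hu1 : P.valuation (φ 0) = WithZero.exp (-1) := by
    obtain ⟨π, hπ⟩ := P.exists_uniformizer
    have hπ0 : π ≠ 0 := by
      rintro rfl
      rw [map_zero] at hπ
      exact WithZero.exp_ne_zero hπ.symm
    obtain ⟨k, G, H, hG, hH, rfl⟩ := hz π hπ0
    rw [hval P hP k G H hG hH, hj, ← WithZero.exp_zsmul, WithZero.exp_inj, smul_eq_mul] at hπ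
    rw [hj, WithZero.exp_inj]
    have := Int.eq_one_or_neg_one_of_mul_eq_neg_one' hπ
    lia
  refine ⟨P, ?_, hu1, ?_, ?_⟩
  · intro z hzv
    by_cases hz0 : z = 0
    · exact ⟨0, by simp [hz0]⟩
    obtain ⟨k, G, H, hG, hH, rfl⟩ := hz z hz0
    rw [hval P hP k G H hG hH, hle P hP] at hzv
    rcases hzv.lt_or_eq with h1 | h1
    · refine ⟨0, ?_⟩
      rw [map_zero, sub_zero, hval P hP k G H hG hH, hu1, ← WithZero.exp_zsmul, ← WithZero.exp_zero,
        WithZero.exp_lt_exp, smul_eq_mul]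
      lia
    · refine ⟨eval e G / eval e H, ?_⟩
      rw [← h1, zpow_zero, one_mul, map_div₀, div_sub_div _ _ (hne H hH)
        ((_root_.map_ne_zero _).mpr hH), map_div₀, map_mul, P.valuation_aeval_eq_one hP hH,
        P.valuation_algebraMap hH, mul_one, div_one]
      have h2 := P.valuationRing.aeval_sub_mem_nonunits P.algebraMap_mem hP
        (G * C (eval e H) - H * C (eval e G))
      rw [← P.valuation_lt_one_iff] at h2
      simpa [mul_comm] using h2
  -- As `F₁` vanishes at the point, that is, as the tangent is `X 2 = 0`, the function `φ 2 = -φ 0 *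
  -- F₁ / F₂` has order at least two.
  · have h3 := P.valuationRing.aeval_sub_mem_nonunits P.algebraMap_mem hP F₁
    rw [← P.valuation_lt_one_iff, hF₁, map_zero, sub_zero] at h3
    have h4 : φ 2 * aeval φ F₂ = -(φ 0 * aeval φ F₁) := by linear_combination hfφ
    have h5 := congrArg P.valuation h4
    rw [map_mul, P.valuation_aeval_eq_one hP hF₂, mul_one, Valuation.map_neg, map_mul, hu1] at h5
    by_cases h6 : aeval φ F₁ = 0
    · rw [h5, h6]
      simp
    obtain ⟨i, hi⟩ := P.exists_valuation_eq_exp h6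
    rw [hi, ← WithZero.exp_zero, WithZero.exp_lt_exp] at h3
    rw [h5, hi, ← WithZero.exp_add, WithZero.exp_le_exp]
    lia
  · intro V hV h0 h2
    obtain ⟨Q, rfl, hQ⟩ := hplace V hV h0 h2
    ext z
    by_cases hz0 : z = 0
    · simp [hz0]
    obtain ⟨k, G, H, hG, hH, rfl⟩ := hz z hz0
    rw [← Q.valuation_le_one_iff, ← P.valuation_le_one_iff, hval P hP k G H hG hH,
      hval Q hQ k G H hG hH, hle P hP, hle Q hQ]

end SmoothPoint

/-! ### Three Galois points on the tangent at a smooth point. -/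

section SmoothGaloisPoint

open IntermediateField MvPolynomial

variable {K L : Type*} [Field K] [Field L] [Algebra K L]

namespace Place

theorem transcendental_of_one_lt [IsAlgClosed K] (P : Place K L) {z : L}
    (hz : 1 < P.valuation z) : Transcendental K z := by
  intro h
  obtain ⟨c, rfl⟩ := mem_range_algebraMap_of_isAlgebraic h
  exact (P.valuation_algebraMap_le_one c).not_gt hz

variable {P : Place K L} [IsAlgClosed K]

/-- All poles of `z` are conjugate to `P`: apply transitivity to the zeros of `z⁻¹`. -/
theorem exists_algEquiv_of_notMem {z : L} [FiniteDimensional K⟮z⟯ L] [IsGalois K⟮z⟯ L]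
    (hz : 1 < P.valuation z) {V : ValuationSubring L} (hV : ∀ c : K, algebraMap K L c ∈ V)
    (hzV : z ∉ V) : ∃ σ : L ≃ₐ[K] L, σ z = z ∧ ∀ a, a ∈ V ↔ σ a ∈ P.valuationRing := by
  have htr : Transcendental K z⁻¹ := fun h =>
    P.transcendental_of_one_lt hz (by simpa using h.inv)
  have e : K⟮z⁻¹⟯ = K⟮z⟯ := by
    refine le_antisymm ?_ ?_ <;> rw [adjoin_simple_le_iff]
    · exact inv_mem (mem_adjoin_simple_self K z)
    · simpa using inv_mem (mem_adjoin_simple_self K z⁻¹)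
  have h1 : FiniteDimensional K⟮z⁻¹⟯ L := by rw [e]; infer_instance
  have h2 : IsGalois K⟮z⁻¹⟯ L := by rw [e]; infer_instance
  obtain ⟨σ, hσ, h⟩ := ValuationSubring.exists_algEquiv_of_nonunits htr V P.valuationRing hV
    P.algebraMap_mem (by rw [ValuationSubring.mem_nonunits_iff_or, inv_inv]; exact Or.inr hzV) (by
      rw [ValuationSubring.mem_nonunits_iff_or, inv_inv, ← P.valuation_le_one_iff]
      exact Or.inr hz.not_ge)
  exact ⟨σ, inv_injective (by rw [← map_inv₀, hσ]), h⟩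

omit [IsAlgClosed K] in
theorem valuation_apply_eq_of_iff {σ τ : L ≃ₐ[K] L} {V : ValuationSubring L}
    (hσ : ∀ a, a ∈ V ↔ σ a ∈ P.valuationRing) (hτ : ∀ a, a ∈ V ↔ τ a ∈ P.valuationRing) (z : L) :
    P.valuation (σ z) = P.valuation (τ z) := by
  have := P.valuation_apply_of_stable (τ * σ⁻¹) (fun x => by
    rw [AlgEquiv.mul_apply, ← hτ, hσ, show σ (σ⁻¹ x) = x from σ.apply_symm_apply x]) (σ z)
  rw [← this, AlgEquiv.mul_apply, show σ⁻¹ (σ z) = z from σ.symm_apply_apply z]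

/-- The order of a function at a pole `V` can be read at `P` through any automorphism carrying `V`
to `P`. A second pole of `x` leads either to two different orders for `y - x` or, if it is also a
pole of `y`, to a zero of both `x / y` and `1 / y`, that is, to the same point of the curve. -/
theorem mem_poleRing_of_isGalois {x y : L} {m : ℕ} (hm : 2 ≤ m)
    (hxv : P.valuation x = WithZero.exp ((m - 1 : ℕ) : ℤ))
    (hyv : P.valuation y = WithZero.exp (m : ℤ))
    (huniq : ∀ V : ValuationSubring L, (∀ c : K, algebraMap K L c ∈ V) → x / y ∈ V.nonunits →
        y⁻¹ ∈ V.nonunits → V = P.valuationRing)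
    [FiniteDimensional K⟮x⟯ L] [IsGalois K⟮x⟯ L] [FiniteDimensional K⟮y⟯ L] [IsGalois K⟮y⟯ L]
    [FiniteDimensional K⟮y - x⟯ L] [IsGalois K⟮y - x⟯ L] : x ∈ P.poleRing ∧ y ∈ P.poleRing := by
  have hxyv : P.valuation (y - x) = WithZero.exp (m : ℤ) := by
    rw [Valuation.map_sub_eq_of_lt_left, hyv]
    rw [hxv, hyv, WithZero.exp_lt_exp]
    lia
  have hone : ∀ n : ℕ, 1 ≤ n → (1 : ℤᵐ⁰) < WithZero.exp (n : ℤ) := by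
    intro n hn
    rw [← WithZero.exp_zero, WithZero.exp_lt_exp]
    lia
  have hy0 : y ≠ 0 := by
    rintro rfl
    rw [map_zero] at hyv
    exact WithZero.exp_ne_zero hyv.symm
  have hx : x ∈ P.poleRing := by
    intro V hV hne
    by_contra hxV
    obtain ⟨σ, hσx, hσ⟩ := exists_algEquiv_of_notMem (hxv ▸ hone _ (by lia)) hV hxV
    by_cases hyV : y ∈ V
    -- With `y` regular at `V`, the pole order of `y - x` is that of `x`, namely `m - 1`, through
    -- `σ`, but `m` through `τ`.
    · have hxyV : y - x ∉ V := fun h => hxV (by simpa using sub_mem hyV h)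
      obtain ⟨τ, hτx, hτ⟩ := exists_algEquiv_of_notMem (hxyv ▸ hone _ (by lia)) hV hxyV
      have h1 := valuation_apply_eq_of_iff hσ hτ (y - x)
      have h2 := (hσ y).mp hyV
      rw [← P.valuation_le_one_iff] at h2
      rw [hτx, hxyv, map_sub, hσx, Valuation.map_sub_eq_of_lt_right, hxv, WithZero.exp_inj] at h1
      · lia
      · rw [hxv]
        exact h2.trans_lt (hone _ (by lia))
    · obtain ⟨τ, hτy, hτ⟩ := exists_algEquiv_of_notMem (hyv ▸ hone _ (by lia)) hV hyV
      have h1 := valuation_apply_eq_of_iff hσ hτ y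
      rw [hτy, hyv] at h1
      have hnon : ∀ z, P.valuation (σ z) < 1 → z ∈ V.nonunits := by
        intro z hz
        rw [ValuationSubring.mem_nonunits_iff_or, hσ]
        rw [P.valuation_lt_one_iff, ValuationSubring.mem_nonunits_iff_or, ← map_inv₀,
          EmbeddingLike.map_eq_zero_iff] at hz
        exact hz
      refine hne (huniq V hV (hnon _ ?_) (hnon _ ?_))
      · rw [map_div₀, map_div₀, hσx, h1, hxv, ← WithZero.exp_sub, ← WithZero.exp_zero,
          WithZero.exp_lt_exp]
        lia
      · rw [map_inv₀, map_inv₀, h1, ← WithZero.exp_neg, ← WithZero.exp_zero, WithZero.exp_lt_exp]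
        lia
  refine ⟨hx, fun V hV hne => ?_⟩
  by_contra hyV
  have h1 : y⁻¹ ∈ V.nonunits := by
    rw [ValuationSubring.mem_nonunits_iff_or, inv_inv]
    exact Or.inr hyV
  refine hne (huniq V hV ?_ h1)
  rw [ValuationSubring.mem_nonunits_iff] at h1 ⊢
  rw [div_eq_mul_inv, map_mul]
  exact (mul_le_of_le_one_left' ((V.valuation_le_one_iff _).mpr (hx V hV hne))).trans_lt h1

end Place

variable [IsAlgClosed K]

theorem IsGenericCurvePoint.normal_form {p : ℕ} [Fact p.Prime] [CharP K p]
    {f : MvPolynomial (Fin 3) K} {φ : Fin 3 → L} (h : IsGenericCurvePoint f φ) (hφ : φ 1 = 1)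
    {d : ℕ} (hd : 4 ≤ d) (hfd : f.IsHomogeneous d) {F₁ F₂ : MvPolynomial (Fin 3) K}
    (hf : f = X 0 * F₁ + X 2 * F₂) (hF₁ : eval ![0, 1, 0] F₁ = 0) (hF₂ : eval ![0, 1, 0] F₂ ≠ 0)
    {x y : L} (hx : x = φ 0 / φ 2) (hy : y = φ 1 / φ 2)
    [IsGalois K⟮x⟯ L] [IsGalois K⟮y⟯ L] [IsGalois K⟮y - x⟯ L]
    (hgenus : functionFieldGenus K L ≤ 1) :
    ∃ (s : L) (e : ℕ) (κ γ δ : K), Transcendental K s ∧ K⟮s⟯ = ⊤ ∧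
      d = p ^ e + 1 ∧ κ ≠ 0 ∧ x = algebraMap K L κ * (s ^ p ^ e + s) + algebraMap K L γ ∧
      y = algebraMap K L κ * s ^ (p ^ e + 1) + algebraMap K L δ := by
  have hlin := fun c hc => h.linear_ne_zero hfd (by lia) (c := c) hc
  have hu0 : φ 0 ≠ 0 := by
    simpa [Fin.sum_univ_three, Pi.single_apply] using hlin (Pi.single 0 1) (by simp)
  have hw0 : φ 2 ≠ 0 := by
    simpa [Fin.sum_univ_three, Pi.single_apply] using hlin (Pi.single 2 1) (by simp)
  have hxtr : Transcendental K x := by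
    intro halg
    obtain ⟨c, hc⟩ := mem_range_algebraMap_of_isAlgebraic halg
    apply hlin ![1, 0, -c] (by
      intro h0
      simpa using congrFun h0 0)
    rw [hx, eq_div_iff hw0] at hc
    simp only [Fin.sum_univ_three, Matrix.cons_val_zero, Matrix.cons_val_one, Matrix.cons_val,
      map_one, map_zero, map_neg]
    linear_combination -hc
  have hxy : φ 0 = x / y := by
    rw [hx, hy, hφ]
    field_simp
  have hwy : φ 2 = y⁻¹ := by rw [hy, hφ, one_div, inv_inv]
  have hy0 : y ≠ 0 := by
    intro h0
    rw [hwy, h0, inv_zero] at hw0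
    exact hw0 rfl
  have htop : adjoin K {x, y} = ⊤ := by
    rw [eq_top_iff, ← h.adjoin_eq_top, adjoin_le_iff]
    have hxm : x ∈ adjoin K {x, y} := subset_adjoin _ _ (by simp)
    have hym : y ∈ adjoin K {x, y} := subset_adjoin _ _ (by simp)
    have hm : ∀ i, φ i ∈ adjoin K {x, y} := by
      intro i
      fin_cases i
      · exact hxy ▸ div_mem hxm hym
      · exact hφ ▸ one_mem _
      · exact hwy ▸ inv_mem hym
    rintro _ ⟨i, j, rfl⟩
    exact div_mem (hm i) (hm j)
  have hSfin : ({x, y} : Set L).Finite := by simp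
  have := finiteDimensional_of_adjoin_eq_top hSfin htop K⟮x⟯
  have := finiteDimensional_of_adjoin_eq_top hSfin htop K⟮y⟯
  have := finiteDimensional_of_adjoin_eq_top hSfin htop K⟮y - x⟯
  have hdvr := fun V hV => ValuationSubring.isDVR_of_isGalois hxtr V hV
  obtain ⟨P, hres, huv, hwv, huniq⟩ := h.exists_place_of_smooth hφ hu0 hf hF₁ hF₂ ⟨d, hfd⟩ hdvr
  obtain ⟨k, hk⟩ := P.exists_valuation_eq_exp hw0
  have hk2 : k ≤ -2 := by rwa [hk, WithZero.exp_le_exp] at hwv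
  obtain ⟨m, rfl⟩ : ∃ m : ℕ, k = -m := ⟨k.natAbs, by lia⟩
  have hyv : P.valuation y = WithZero.exp (m : ℤ) := by
    rw [← inv_inv y, ← hwy, map_inv₀, hk, ← WithZero.exp_neg, neg_neg]
  have hxv : P.valuation x = WithZero.exp ((m - 1 : ℕ) : ℤ) := by
    rw [hx, map_div₀, huv, hk, ← WithZero.exp_sub]
    congr 1
    lia
  obtain ⟨hxR, hyR⟩ := Place.mem_poleRing_of_isGalois (by lia) hxv hyv (by
    rwa [← hxy, ← hwy])
  have hPe : ∀ i, φ i - algebraMap K L ((![0, 1, 0] : Fin 3 → K) i) ∈ P.valuationRing.nonunits := by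
    intro i
    rw [← P.valuation_lt_one_iff]
    fin_cases i
    · simp only [Fin.zero_eta, Matrix.cons_val_zero, map_zero, sub_zero, huv]
      rw [← WithZero.exp_zero, WithZero.exp_lt_exp]
      lia
    · simp [hφ]
    · simp only [Fin.reduceFinMk, Matrix.cons_val, map_zero, sub_zero, hk]
      rw [← WithZero.exp_zero, WithZero.exp_lt_exp]
      lia
  -- A further point `(1 : b : 0)` of the curve on the tangent would carry a pole of `x`, which must
  -- be `P`; but `1 / φ 0` is regular there, while `φ 0` vanishes at `P`.
  have hnoroot : ∀ b : K, eval ![1, b, 0] f ≠ 0 := by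
    intro b hb
    obtain ⟨V, hV, hVe⟩ := (h.smul (inv_ne_zero hu0)).exists_valuationSubring (j := 0)
      (e := ![1, b, 0]) (by simp [hu0]) rfl hb
    have h1 := hVe 1
    have h2 := hVe 2
    simp only [Pi.smul_apply, smul_eq_mul, hφ, mul_one, Matrix.cons_val_one, Matrix.cons_val,
      map_zero, sub_zero, Matrix.cons_val_zero] at h1 h2
    have hxV : x ∉ V := by
      rw [ValuationSubring.mem_nonunits_iff_or, mul_inv, inv_inv, ← div_eq_mul_inv, ← hx] at h2
      exact h2.resolve_left (mul_ne_zero (inv_ne_zero hu0) hw0)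
    have hVP : V = P.valuationRing := by
      by_contra hne
      exact hxV (hxR V hV hne)
    have h3 : (φ 0)⁻¹ ∈ V := by
      rw [← sub_add_cancel (φ 0)⁻¹ (algebraMap K L b)]
      exact V.add_mem _ _ (V.nonunits_le h1) (hV b)
    rw [hVP, ← P.valuation_le_one_iff, map_inv₀, huv, ← WithZero.exp_neg, ← WithZero.exp_zero,
      WithZero.exp_le_exp] at h3
    lia
  have heval : ∀ (a : Fin 3 → Polynomial K) (r : K) (g : MvPolynomial (Fin 3) K),
      Polynomial.eval r (aeval a g) = eval (fun i => Polynomial.eval r (a i)) g := by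
    intro a r g
    have := comp_aeval_apply a (Polynomial.aeval (R := K) r) g
    exact this
  obtain ⟨c, hc0, hc⟩ : ∃ c : K, c ≠ 0 ∧ ∀ b : K, eval ![1, b, 0] f = c := by
    set Q : Polynomial K := aeval ![1, Polynomial.X, 0] f with hQ
    have hQe : ∀ b, Polynomial.eval b Q = eval ![1, b, 0] f := by
      intro b
      rw [hQ, heval]
      congr 2
      funext i
      fin_cases i <;> simp
    have hdeg : Q.degree = 0 := by
      by_contra hdeg
      obtain ⟨b, hb⟩ := IsAlgClosed.exists_root Q hdeg
      exact hnoroot b (by rw [← hQe]; exact hb)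
    rw [Polynomial.eq_C_of_degree_eq_zero hdeg] at hQe
    refine ⟨Q.coeff 0, ?_, fun b => by rw [← hQe, Polynomial.eval_C]⟩
    have := hnoroot 0
    rwa [← hQe, Polynomial.eval_C] at this
  have hQ : (aeval ![Polynomial.X, 1, 0] f : Polynomial K) = Polynomial.C c * Polynomial.X ^ d := by
    -- The factor `X` disposes of `r = 0`; for other `r` homogeneity reduces to the constant value
    -- of `f` on `(1 : b : 0)`.
    refine mul_right_cancel₀ (Polynomial.X_ne_zero) (Polynomial.funext fun r => ?_)
    rw [Polynomial.eval_mul, Polynomial.eval_mul, Polynomial.eval_X]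
    by_cases hr : r = 0
    · rw [hr, mul_zero, mul_zero]
    congr 1
    rw [heval]
    have h1 : (fun i => Polynomial.eval r ((![Polynomial.X, 1, 0] : Fin 3 → Polynomial K) i)) =
        r • ![1, r⁻¹, 0] := by
      funext i
      fin_cases i <;> simp [hr]
    have h2 : eval (r • ![1, r⁻¹, 0]) f = r ^ d * eval ![1, r⁻¹, 0] f :=
      aeval_smul_of_isHomogeneous hfd r ![1, r⁻¹, 0]
    rw [h1, h2, hc, Polynomial.eval_mul, Polynomial.eval_C, Polynomial.eval_pow, Polynomial.eval_X,
      mul_comm]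
  have hQL : φ 0 * aeval ![φ 0, 1, 0] F₁ = algebraMap K L c * φ 0 ^ d := by
    have h1 := congrArg (Polynomial.aeval (φ 0)) hQ
    rw [comp_aeval_apply] at h1
    have h2 : (fun i => Polynomial.aeval (φ 0) ((![Polynomial.X, 1, 0] : Fin 3 → Polynomial K) i)) =
        ![φ 0, 1, 0] := by
      funext i
      fin_cases i <;> simp
    rw [h2, hf] at h1
    simpa using h1
  obtain ⟨H, hH⟩ : ∃ H : MvPolynomial (Fin 3) K,
      aeval φ F₁ = aeval ![φ 0, 1, 0] F₁ + φ 2 * aeval φ H := by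
    have h1 := MvPolynomial.aeval_congr_mod (Ideal.span {(X 2 : MvPolynomial (Fin 3) K)})
      (φ := X) (ψ := ![X 0, X 1, 0]) (by
        intro i
        fin_cases i <;> simp) F₁
    rw [aeval_X_left_apply, Ideal.mem_span_singleton] at h1
    obtain ⟨H, hH⟩ := h1
    refine ⟨H, ?_⟩
    have h2 := congrArg (aeval φ) hH
    rw [map_sub, comp_aeval_apply, map_mul, aeval_X] at h2
    have h3 : (fun i => aeval φ ((![X 0, X 1, 0] : Fin 3 → MvPolynomial (Fin 3) K) i)) =
        ![φ 0, 1, 0] := by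
      funext i
      fin_cases i <;> simp [hφ]
    rw [h3] at h2
    linear_combination h2
  -- The restriction of `f` to the tangent is `c * X ^ d`, so on the curve `φ 2` times a unit is `-c
  -- * φ 0 ^ d`: contact of order `d`.
  have hmd : m = d := by
    have h1 := (h.aeval_eq_zero_iff d f hfd).mpr dvd_rfl
    rw [hf] at h1
    simp only [map_add, map_mul, aeval_X] at h1
    have h2 : φ 2 * aeval φ (F₂ + X 0 * H) = -(algebraMap K L c * φ 0 ^ d) := by
      rw [map_add, map_mul, aeval_X]
      linear_combination h1 - hQL - φ 0 * hH
    have h3 := congrArg P.valuation h2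
    rw [map_mul, P.valuation_aeval_eq_one hPe (by simpa using hF₂), mul_one, Valuation.map_neg,
      map_mul, P.valuation_algebraMap hc0, one_mul, map_pow, huv, hk, ← WithZero.exp_nsmul,
      WithZero.exp_inj] at h3
    simp at h3
    exact h3
  subst hmd
  obtain ⟨s, e, κ, γ, δ, -, hsv, hsgen, hme, hκ, hxs, hys⟩ :=
    Place.exists_normal_form_of_genus_le_one (p := p) hres hd hxR hyR hxv hyv htop hdvr hgenus
  refine ⟨s, e, κ, γ, δ, P.transcendental_of_one_lt ?_, hsgen, hme, hκ, hxs, hys⟩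
  rw [hsv, ← WithZero.exp_zero, WithZero.exp_lt_exp]
  lia

end SmoothGaloisPoint

/-! ### An equation of the Ballico-Hefez curve. -/

section BallicoHefezEquation

open MvPolynomial

variable (K : Type*) [Field K]

/-- The polynomials `H n` in `X, Y, Z` with `H n (a + b, a * b, 1) = a ^ n + b ^ n`. -/
noncomputable def powerSumPoly : ℕ → MvPolynomial (Fin 3) K
  | 0 => C 2
  | 1 => X 0
  | n + 2 => X 0 * powerSumPoly (n + 1) - X 1 * X 2 * powerSumPoly n

/-- An equation of the Ballico-Hefez curve, in coordinates in which it is parametrized by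
`(s ^ q * t + s * t ^ q : t ^ (q + 1) : s ^ (q + 1))`. -/
noncomputable def ballicoHefezPoly (q : ℕ) : MvPolynomial (Fin 3) K :=
  X 1 ^ q * X 2 - powerSumPoly K (q + 1) + X 1 * X 2 ^ q

variable {K}

theorem isHomogeneous_powerSumPoly (n : ℕ) : (powerSumPoly K n).IsHomogeneous n := by
  induction n using powerSumPoly.induct with
  | case1 => exact isHomogeneous_C _ _
  | case2 => exact isHomogeneous_X _ _
  | case3 n ih1 ih2 =>
    rw [powerSumPoly]
    refine IsHomogeneous.sub ?_ ?_
    · have := (isHomogeneous_X K (0 : Fin 3)).mul ih1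
      rwa [show 1 + (n + 1) = n + 2 by ring] at this
    · have := ((isHomogeneous_X K (1 : Fin 3)).mul (isHomogeneous_X K 2)).mul ih2
      rwa [show 1 + 1 + n = n + 2 by ring] at this

theorem isHomogeneous_ballicoHefezPoly (q : ℕ) : (ballicoHefezPoly K q).IsHomogeneous (q + 1) := by
  refine IsHomogeneous.add (IsHomogeneous.sub ?_ (isHomogeneous_powerSumPoly _)) ?_
  · exact (isHomogeneous_X_pow (R := K) 1 q).mul (isHomogeneous_X K 2)
  · have := (isHomogeneous_X K (1 : Fin 3)).mul (isHomogeneous_X_pow (R := K) 2 q)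
    rwa [add_comm 1 q] at this

theorem aeval_powerSumPoly {A : Type*} [CommRing A] [Algebra K A] (a b : A) (n : ℕ) :
    aeval ![a + b, a * b, 1] (powerSumPoly K n) = a ^ n + b ^ n := by
  induction n using powerSumPoly.induct with
  | case1 => rw [powerSumPoly, aeval_C, map_ofNat, pow_zero, pow_zero, one_add_one_eq_two]
  | case2 => simp [powerSumPoly]
  | case3 n ih1 ih2 =>
    rw [powerSumPoly, map_sub, map_mul, map_mul, map_mul, ih1, ih2]
    simp
    ring

/-- In terms of the two roots the equation splits: an affine zero has `b = a ^ q` or `a = b ^ q`,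
which is the parametrization `(t + t ^ q, t ^ (q + 1), 1)`. -/
theorem aeval_ballicoHefezPoly {A : Type*} [CommRing A] [Algebra K A] (a b : A) (q : ℕ) :
    aeval ![a + b, a * b, 1] (ballicoHefezPoly K q) = (a ^ q - b) * (b ^ q - a) := by
  rw [ballicoHefezPoly, map_add, map_sub, aeval_powerSumPoly]
  simp
  ring

theorem eval_powerSumPoly_infinity (x y : K) {n : ℕ} (hn : 1 ≤ n) :
    eval ![x, y, 0] (powerSumPoly K n) = x ^ n := by
  induction n using powerSumPoly.induct with
  | case1 => lia
  | case2 => simp [powerSumPoly]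
  | case3 n ih1 ih2 =>
    rw [powerSumPoly, map_sub, map_mul, map_mul, map_mul, ih1 (by lia)]
    simp
    ring

theorem eval_ballicoHefezPoly_infinity (x y : K) {q : ℕ} (hq : 1 ≤ q) :
    eval ![x, y, 0] (ballicoHefezPoly K q) = -x ^ (q + 1) := by
  rw [ballicoHefezPoly, map_add, map_sub, eval_powerSumPoly_infinity _ _ (by lia)]
  simp [show q ≠ 0 by lia]

/-- This makes `(0 : 1 : 0)` a smooth point. -/
theorem eval_pderiv_ballicoHefezPoly {q : ℕ} (hq : 2 ≤ q) :
    eval ![0, 1, 0] (pderiv 2 (ballicoHefezPoly K q)) = 1 := by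
  have h1 : eval ![0, 1, 0] (pderiv 2 (powerSumPoly K (q + 1))) = 0 := by
    obtain ⟨n, rfl⟩ : ∃ n, q = n + 1 := ⟨q - 1, by lia⟩
    rw [powerSumPoly]
    simp only [map_sub, Derivation.leibniz, pderiv_X, smul_eq_mul, map_add, map_mul, eval_X]
    simp [eval_powerSumPoly_infinity (0 : K) 1 (n := n) (by lia), show n ≠ 0 by lia]
  rw [ballicoHefezPoly, map_add, map_sub, map_add, map_sub, h1]
  simp only [Derivation.leibniz, Derivation.leibniz_pow, pderiv_X, smul_eq_mul, map_add, map_mul,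
    map_pow, eval_X]
  simp [show q - 1 ≠ 0 by lia]

theorem ballicoHefezPoly_ne_zero {q : ℕ} (hq : 2 ≤ q) : ballicoHefezPoly K q ≠ 0 := by
  intro h
  have := eval_pderiv_ballicoHefezPoly (K := K) hq
  rw [h] at this
  simp at this

variable [IsAlgClosed K]

/-- The point with parameter `(s : t)` of the Ballico-Hefez curve in the coordinates of
`ballicoHefezPoly`. -/
def ballicoHefezParam {A : Type*} [CommRing A] (q : ℕ) (s t : A) : Fin 3 → A :=
  ![s ^ q * t + s * t ^ q, t ^ (q + 1), s ^ (q + 1)]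

theorem ballicoHefezParam_smul {A : Type*} [CommRing A] (q : ℕ) (c s t : A) :
    ballicoHefezParam q (c * s) (c * t) = c ^ (q + 1) • ballicoHefezParam q s t := by
  funext i
  fin_cases i <;> simp [ballicoHefezParam] <;> ring

omit [IsAlgClosed K] in
theorem aeval_ballicoHefezParam_one {A : Type*} [CommRing A] [Algebra K A] (q : ℕ) (t : A) :
    aeval (ballicoHefezParam q 1 t) (ballicoHefezPoly K q) = 0 := by
  have := aeval_ballicoHefezPoly (K := K) t (t ^ q) q
  rw [sub_self, zero_mul] at this
  rw [← this]
  congr 2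
  simp [ballicoHefezParam]
  ring

theorem eval_ballicoHefezPoly_eq_zero_iff {q : ℕ} (hq : 1 ≤ q) (v : Fin 3 → K) :
    eval v (ballicoHefezPoly K q) = 0 ↔ ∃ s t : K, v = ballicoHefezParam q s t := by
  have hsmul : ∀ (c : K) (v : Fin 3 → K), eval (c • v) (ballicoHefezPoly K q) =
      c ^ (q + 1) * eval v (ballicoHefezPoly K q) := fun c v =>
    aeval_smul_of_isHomogeneous (isHomogeneous_ballicoHefezPoly q) c v
  have h3 : ∀ v : Fin 3 → K, v = ![v 0, v 1, v 2] := fun v => by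
    funext i
    fin_cases i <;> rfl
  constructor
  · intro h
    by_cases h2 : v 2 = 0
    · rw [h3 v, h2, eval_ballicoHefezPoly_infinity _ _ hq, neg_eq_zero] at h
      have h0 : v 0 = 0 := pow_eq_zero_iff (by lia) |>.mp h
      obtain ⟨t, ht⟩ := IsAlgClosed.exists_pow_nat_eq (v 1) (n := q + 1) (by lia)
      refine ⟨0, t, ?_⟩
      rw [h3 v, h0, h2, ← ht]
      simp [ballicoHefezParam, show q ≠ 0 by lia]
    · obtain ⟨s, hs⟩ := IsAlgClosed.exists_pow_nat_eq (v 2) (n := q + 1) (by lia)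
      have hs0 : s ≠ 0 := by
        rintro rfl
        rw [zero_pow (by lia)] at hs
        exact h2 hs.symm
      obtain ⟨a, ha⟩ := IsAlgClosed.exists_root (Polynomial.C 1 * Polynomial.X ^ 2 +
          Polynomial.C (-(v 0 / v 2)) * Polynomial.X + Polynomial.C (v 1 / v 2))
        (by rw [Polynomial.degree_quadratic one_ne_zero]; decide)
      simp only [Polynomial.IsRoot, Polynomial.eval_add, Polynomial.eval_mul, Polynomial.eval_C,
        Polynomial.eval_pow, Polynomial.eval_X] at ha
      obtain ⟨b, hb⟩ : ∃ b, v 0 / v 2 = a + b := ⟨v 0 / v 2 - a, by ring⟩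
      have hab : v 1 / v 2 = a * b := by rw [hb] at ha; linear_combination ha
      have hv : v = s ^ (q + 1) • ![a + b, a * b, 1] := by
        rw [← hb, ← hab, hs]
        funext i
        fin_cases i <;> simp [mul_div_cancel₀ _ h2]
      have hparam : ∀ c : K, ballicoHefezParam q s (s * c) = s ^ (q + 1) • ![c + c ^ q, c * c ^ q, 1] := by
        intro c
        have := ballicoHefezParam_smul q s 1 c
        rw [mul_one] at this
        rw [this]
        congr 1
        simp [ballicoHefezParam]
        ring
      have h5 : eval ![a + b, a * b, 1] (ballicoHefezPoly K q) = (a ^ q - b) * (b ^ q - a) :=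
        aeval_ballicoHefezPoly a b q
      rw [hv, hsmul, h5, mul_eq_zero, or_iff_right (pow_ne_zero _ (pow_ne_zero _ hs0)), mul_eq_zero] at h
      rcases h with h | h
      · refine ⟨s, s * a, ?_⟩
        rw [hv, hparam, sub_eq_zero.mp h]
      · refine ⟨s, s * b, ?_⟩
        rw [hv, hparam, sub_eq_zero.mp h, add_comm a b, mul_comm a b]
  · rintro ⟨s, t, rfl⟩
    by_cases hs : s = 0
    · have : ballicoHefezParam q s t = ![0, t ^ (q + 1), 0] := by
        simp [ballicoHefezParam, hs, show q ≠ 0 by lia]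
      rw [this, eval_ballicoHefezPoly_infinity _ _ hq]
      simp
    · have h1 := ballicoHefezParam_smul q s 1 (t / s)
      rw [mul_one, mul_div_cancel₀ _ hs] at h1
      have h2 : eval (ballicoHefezParam q 1 (t / s)) (ballicoHefezPoly K q) = 0 :=
        aeval_ballicoHefezParam_one q (t / s)
      rw [h1, hsmul, h2, mul_zero]

/-- A homogeneous polynomial that vanishes at a generic point of the Ballico-Hefez curve vanishes
on the curve. -/
theorem eval_ballicoHefezParam_eq_zero {L : Type*} [Field L] [Algebra K L] {g : MvPolynomial (Fin 3) K}
    {n q : ℕ} (hg : g.IsHomogeneous n) {t : L} (ht : Transcendental K t)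
    (h : aeval (ballicoHefezParam q 1 t) g = 0) (a b : K) :
    eval (ballicoHefezParam q a b) g = 0 := by
  have hsmul : ∀ (c : K) (v : Fin 3 → K), eval (c • v) g = c ^ n * eval v g := fun c v =>
    aeval_smul_of_isHomogeneous hg c v
  have heval : ∀ (a : Fin 3 → Polynomial K) (r : K),
      Polynomial.eval r (aeval a g) = eval (fun i => Polynomial.eval r (a i)) g := by
    intro a r
    exact comp_aeval_apply a (Polynomial.aeval (R := K) r) g
  have h1 : ∀ c : K, eval (ballicoHefezParam q 1 c) g = 0 := by
    intro c
    have h2 : (aeval (ballicoHefezParam q 1 (Polynomial.X : Polynomial K)) g) = 0 := by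
      refine transcendental_iff.mp ht _ ?_
      rw [comp_aeval_apply, ← h]
      congr 2
      funext i
      fin_cases i <;> simp [ballicoHefezParam]
    have h3 := congrArg (Polynomial.eval c) h2
    rw [heval, Polynomial.eval_zero] at h3
    rw [← h3]
    congr 2
    funext i
    fin_cases i <;> simp [ballicoHefezParam]
  have h4 : ∀ a b : K, a ≠ 0 → eval (ballicoHefezParam q a b) g = 0 := by
    intro a b ha
    have h5 := ballicoHefezParam_smul q a 1 (b / a)
    rw [mul_one, mul_div_cancel₀ _ ha] at h5
    rw [h5, hsmul, h1, mul_zero]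
  by_cases ha : a = 0
  -- The parameter `a = 0` is reached from `a ≠ 0` by a polynomial identity in `a`.
  · have h6 : (aeval (ballicoHefezParam q (Polynomial.X : Polynomial K) (Polynomial.C b)) g) = 0 := by
      refine mul_right_cancel₀ Polynomial.X_ne_zero (Polynomial.funext fun r => ?_)
      rw [zero_mul, Polynomial.eval_zero, Polynomial.eval_mul, Polynomial.eval_X]
      by_cases hr : r = 0
      · rw [hr, mul_zero]
      rw [heval]
      have h7 := h4 r b hr
      have h8 : (fun i => Polynomial.eval r (ballicoHefezParam q Polynomial.X (Polynomial.C b) i)) =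
          ballicoHefezParam q r b := by
        funext i
        fin_cases i
        · simp [ballicoHefezParam]
          ring
        all_goals simp [ballicoHefezParam]
      rw [h8, h7, zero_mul]
    have h9 := congrArg (Polynomial.eval a) h6
    rw [heval, Polynomial.eval_zero] at h9
    rw [← h9]
    congr 2
    funext i
    fin_cases i
    · simp [ballicoHefezParam]
      ring
    all_goals simp [ballicoHefezParam]
  · exact h4 a b ha

end BallicoHefezEquation

/-! ### The chain rule for linear changes of coordinates. -/

section LinearPullbackDerivative

open MvPolynomial

variable {K : Type*} [Field K]

theorem pderiv_linearPullback (M : Matrix (Fin 3) (Fin 3) K) (j : Fin 3)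
    (g : MvPolynomial (Fin 3) K) :
    pderiv j (linearPullback M g) = ∑ i, C (M i j) * linearPullback M (pderiv i g) := by
  induction g using MvPolynomial.induction_on with
  | C a => simp [linearPullback]
  | add p q hp hq =>
    simp only [map_add, hp, hq, mul_add, Finset.sum_add_distrib]
  | mul_X p i hp =>
    have h1 : pderiv j (linearPullback M (X i)) = C (M i j) := by
      simp [linearPullback, pderiv_X, Pi.single_apply]
    rw [map_mul, Derivation.leibniz, hp, h1]
    simp only [Derivation.leibniz, map_add, smul_eq_mul, map_mul, mul_add, Finset.sum_add_distrib,
      pderiv_X]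
    congr 1
    · rw [Finset.sum_eq_single i]
      · simp [mul_comm]
      · intro k _ hk
        simp [hk.symm]
      · simp
    · rw [Finset.mul_sum]
      refine Finset.sum_congr rfl fun k _ => ?_
      ring

end LinearPullbackDerivative

/-! ### Finite fields as fixed points of Frobenius. -/

section FiniteFields

open Polynomial

theorem mem_range_algebraMap_iff_pow_card {F K : Type*} [Field F] [Finite F] [Field K] [Algebra F K]
    (a : K) : a ∈ Set.range (algebraMap F K) ↔ a ^ Nat.card F = a := by
  classical
  have := Fintype.ofFinite F
  rw [Nat.card_eq_fintype_card]
  constructor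
  · rintro ⟨b, rfl⟩
    rw [← map_pow, FiniteField.pow_card]
  · intro ha
    have hq : 1 < Fintype.card F := Fintype.one_lt_card
    have hne : (X ^ Fintype.card F - X : K[X]) ≠ 0 := FiniteField.X_pow_card_sub_X_ne_zero K hq
    have hroot : ∀ b : K, b ∈ (X ^ Fintype.card F - X : K[X]).roots.toFinset ↔
        b ^ Fintype.card F = b := by
      intro b
      rw [Multiset.mem_toFinset, mem_roots hne]
      simp [sub_eq_zero]
    have hsub : Finset.univ.image (algebraMap F K) ⊆ (X ^ Fintype.card F - X : K[X]).roots.toFinset := by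
      intro b hb
      obtain ⟨c, -, rfl⟩ := Finset.mem_image.mp hb
      rw [hroot, ← map_pow, FiniteField.pow_card]
    have hcard : (X ^ Fintype.card F - X : K[X]).roots.toFinset.card ≤
        (Finset.univ.image (algebraMap F K)).card := by
      rw [Finset.card_image_of_injective _ (algebraMap F K).injective, Finset.card_univ]
      refine ((Multiset.toFinset_card_le _).trans (card_roots' _)).trans_eq ?_
      exact FiniteField.X_pow_card_sub_X_natDegree_eq K hq
    have := Finset.eq_of_subset_of_card_le hsub hcard
    rw [← hroot, ← this] at ha
    obtain ⟨b, -, hb⟩ := Finset.mem_image.mp ha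
    exact ⟨b, hb⟩

theorem natCard_eq_of_mem_range_iff {F K : Type*} [Field F] [Finite F] [Field K] [Algebra F K]
    [IsAlgClosed K] (p : ℕ) [Fact p.Prime] [CharP K p] {e : ℕ} (he : e ≠ 0)
    (h : ∀ a : K, a ∈ Set.range (algebraMap F K) ↔ a ^ p ^ e = a) : Nat.card F = p ^ e := by
  classical
  have := Fintype.ofFinite F
  have hq : 1 < p ^ e := Nat.one_lt_pow he (Fact.out : p.Prime).one_lt
  have hne : (X ^ p ^ e - X : K[X]) ≠ 0 := FiniteField.X_pow_card_sub_X_ne_zero K hq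
  have hsep : (X ^ p ^ e - X : K[X]).Separable := galois_poly_separable p _ (dvd_pow_self p he)
  have heq : Finset.univ.image (algebraMap F K) = (X ^ p ^ e - X : K[X]).roots.toFinset := by
    ext a
    rw [Multiset.mem_toFinset, mem_roots hne, Finset.mem_image]
    have := h a
    simp only [Set.mem_range] at this
    simp [sub_eq_zero, this]
  rw [Nat.card_eq_fintype_card, ← Finset.card_univ,
    ← Finset.card_image_of_injective _ (algebraMap F K).injective, heq,
    Multiset.toFinset_card_of_nodup (nodup_roots hsep),
    ← (IsAlgClosed.splits (X ^ p ^ e - X : K[X])).natDegree_eq_card_roots,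
    FiniteField.X_pow_card_sub_X_natDegree_eq K hq]

end FiniteFields

/-! ### Galois and rational points in adapted coordinates. -/

section GaloisPointsInCoordinates

open MvPolynomial IntermediateField Matrix

variable {F K : Type*} [Field F] [Field K] [Algebra F K] {d : ℕ} {L : Type*} [Field L] [Algebra K L]

namespace GeomIrredPlaneCurve

variable (C : GeomIrredPlaneCurve F K d) (hd : 2 ≤ d) {φ ψ : Fin 3 → L}
  (h : IsGenericCurvePoint (map (algebraMap F K) C.poly) φ) {M N : Matrix (Fin 3) (Fin 3) K}
  (hNM : N * M = 1) (hψ : φ = (M.map (algebraMap K L)) *ᵥ ψ)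

include hd h hNM hψ in
-- Points transform by `M` and linear forms by its inverse `N`, so pencils can be written in the new
-- coordinates.
theorem isGalois_iff_in_coordinates {v c₁ c₂ : Fin 3 → K} (hv : M *ᵥ v ≠ 0)
    (hli : LinearIndependent K ![c₁, c₂]) (h₁ : c₁ ⬝ᵥ v = 0) (h₂ : c₂ ⬝ᵥ v = 0) :
    Projectivization.mk K (M *ᵥ v) hv ∈ C.galoisPoints ↔
      IsGalois K⟮(∑ i, algebraMap K L (c₁ i) * ψ i) / (∑ i, algebraMap K L (c₂ i) * ψ i)⟯ L := by
  have hdot : ∀ c : Fin 3 → K, c ⬝ᵥ v = 0 → ∑ i, (c ᵥ* N) i * (M *ᵥ v) i = 0 := by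
    intro c hc
    change (c ᵥ* N) ⬝ᵥ (M *ᵥ v) = 0
    rw [← dotProduct_mulVec, mulVec_mulVec, hNM, one_mulVec, hc]
  have hform : ∀ c : Fin 3 → K, ∑ i, algebraMap K L ((c ᵥ* N) i) * φ i =
      ∑ i, algebraMap K L (c i) * ψ i := by
    intro c
    have h1 : (fun i => algebraMap K L ((c ᵥ* N) i)) =
        (fun i => algebraMap K L (c i)) ᵥ* (N.map (algebraMap K L)) := by
      funext i
      exact RingHom.map_vecMul (algebraMap K L) N c i
    change (fun i => algebraMap K L ((c ᵥ* N) i)) ⬝ᵥ φ = (fun i => algebraMap K L (c i)) ⬝ᵥ ψ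
    rw [h1, hψ, ← dotProduct_mulVec, mulVec_mulVec, ← Matrix.map_mul, hNM]
    simp
  rw [← hform, ← hform]
  refine C.isGalois_projectionField_iff hd h hv ?_ (hdot _ h₁) (hdot _ h₂)
  rw [LinearIndependent.pair_iff] at hli ⊢
  intro s t hst
  refine hli s t ?_
  have h1 := congrArg (fun w => w ᵥ* M) hst
  simpa [add_vecMul, smul_vecMul, vecMul_vecMul, hNM] using h1

include hd h hNM hψ in
theorem isGalois_iff_vertical (hv : M *ᵥ ![0, 1, 0] ≠ 0) :
    Projectivization.mk K (M *ᵥ ![0, 1, 0]) hv ∈ C.galoisPoints ↔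
      IsGalois K⟮ψ 0 / ψ 2⟯ L := by
  rw [C.isGalois_iff_in_coordinates hd h hNM hψ hv (c₁ := ![1, 0, 0]) (c₂ := ![0, 0, 1])
    (LinearIndependent.pair_iff.mpr fun s t hst => ⟨by simpa using congrFun hst 0,
      by simpa using congrFun hst 2⟩) (by simp [dotProduct, Fin.sum_univ_three])
      (by simp [dotProduct, Fin.sum_univ_three])]
  exact isGalois_adjoin_congr (by simp [Fin.sum_univ_three])

include hd h hNM hψ in
theorem isGalois_iff_infinity (a : K) (hv : M *ᵥ ![1, a, 0] ≠ 0) :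
    Projectivization.mk K (M *ᵥ ![1, a, 0]) hv ∈ C.galoisPoints ↔
      IsGalois K⟮ψ 1 / ψ 2 - algebraMap K L a * (ψ 0 / ψ 2)⟯ L := by
  rw [C.isGalois_iff_in_coordinates hd h hNM hψ hv (c₁ := ![-a, 1, 0]) (c₂ := ![0, 0, 1])
    (LinearIndependent.pair_iff.mpr fun s t hst => ⟨by simpa using congrFun hst 1,
      by simpa using congrFun hst 2⟩) (by simp [dotProduct, Fin.sum_univ_three])
      (by simp [dotProduct, Fin.sum_univ_three])]
  refine isGalois_adjoin_congr ?_
  simp only [Fin.sum_univ_three, cons_val_zero, cons_val_one, cons_val, map_neg, map_one, map_zero]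
  simp only [zero_mul, one_mul, add_zero, zero_add]
  ring

include hd h hNM hψ in
theorem isGalois_iff_affine (hψ2 : ψ 2 ≠ 0) (s n : K) (hv : M *ᵥ ![s, n, 1] ≠ 0) :
    Projectivization.mk K (M *ᵥ ![s, n, 1]) hv ∈ C.galoisPoints ↔
      IsGalois K⟮(ψ 1 / ψ 2 - algebraMap K L n) / (ψ 0 / ψ 2 - algebraMap K L s)⟯ L := by
  rw [C.isGalois_iff_in_coordinates hd h hNM hψ hv (c₁ := ![0, 1, -n]) (c₂ := ![1, 0, -s])
    (LinearIndependent.pair_iff.mpr fun s t hst => ⟨by simpa using congrFun hst 1,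
      by simpa using congrFun hst 0⟩) (by simp [dotProduct, Fin.sum_univ_three])
      (by simp [dotProduct, Fin.sum_univ_three])]
  refine isGalois_adjoin_congr ?_
  simp only [Fin.sum_univ_three, cons_val_zero, cons_val_one, cons_val, map_neg, map_one, map_zero]
  rw [div_sub' hψ2, div_sub' hψ2, div_div_div_cancel_right₀ hψ2]
  congr 1 <;> ring

end GeomIrredPlaneCurve

theorem mk_mem_rationalPlanePoints_iff {M N : Matrix (Fin 3) (Fin 3) F}
    (hNM : N * M = 1) {v : Fin 3 → K} (hv : M.map (algebraMap F K) *ᵥ v ≠ 0) :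
    Projectivization.mk K (M.map (algebraMap F K) *ᵥ v) hv ∈ rationalPlanePoints F K ↔
      ∃ (w : Fin 3 → F) (a : K), a ≠ 0 ∧ ∀ i, v i = a * algebraMap F K (w i) := by
  have hmap : ∀ (A : Matrix (Fin 3) (Fin 3) F) (w : Fin 3 → F),
      (A.map (algebraMap F K)) *ᵥ (fun i => algebraMap F K (w i)) =
        fun i => algebraMap F K ((A *ᵥ w) i) := fun A w => by
    funext i
    exact (RingHom.map_mulVec (algebraMap F K) A w i).symm
  constructor
  · rintro ⟨w, hw, hmk⟩
    rw [Projectivization.mk_eq_mk_iff] at hmk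
    obtain ⟨a, ha⟩ := hmk
    refine ⟨N *ᵥ w, a, a.ne_zero, fun i => ?_⟩
    have h1 := congrArg (fun u => N.map (algebraMap F K) *ᵥ u) ha
    simp only [mulVec_mulVec, ← Matrix.map_mul, hNM] at h1
    rw [Matrix.map_one _ (map_zero _) (map_one _), one_mulVec, Units.smul_def, mulVec_smul,
      hmap] at h1
    rw [← h1]
    rfl
  · rintro ⟨w, a, ha, hva⟩
    have hv' : v = a • fun i => algebraMap F K (w i) := funext hva
    have h1 : M.map (algebraMap F K) *ᵥ v = a • fun i => algebraMap F K ((M *ᵥ w) i) := by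
      rw [hv', mulVec_smul, hmap]
    refine ⟨M *ᵥ w, ?_, ?_⟩
    · intro h0
      rw [h1, h0, smul_zero] at hv
      exact hv rfl
    · rw [Projectivization.mk_eq_mk_iff]
      exact ⟨Units.mk0 a ha, h1.symm⟩

theorem rational_infinity_iff (a : K) : (∃ (w : Fin 3 → F) (b : K), b ≠ 0 ∧
    ∀ i, (![1, a, 0] : Fin 3 → K) i = b * algebraMap F K (w i)) ↔
      a ∈ Set.range (algebraMap F K) := by
  constructor
  · rintro ⟨w, b, hb, h⟩
    have h0 : 1 = b * algebraMap F K (w 0) := h 0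
    have h1 : a = b * algebraMap F K (w 1) := h 1
    refine ⟨w 1 / w 0, ?_⟩
    rw [map_div₀, h1, div_eq_iff (right_ne_zero_of_mul (h0 ▸ one_ne_zero))]
    linear_combination algebraMap F K (w 1) * h0
  · rintro ⟨b, rfl⟩
    refine ⟨![1, b, 0], 1, one_ne_zero, fun i => ?_⟩
    fin_cases i <;> simp

theorem rational_affine_iff (s n : K) : (∃ (w : Fin 3 → F) (b : K), b ≠ 0 ∧
    ∀ i, (![s, n, 1] : Fin 3 → K) i = b * algebraMap F K (w i)) ↔
      s ∈ Set.range (algebraMap F K) ∧ n ∈ Set.range (algebraMap F K) := by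
  constructor
  · rintro ⟨w, b, hb, h⟩
    have h0 : s = b * algebraMap F K (w 0) := h 0
    have h1 : n = b * algebraMap F K (w 1) := h 1
    have h2 : 1 = b * algebraMap F K (w 2) := h 2
    have hw2 : algebraMap F K (w 2) ≠ 0 := right_ne_zero_of_mul (h2 ▸ one_ne_zero)
    refine ⟨⟨w 0 / w 2, ?_⟩, w 1 / w 2, ?_⟩
    · rw [map_div₀, h0, div_eq_iff hw2]
      linear_combination algebraMap F K (w 0) * h2
    · rw [map_div₀, h1, div_eq_iff hw2]
      linear_combination algebraMap F K (w 1) * h2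
  · rintro ⟨⟨b, rfl⟩, c, rfl⟩
    refine ⟨![b, c, 1], 1, one_ne_zero, fun i => ?_⟩
    fin_cases i <;> simp

theorem rational_vertical : ∃ (w : Fin 3 → F) (b : K), b ≠ 0 ∧
    ∀ i, (![0, 1, 0] : Fin 3 → K) i = b * algebraMap F K (w i) :=
  ⟨![0, 1, 0], 1, one_ne_zero, fun i => by fin_cases i <;> simp⟩

theorem exists_smul_standard {v : Fin 3 → K} (hv : v ≠ 0) : ∃ c : K, c ≠ 0 ∧
    (v = c • ![0, 1, 0] ∨ (∃ a, v = c • ![1, a, 0]) ∨ ∃ s n, v = c • ![s, n, 1]) := by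
  by_cases h2 : v 2 = 0
  · by_cases h0 : v 0 = 0
    · refine ⟨v 1, ?_, Or.inl ?_⟩
      · intro h1
        apply hv
        funext i
        fin_cases i <;> assumption
      · funext i
        fin_cases i <;> simp [h0, h2]
    · refine ⟨v 0, h0, Or.inr (Or.inl ⟨v 1 / v 0, ?_⟩)⟩
      funext i
      fin_cases i <;> simp [h2, mul_div_cancel₀ _ h0]
  · refine ⟨v 2, h2, Or.inr (Or.inr ⟨v 0 / v 2, v 1 / v 2, ?_⟩)⟩
    funext i
    fin_cases i <;> simp [mul_div_cancel₀ _ h2]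

end GaloisPointsInCoordinates

/-! ### From sets of projective points to equations. -/

section PointsOfCurves

open MvPolynomial Matrix

variable {F K : Type*} [Field F] [Field K] [Algebra F K] {d : ℕ}

theorem GeomIrredPlaneCurve.mk_mem_points_iff (C : GeomIrredPlaneCurve F K d) {v : Fin 3 → K}
    (hv : v ≠ 0) : Projectivization.mk K v hv ∈ C.points ↔
      eval v (map (algebraMap F K) C.poly) = 0 := by
  obtain ⟨a, ha⟩ := Projectivization.exists_smul_eq_mk_rep K v hv
  change aeval (Projectivization.mk K v hv).rep C.poly = 0 ↔ _
  rw [← ha, aeval_def, eval₂_eq_eval_map, Units.smul_def]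
  have h1 : eval ((a : K) • v) (map (algebraMap F K) C.poly) =
      (a : K) ^ d * eval v (map (algebraMap F K) C.poly) :=
    aeval_smul_of_isHomogeneous (C.isHomogeneous.map _) (a : K) v
  rw [h1, mul_eq_zero, or_iff_right (pow_ne_zero _ a.ne_zero)]

theorem GeomIrredPlaneCurve.mk_mem_smoothRationalPoints_iff (C : GeomIrredPlaneCurve F K d)
    {v : Fin 3 → F} (hv : v ≠ 0) : Projectivization.mk F v hv ∈ C.smoothRationalPoints ↔
      eval v C.poly = 0 ∧ ∃ i, eval v (pderiv i C.poly) ≠ 0 := by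
  obtain ⟨a, ha⟩ := Projectivization.exists_smul_eq_mk_rep F v hv
  have h1 : ∀ (n : ℕ) (g : MvPolynomial (Fin 3) F), g.IsHomogeneous n →
      eval ((a : F) • v) g = (a : F) ^ n * eval v g :=
    fun n g hg => aeval_smul_of_isHomogeneous hg (a : F) v
  change eval (Projectivization.mk F v hv).rep C.poly = 0 ∧
    (∃ i, eval (Projectivization.mk F v hv).rep (pderiv i C.poly) ≠ 0) ↔ _
  rw [← ha, Units.smul_def, h1 d _ C.isHomogeneous, mul_eq_zero,
    or_iff_right (pow_ne_zero _ a.ne_zero)]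
  simp only [h1 (d - 1) _ C.isHomogeneous.pderiv, ne_eq, mul_eq_zero, not_or,
    pow_ne_zero _ a.ne_zero, not_false_eq_true, true_and]

/-- The change of coordinates from the parametrization `(s ^ (q + 1), (s + t) ^ (q + 1), t ^ (q + 1))`
to `ballicoHefezParam`. -/
def ballicoHefezMatrix (F : Type*) [Field F] : GL (Fin 3) F where
  val := !![-1, 1, -1; 0, 0, 1; 1, 0, 0]
  inv := !![0, 0, 1; 1, 1, 1; 0, 1, 0]
  val_inv := by
    ext i j
    fin_cases i <;> fin_cases j <;> simp [Matrix.mul_apply, Fin.sum_univ_three]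
  inv_val := by
    ext i j
    fin_cases i <;> fin_cases j <;> simp [Matrix.mul_apply, Fin.sum_univ_three]

theorem ballicoHefezMatrix_mulVec (p f : ℕ) [Fact p.Prime] [CharP K p] (s t : K) :
    ((ballicoHefezMatrix F).1.map (algebraMap F K)) *ᵥ
      ![s ^ (p ^ f + 1), (s + t) ^ (p ^ f + 1), t ^ (p ^ f + 1)] = ballicoHefezParam (p ^ f) s t := by
  have h1 : (s + t) ^ (p ^ f + 1) = (s ^ p ^ f + t ^ p ^ f) * (s + t) := by
    rw [pow_succ, add_pow_char_pow]
  funext i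
  fin_cases i <;> simp [ballicoHefezMatrix, ballicoHefezParam, Matrix.mulVec, dotProduct,
    Fin.sum_univ_three, h1]
  ring

theorem mk_mem_ballicoHefezPoints_iff [IsAlgClosed K] (p f : ℕ) [Fact p.Prime] [CharP K p]
    {v : Fin 3 → K} (hv : v ≠ 0) :
    Projectivization.mk K v hv ∈ ballicoHefezPoints K (p ^ f) ↔
      eval (((ballicoHefezMatrix F).1.map (algebraMap F K)) *ᵥ v) (ballicoHefezPoly K (p ^ f)) = 0 := by
  have hq : 1 ≤ p ^ f := Nat.one_le_pow _ _ (Fact.out : p.Prime).pos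
  rw [eval_ballicoHefezPoly_eq_zero_iff hq]
  constructor
  · rintro ⟨s, t, h0, hmk⟩
    rw [Projectivization.mk_eq_mk_iff] at hmk
    obtain ⟨a, ha⟩ := hmk
    -- The parametrization has degree `q + 1`, so a scalar is absorbed into the parameters by a `(q
    -- + 1)`-st root.
    obtain ⟨b, hb⟩ := IsAlgClosed.exists_pow_nat_eq (a : K) (n := p ^ f + 1) (by lia)
    refine ⟨b * s, b * t, ?_⟩
    rw [← ha, Units.smul_def, mulVec_smul, ballicoHefezMatrix_mulVec, ballicoHefezParam_smul, hb]
  · rintro ⟨s, t, hst⟩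
    rw [← ballicoHefezMatrix_mulVec (F := F)] at hst
    have hinj : v = ![s ^ (p ^ f + 1), (s + t) ^ (p ^ f + 1), t ^ (p ^ f + 1)] := by
      have h1 := congrArg (fun u => ((ballicoHefezMatrix F)⁻¹.1.map (algebraMap F K)) *ᵥ u) hst
      simpa [mulVec_mulVec, ← Matrix.map_mul, ← Units.val_mul] using h1
    exact ⟨s, t, hinj ▸ hv, by congr 1⟩

theorem projectivelyEquivalentOver_ballicoHefez_iff [IsAlgClosed K] (p f : ℕ) [Fact p.Prime]
    [CharP K p] (hd : 1 ≤ d) (C : GeomIrredPlaneCurve F K d) :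
    ProjectivelyEquivalentOver F C.points (ballicoHefezPoints K (p ^ f)) ↔
      ∃ B : GL (Fin 3) F, ∀ v : Fin 3 → K, eval v (map (algebraMap F K) C.poly) = 0 ↔
        eval ((B.1.map (algebraMap F K)) *ᵥ v) (ballicoHefezPoly K (p ^ f)) = 0 := by
  have himage : ∀ A : GL (Fin 3) F, ((fun P : ℙ K (Fin 3 → K) =>
      Matrix.GeneralLinearGroup.toLin (A.map (algebraMap F K)) • P) '' C.points =
        ballicoHefezPoints K (p ^ f)) ↔ ∀ P : ℙ K (Fin 3 → K), P ∈ C.points ↔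
      Matrix.GeneralLinearGroup.toLin (A.map (algebraMap F K)) • P ∈
        ballicoHefezPoints K (p ^ f) := by
    intro A
    constructor
    · intro h P
      rw [← h]
      exact ((MulAction.injective _).mem_set_image).symm
    · intro h
      ext Q
      constructor
      · rintro ⟨P, hP, rfl⟩
        exact (h P).mp hP
      · intro hQ
        obtain ⟨P, rfl⟩ := MulAction.surjective
          (Matrix.GeneralLinearGroup.toLin (A.map (algebraMap F K))) Q
        exact ⟨P, (h P).mpr hQ, rfl⟩
  have hpoint : ∀ A : GL (Fin 3) F, (∀ P : ℙ K (Fin 3 → K), P ∈ C.points ↔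
      Matrix.GeneralLinearGroup.toLin (A.map (algebraMap F K)) • P ∈
        ballicoHefezPoints K (p ^ f)) ↔
      ∀ v : Fin 3 → K, eval v (map (algebraMap F K) C.poly) = 0 ↔
        eval (((ballicoHefezMatrix F * A).1.map (algebraMap F K)) *ᵥ v)
          (ballicoHefezPoly K (p ^ f)) = 0 := by
    intro A
    have key : ∀ (v : Fin 3 → K) (hv : v ≠ 0),
        (Matrix.GeneralLinearGroup.toLin (A.map (algebraMap F K)) • Projectivization.mk K v hv ∈
          ballicoHefezPoints K (p ^ f)) ↔
        eval (((ballicoHefezMatrix F * A).1.map (algebraMap F K)) *ᵥ v)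
          (ballicoHefezPoly K (p ^ f)) = 0 := by
      intro v hv
      rw [Projectivization.smul_mk, mk_mem_ballicoHefezPoints_iff (F := F), Units.val_mul,
        Matrix.map_mul, ← mulVec_mulVec]
      rfl
    constructor
    · intro h v
      -- The zero vector is no projective point, but both forms have positive degree and vanish
      -- there.
      by_cases hv : v = 0
      · have hz : ∀ (n : ℕ) (g : MvPolynomial (Fin 3) K), n ≠ 0 → g.IsHomogeneous n →
            eval 0 g = 0 := by
          intro n g hn hg
          have h1 : eval ((0 : K) • (0 : Fin 3 → K)) g = 0 ^ n * eval 0 g :=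
            aeval_smul_of_isHomogeneous hg (0 : K) 0
          rwa [zero_smul, zero_pow hn, zero_mul] at h1
        rw [hv, mulVec_zero, hz d _ (by lia) (C.isHomogeneous.map _),
          hz _ _ (Nat.succ_ne_zero _) (isHomogeneous_ballicoHefezPoly _)]
      · rw [← C.mk_mem_points_iff hv, h, key v hv]
    · intro h P
      rw [← P.mk_rep, C.mk_mem_points_iff, h, key]
  constructor
  · rintro ⟨A, hA⟩
    exact ⟨ballicoHefezMatrix F * A, (hpoint A).mp ((himage A).mp hA)⟩
  · rintro ⟨B, hB⟩
    refine ⟨(ballicoHefezMatrix F)⁻¹ * B, (himage _).mpr ((hpoint _).mpr ?_)⟩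
    rwa [mul_inv_cancel_left]

end PointsOfCurves

/-! ### Coordinates adapted to the tangent at a smooth point. -/

section TangentCoordinates

open MvPolynomial Matrix

theorem exists_matrix_tangent {F : Type*} [Field F] {P g : Fin 3 → F} (hP : P ≠ 0) (hg : g ≠ 0)
    (hgP : g ⬝ᵥ P = 0) : ∃ M N : Matrix (Fin 3) (Fin 3) F, M * N = 1 ∧ N * M = 1 ∧
      M *ᵥ ![0, 1, 0] = P ∧ (g ᵥ* M) 0 = 0 ∧ (g ᵥ* M) 2 ≠ 0 := by
  obtain ⟨b, hb⟩ : ∃ b : Fin 3 → F, g ⬝ᵥ b ≠ 0 := by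
    obtain ⟨i, hi⟩ := Function.ne_iff.mp hg
    exact ⟨Pi.single i 1, by simpa using hi⟩
  obtain ⟨c, hc⟩ : ∃ c : Fin 3 → F, c ⬝ᵥ P ≠ 0 := by
    obtain ⟨i, hi⟩ := Function.ne_iff.mp hP
    exact ⟨Pi.single i 1, by simpa using hi⟩
  simp only [dotProduct, Fin.sum_univ_three] at hgP hb hc
  -- The columns are the cross product of `g` and `c`, which lies on the tangent `g = 0`, then `P`,
  -- then a vector `b` off the tangent; the determinant is `-(g·b)(c·P)`.
  set M : Matrix (Fin 3) (Fin 3) F := !![g 1 * c 2 - g 2 * c 1, P 0, b 0;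
    g 2 * c 0 - g 0 * c 2, P 1, b 1; g 0 * c 1 - g 1 * c 0, P 2, b 2] with hM
  have hdet : M.det = -((g 0 * b 0 + g 1 * b 1 + g 2 * b 2) * (c 0 * P 0 + c 1 * P 1 + c 2 * P 2)) := by
    rw [hM, det_fin_three]
    simp
    linear_combination (c 0 * b 0 + c 1 * b 1 + c 2 * b 2) * hgP
  have hunit : IsUnit M.det := by
    rw [isUnit_iff_ne_zero, hdet]
    exact neg_ne_zero.mpr (mul_ne_zero hb hc)
  refine ⟨M, M⁻¹, mul_nonsing_inv M hunit, nonsing_inv_mul M hunit, ?_, ?_, ?_⟩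
  · funext i
    fin_cases i <;> simp [hM, mulVec, dotProduct, Fin.sum_univ_three]
  · simp [hM, vecMul, dotProduct, Fin.sum_univ_three]
    ring
  · simpa [hM, vecMul, dotProduct, Fin.sum_univ_three] using hb

variable {K : Type*} [Field K]

theorem MvPolynomial.eval_linearPullback (M : Matrix (Fin 3) (Fin 3) K) (v : Fin 3 → K)
    (g : MvPolynomial (Fin 3) K) : eval v (linearPullback M g) = eval (M *ᵥ v) g := by
  have := aeval_linearPullback M v g
  rwa [Algebra.algebraMap_self, show M.map (RingHom.id K) = M from rfl] at this

/-- Modulo `X 0` and `X 2` a form is its value at `(0, 1, 0)` times a power of `X 1`, hence zero. -/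
theorem MvPolynomial.exists_eq_X_mul_add_X_mul {f : MvPolynomial (Fin 3) K} {d : ℕ}
    (hf : f.IsHomogeneous d) (h : eval ![0, 1, 0] f = 0) : ∃ F₁ F₂ : MvPolynomial (Fin 3) K,
      f = X 0 * F₁ + X 2 * F₂ ∧ eval ![0, 1, 0] F₁ = eval ![0, 1, 0] (pderiv 0 f) ∧
        eval ![0, 1, 0] F₂ = eval ![0, 1, 0] (pderiv 2 f) := by
  let e : Fin 3 → MvPolynomial (Fin 3) K := fun i => C ((![0, 1, 0] : Fin 3 → K) i)
  have h1 : aeval ((X 1 : MvPolynomial (Fin 3) K) • e) f = 0 := by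
    have h2 : aeval e f = algebraMap K (MvPolynomial (Fin 3) K) (aeval ![0, 1, 0] f) :=
      aeval_algebraMap_apply _ ![0, 1, 0] f
    have h3 : aeval (![0, 1, 0] : Fin 3 → K) f = 0 := h
    rw [aeval_smul_of_isHomogeneous hf, h2, h3, map_zero, mul_zero]
  have h2 := aeval_congr_mod (Ideal.span {X 0, X 2}) (φ := X)
    (ψ := (X 1 : MvPolynomial (Fin 3) K) • e) (fun i => ?_) f
  · rw [h1, sub_zero, aeval_X_left_apply, Ideal.mem_span_pair] at h2
    obtain ⟨a, b, hab⟩ := h2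
    refine ⟨a, b, by rw [← hab]; ring, ?_, ?_⟩ <;>
    · rw [← hab]
      simp [Derivation.leibniz, pderiv_X]
  · fin_cases i
    · simpa [e] using Ideal.subset_span (by simp)
    · simp [e]
    · simpa [e] using Ideal.subset_span (by simp)

variable {F : Type*} [Field F] [Algebra F K] {d : ℕ}

theorem eval_algebraMap_map (v : Fin 3 → F) (g : MvPolynomial (Fin 3) F) :
    eval (fun i => algebraMap F K (v i)) (map (algebraMap F K) g) = algebraMap F K (eval v g) := by
  rw [eval_map]
  exact aeval_algebraMap_apply K v g

theorem GeomIrredPlaneCurve.exists_tangent_coordinates (C : GeomIrredPlaneCurve F K d)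
    (h : C.smoothRationalPoints.Nonempty) : ∃ M N : Matrix (Fin 3) (Fin 3) F,
      M * N = 1 ∧ N * M = 1 ∧ ∃ F₁ F₂ : MvPolynomial (Fin 3) K,
      linearPullback (M.map (algebraMap F K)) (map (algebraMap F K) C.poly) = X 0 * F₁ + X 2 * F₂ ∧
        eval ![0, 1, 0] F₁ = 0 ∧ eval ![0, 1, 0] F₂ ≠ 0 := by
  obtain ⟨P, hP⟩ := h
  rw [← P.mk_rep, C.mk_mem_smoothRationalPoints_iff] at hP
  obtain ⟨h0, j, hj⟩ := hP
  obtain ⟨M, N, hMN, hNM, hMe, hM0, hM2⟩ := exists_matrix_tangent P.rep_nonzero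
    (g := fun i => eval P.rep (pderiv i C.poly)) (fun h => hj (congrFun h j)) (by
      -- Euler's formula puts the point on its tangent line.
      have h1 := congrArg (eval P.rep) C.isHomogeneous.sum_X_mul_pderiv
      simp only [map_sum, map_mul, eval_X, map_nsmul, h0, smul_zero] at h1
      rw [← h1]
      exact Finset.sum_congr rfl fun i _ => mul_comm _ _)
  have hMe' : (M.map (algebraMap F K)) *ᵥ ![0, 1, 0] = fun i => algebraMap F K (P.rep i) := by
    rw [← hMe]
    funext i
    rw [RingHom.map_mulVec]
    congr 2
    funext j
    fin_cases j <;> simp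
  have hpd : ∀ j, eval ![0, 1, 0] (pderiv j (linearPullback (M.map (algebraMap F K))
      (map (algebraMap F K) C.poly))) = algebraMap F K
        (((fun i => eval P.rep (pderiv i C.poly)) ᵥ* M) j) := by
    intro j
    rw [pderiv_linearPullback, map_sum]
    simp only [vecMul, dotProduct, map_sum, map_mul, eval_C, eval_linearPullback, hMe', pderiv_map,
      eval_algebraMap_map, Matrix.map_apply]
    exact Finset.sum_congr rfl fun i _ => mul_comm _ _
  obtain ⟨F₁, F₂, hf, hF₁, hF₂⟩ := exists_eq_X_mul_add_X_mul (isHomogeneous_linearPullback (M.map (algebraMap F K))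
    (C.isHomogeneous.map (algebraMap F K))) (by
      rw [eval_linearPullback, hMe', eval_algebraMap_map, h0, map_zero])
  refine ⟨M, N, hMN, hNM, F₁, F₂, hf, ?_, ?_⟩
  · rw [hF₁, hpd, hM0, map_zero]
  · rw [hF₂, hpd, _root_.map_ne_zero]
    exact hM2

end TangentCoordinates

/-! ### From Galois points to the Ballico-Hefez curve. -/

section FromGaloisPoints

open MvPolynomial IntermediateField Matrix

variable {F K : Type*} [Field F] [Field K] [Algebra F K] {d : ℕ} {L : Type*} [Field L] [Algebra K L]

theorem mulVec_ne_zero_of_mul_eq_one {M N : Matrix (Fin 3) (Fin 3) K} (hNM : N * M = 1)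
    {v : Fin 3 → K} (hv : v ≠ 0) : M *ᵥ v ≠ 0 := by
  intro h
  apply hv
  rw [← one_mulVec v, ← hNM, ← mulVec_mulVec, h, mulVec_zero]

theorem IsGenericCurvePoint.exists_coordinates {f : MvPolynomial (Fin 3) K} {φ : Fin 3 → L}
    (hφ : IsGenericCurvePoint f φ) (hf : f.IsHomogeneous d) (hd : 2 ≤ d)
    {M N : Matrix (Fin 3) (Fin 3) K} (hMN : M * N = 1) (hNM : N * M = 1) :
    ∃ φ ψ : Fin 3 → L, IsGenericCurvePoint f φ ∧
      IsGenericCurvePoint (linearPullback M f) ψ ∧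
      φ = (M.map (algebraMap K L)) *ᵥ ψ ∧ ψ 1 = 1 ∧ ψ 2 ≠ 0 := by
  have hcoord : φ = (M.map (algebraMap K L)) *ᵥ
      ((N.map (algebraMap K L)) *ᵥ φ) := by
    rw [mulVec_mulVec, ← Matrix.map_mul, hMN, Matrix.map_one _ (map_zero _) (map_one _), one_mulVec]
  set ψ := (N.map (algebraMap K L)) *ᵥ φ with hψdef
  have hψ := hφ.linear_change hMN hNM hcoord
  have hhom := isHomogeneous_linearPullback M hf
  have h1 : ψ 1 ≠ 0 := by
    have := hψ.linear_ne_zero hhom hd (c := ![0, 1, 0]) (fun h => by simpa using congrFun h 1)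
    simpa [Fin.sum_univ_three] using this
  have h2 : ψ 2 ≠ 0 := by
    have := hψ.linear_ne_zero hhom hd (c := ![0, 0, 1]) (fun h => by simpa using congrFun h 2)
    simpa [Fin.sum_univ_three] using this
  refine ⟨(ψ 1)⁻¹ • φ, (ψ 1)⁻¹ • ψ, hφ.smul (inv_ne_zero h1), hψ.smul (inv_ne_zero h1), ?_, ?_, ?_⟩
  · rw [mulVec_smul, ← hcoord]
  · simp [h1]
  · simp [h1, h2]

theorem isGalois_infinity_model_iff [IsAlgClosed K] (p e : ℕ) [Fact p.Prime] [CharP K p]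
    (he : e ≠ 0) {s : L} (hs : Transcendental K s) (htop : K⟮s⟯ = ⊤) {κ γ δ : K} (hκ : κ ≠ 0) {x y : L}
    (hx : x = algebraMap K L κ * (s ^ p ^ e + s) + algebraMap K L γ)
    (hy : y = algebraMap K L κ * s ^ (p ^ e + 1) + algebraMap K L δ) (a : K) :
    IsGalois K⟮y - algebraMap K L a * x⟯ L ↔ a ^ p ^ e = a := by
  have h1 : y - algebraMap K L a * x = algebraMap K L κ *
      (s ^ (p ^ e + 1) - algebraMap K L a * (s ^ p ^ e + s)) + algebraMap K L (δ - a * γ) := by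
    rw [hx, hy, map_sub, map_mul]
    ring
  rw [h1, adjoin_affine hκ]
  refine ⟨fun h => ?_, fun h => isGalois_outer_line p e he hs htop h⟩
  by_contra ha
  exact not_isGalois_outer_line p e he hs htop ha h

/-- For `S = 0` and `S = 1` this yields two Galois points whose rationality makes `γ`, `δ` and `κ`
rational. -/
theorem isGalois_affine_model [IsAlgClosed K] (p e : ℕ) [Fact p.Prime] [CharP K p]
    (he : e ≠ 0) {s : L} (hs : Transcendental K s) (htop : K⟮s⟯ = ⊤) {κ γ δ : K} (hκ : κ ≠ 0) {x y : L}
    (hx : x = algebraMap K L κ * (s ^ p ^ e + s) + algebraMap K L γ)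
    (hy : y = algebraMap K L κ * s ^ (p ^ e + 1) + algebraMap K L δ) {S : K} (hS : S ^ p ^ e = S) :
    IsGalois K⟮(y - algebraMap K L δ) / (x - algebraMap K L (κ * S + γ))⟯ L := by
  have h1 : (y - algebraMap K L δ) / (x - algebraMap K L (κ * S + γ)) =
      (s ^ (p ^ e + 1) - algebraMap K L 0) / (s ^ p ^ e + s - algebraMap K L S) := by
    rw [← mul_div_mul_left (s ^ (p ^ e + 1) - _) _ ((_root_.map_ne_zero (algebraMap K L)).mpr hκ),
      hx, hy, map_zero, map_add, map_mul]
    congr 1 <;> ring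
  rw [h1]
  exact isGalois_affine_point p e he hs htop hS (zero_pow (pow_ne_zero _ (Fact.out : p.Prime).ne_zero))

theorem IsGenericCurvePoint.eval_eq_zero_iff_ballicoHefezPoly [IsAlgClosed K] {q : ℕ} (hq : 1 ≤ q)
    {g : MvPolynomial (Fin 3) K} (hg : g.IsHomogeneous d) {s : L} (hs : Transcendental K s)
    (h : IsGenericCurvePoint g (ballicoHefezParam q 1 s)) (v : Fin 3 → K) :
    MvPolynomial.eval v g = 0 ↔ MvPolynomial.eval v (ballicoHefezPoly K q) = 0 := by
  constructor
  · intro hv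
    obtain ⟨k, hk⟩ := (h.aeval_eq_zero_iff _ _ (isHomogeneous_ballicoHefezPoly q)).mp
      (aeval_ballicoHefezParam_one q s)
    rw [hk, map_mul, hv, zero_mul]
  · intro hv
    obtain ⟨a, b, rfl⟩ := (eval_ballicoHefezPoly_eq_zero_iff hq v).mp hv
    exact eval_ballicoHefezParam_eq_zero hg hs
      ((h.aeval_eq_zero_iff _ _ hg).mpr dvd_rfl) a b

/-- The affine change of coordinates `(x, y) ↦ (κ * x + γ, κ * y + δ)`. -/
def homothetyMatrix {F : Type*} [Field F] (κ γ δ : F) (hκ : κ ≠ 0) : GL (Fin 3) F where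
  val := !![κ, 0, γ; 0, κ, δ; 0, 0, 1]
  inv := !![κ⁻¹, 0, -(κ⁻¹ * γ); 0, κ⁻¹, -(κ⁻¹ * δ); 0, 0, 1]
  val_inv := by
    ext i j
    fin_cases i <;> fin_cases j <;> simp [Matrix.mul_apply, Fin.sum_univ_three, hκ]
  inv_val := by
    ext i j
    fin_cases i <;> fin_cases j <;> simp [Matrix.mul_apply, Fin.sum_univ_three, hκ]

theorem homothetyMatrix_mulVec [Algebra F L] (q : ℕ) (κ γ δ : F) (hκ : κ ≠ 0) (s : L) :
    ((homothetyMatrix κ γ δ hκ).1.map (algebraMap F L)) *ᵥ ballicoHefezParam q 1 s =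
      ![algebraMap F L κ * (s ^ q + s) + algebraMap F L γ,
        algebraMap F L κ * s ^ (q + 1) + algebraMap F L δ, 1] := by
  funext i
  fin_cases i <;> simp [homothetyMatrix, ballicoHefezParam, mulVec, dotProduct, Fin.sum_univ_three]
  exact Or.inl (add_comm _ _)

theorem GeomIrredPlaneCurve.exists_ballicoHefez_coordinates [Finite F] [IsAlgClosed K] (p : ℕ)
    [Fact p.Prime] [CharP K p] (hd : 4 ≤ d) (C : GeomIrredPlaneCurve F K d)
    {φ₀ : Fin 3 → L} (hφ₀ : IsGenericCurvePoint (map (algebraMap F K) C.poly) φ₀)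
    (hgenus : functionFieldGenus K L ≤ 1) (hsm : C.smoothRationalPoints.Nonempty)
    (hΔ : C.galoisPoints = rationalPlanePoints F K) :
    ∃ B : GL (Fin 3) F, ∀ v : Fin 3 → K, eval v (map (algebraMap F K) C.poly) = 0 ↔
      eval ((B.1.map (algebraMap F K)) *ᵥ v) (ballicoHefezPoly K (Nat.card F)) = 0 := by
  obtain ⟨M, N, hMN, hNM, F₁, F₂, hf, hF₁, hF₂⟩ := C.exists_tangent_coordinates hsm
  have hMNK : M.map (algebraMap F K) * N.map (algebraMap F K) = 1 := by
    rw [← Matrix.map_mul, hMN, Matrix.map_one _ (map_zero _) (map_one _)]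
  have hNMK : N.map (algebraMap F K) * M.map (algebraMap F K) = 1 := by
    rw [← Matrix.map_mul, hNM, Matrix.map_one _ (map_zero _) (map_one _)]
  obtain ⟨φ, ψ, hφ, hψ, hφψ, hψ1, hψ2⟩ :=
    hφ₀.exists_coordinates (C.isHomogeneous.map _) (by lia) hMNK hNMK
  have hhom := isHomogeneous_linearPullback (M.map (algebraMap F K))
    (C.isHomogeneous.map (algebraMap F K))
  have hne : ∀ {v : Fin 3 → K}, v ≠ 0 → M.map (algebraMap F K) *ᵥ v ≠ 0 :=
    fun hv => mulVec_ne_zero_of_mul_eq_one hNMK hv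
  have hv1 : (![0, 1, 0] : Fin 3 → K) ≠ 0 := fun h => by simpa using congrFun h 1
  have hv2 : ∀ a : K, ![1, a, 0] ≠ 0 := fun a h => by simpa using congrFun h 0
  have hv3 : ∀ a b : K, ![a, b, 1] ≠ 0 := fun a b h => by simpa using congrFun h 2
  have hvert : IsGalois K⟮ψ 0 / ψ 2⟯ L := by
    rw [← C.isGalois_iff_vertical (by lia) hφ hNMK hφψ (hne hv1), hΔ,
      mk_mem_rationalPlanePoints_iff hNM]
    exact rational_vertical
  have hinf : ∀ a : K, IsGalois K⟮ψ 1 / ψ 2 - algebraMap K L a * (ψ 0 / ψ 2)⟯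
      L ↔ a ∈ Set.range (algebraMap F K) := by
    intro a
    rw [← C.isGalois_iff_infinity (by lia) hφ hNMK hφψ a (hne (hv2 a)), hΔ,
      mk_mem_rationalPlanePoints_iff hNM, rational_infinity_iff]
  have haff : ∀ a b : K, IsGalois K⟮(ψ 1 / ψ 2 - algebraMap K L b) /
      (ψ 0 / ψ 2 - algebraMap K L a)⟯ L ↔
        a ∈ Set.range (algebraMap F K) ∧ b ∈ Set.range (algebraMap F K) := by
    intro a b
    rw [← C.isGalois_iff_affine (by lia) hφ hNMK hφψ hψ2 a b (hne (hv3 a b)), hΔ,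
      mk_mem_rationalPlanePoints_iff hNM, rational_affine_iff]
  have hg0 : IsGalois K⟮ψ 1 / ψ 2⟯ L :=
    (isGalois_adjoin_congr (by simp)).mp ((hinf 0).mpr ⟨0, map_zero _⟩)
  have hg1 : IsGalois K⟮ψ 1 / ψ 2 - ψ 0 / ψ 2⟯ L :=
    (isGalois_adjoin_congr (by simp)).mp ((hinf 1).mpr ⟨1, map_one _⟩)
  obtain ⟨s, e, κ, γ, δ, hs, htop, hde, hκ, hx, hy⟩ :=
    hψ.normal_form hψ1 hd hhom hf hF₁ hF₂ rfl rfl hgenus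
  have he : e ≠ 0 := by
    rintro rfl
    rw [pow_zero] at hde
    lia
  -- The point `(1 : a : 0)` is Galois exactly for `a` in `F`, by hypothesis, and exactly for `a ^ p
  -- ^ e = a`, by the normal form.
  have hcard : Nat.card F = p ^ e := natCard_eq_of_mem_range_iff p he fun a => by
    rw [← hinf, isGalois_infinity_model_iff p e he hs htop hκ hx hy]
  have hpe : p ^ e ≠ 0 := pow_ne_zero _ (Fact.out : p.Prime).ne_zero
  obtain ⟨⟨γ', hγ⟩, δ', hδ⟩ := (haff _ _).mp
    (isGalois_affine_model p e he hs htop hκ hx hy (zero_pow hpe))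
  obtain ⟨⟨κ', hκ'⟩, -⟩ := (haff _ _).mp
    (isGalois_affine_model p e he hs htop hκ hx hy (one_pow _))
  rw [mul_zero, zero_add] at hγ
  rw [mul_one, ← hγ] at hκ'
  replace hκ' : algebraMap F K (κ' - γ') = κ := by rw [map_sub, hκ']; ring
  have hκ0 : κ' - γ' ≠ 0 := by
    intro h
    rw [h, map_zero] at hκ'
    exact hκ hκ'.symm
  set A := homothetyMatrix (κ' - γ') γ' δ' hκ0 with hA
  have hAψ : (ψ 2)⁻¹ • ψ = ((A.1.map (algebraMap F K)).map (algebraMap K L)) *ᵥ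
      ballicoHefezParam (p ^ e) 1 s := by
    let _ : Algebra F L := ((algebraMap K L).comp (algebraMap F K)).toAlgebra
    have h1 := homothetyMatrix_mulVec (p ^ e) (κ' - γ') γ' δ' hκ0 s
    have h2 : (A.1.map (algebraMap F K)).map (algebraMap K L) =
      A.1.map (algebraMap F L) := rfl
    have h3 : ∀ a : F, algebraMap F L a =
      algebraMap K L (algebraMap F K a) := fun a => rfl
    rw [h2, hA, h1, h3, h3, h3, hκ', hγ, hδ, ← hx, ← hy]
    funext i
    fin_cases i <;> simp [div_eq_inv_mul, hψ2]
  have hAA : A.1.map (algebraMap F K) * A⁻¹.1.map (algebraMap F K) = 1 := by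
    rw [← Matrix.map_mul, ← Units.val_mul, mul_inv_cancel]
    exact Matrix.map_one _ (map_zero _) (map_one _)
  have hAA' : A⁻¹.1.map (algebraMap F K) * A.1.map (algebraMap F K) = 1 := by
    rw [← Matrix.map_mul, ← Units.val_mul, inv_mul_cancel]
    exact Matrix.map_one _ (map_zero _) (map_one _)
  have hgen := (hψ.smul (inv_ne_zero hψ2)).linear_change hAA hAA' hAψ
  have hzero := hgen.eval_eq_zero_iff_ballicoHefezPoly (Nat.one_le_iff_ne_zero.mpr hpe)
    (isHomogeneous_linearPullback _ hhom) hs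
  refine ⟨A⁻¹ * ⟨N, M, hNM, hMN⟩, fun v => ?_⟩
  rw [hcard, ← hzero, eval_linearPullback, eval_linearPullback, Units.val_mul, Matrix.map_mul,
    ← mulVec_mulVec, mulVec_mulVec _ (A.1.map _), hAA, one_mulVec, mulVec_mulVec, hMNK, one_mulVec]

end FromGaloisPoints

/-! ### From the Ballico-Hefez curve to its Galois points. -/

section FromBallicoHefez

open MvPolynomial IntermediateField Matrix

variable {K : Type*} [Field K] {d : ℕ}

theorem MvPolynomial.dvd_of_zeros_subset [IsAlgClosed K] {σ : Type*} [Finite σ] {f g : MvPolynomial σ K}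
    (hf : Irreducible f) (h : ∀ v, eval v f = 0 → eval v g = 0) : f ∣ g := by
  have h1 : g ∈ vanishingIdeal K (zeroLocus K (Ideal.span {f})) := by
    intro v hv
    exact h v (hv f (Ideal.mem_span_singleton_self f))
  rw [vanishingIdeal_zeroLocus_eq_radical] at h1
  obtain ⟨n, hn⟩ := h1
  exact hf.prime.dvd_of_dvd_pow (Ideal.mem_span_singleton.mp hn)

theorem MvPolynomial.irreducible_linearPullback {M N : Matrix (Fin 3) (Fin 3) K} (hMN : M * N = 1)
    (hNM : N * M = 1) {f : MvPolynomial (Fin 3) K} (hf : Irreducible f) :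
    Irreducible (linearPullback M f) := by
  have hcomp : ∀ {A B : Matrix (Fin 3) (Fin 3) K}, A * B = 1 →
      (linearPullback B).comp (linearPullback A) = AlgHom.id K _ := fun {A B} h =>
    AlgHom.ext fun g => by
      rw [AlgHom.comp_apply, linearPullback_mul, h, linearPullback_one, AlgHom.id_apply]
  exact (MulEquiv.irreducible_iff
    (AlgEquiv.ofAlgHom (linearPullback M) (linearPullback N) (hcomp hNM) (hcomp hMN))).mpr hf

theorem RatFunc.finrank_adjoin_polynomial (g : Polynomial K) :
    Module.finrank K⟮algebraMap (Polynomial K) (RatFunc K) g⟯ (RatFunc K) = g.natDegree := by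
  rw [RatFunc.finrank_eq_max_natDegree, RatFunc.num_algebraMap, RatFunc.denom_algebraMap]
  simp

/-- The degree of `K(X)` over `E` divides both `q` and `q + 1`. -/
theorem adjoin_pair_ballicoHefez {q : ℕ} (hq : 2 ≤ q) {E : IntermediateField K (RatFunc K)}
    (h1 : (RatFunc.X : RatFunc K) ^ q + RatFunc.X ∈ E)
    (h2 : (RatFunc.X : RatFunc K) ^ (q + 1) ∈ E) : E = ⊤ := by
  have hdvd : ∀ g : Polynomial K, algebraMap (Polynomial K) (RatFunc K) g ∈ E →
      Module.finrank E (RatFunc K) ∣ g.natDegree := by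
    intro g hg
    rw [← RatFunc.finrank_adjoin_polynomial, ← relfinrank_top_right, ← relfinrank_top_right]
    exact relfinrank_dvd_of_le_left _ (adjoin_simple_le_iff.mpr hg)
  have h3 := hdvd (Polynomial.X ^ q + Polynomial.X) (by simpa using h1)
  have h4 := hdvd (Polynomial.X ^ (q + 1)) (by simpa using h2)
  rw [Polynomial.natDegree_X_pow] at h4
  rw [Polynomial.natDegree_add_eq_left_of_natDegree_lt
    (by rw [Polynomial.natDegree_X, Polynomial.natDegree_X_pow]; lia), Polynomial.natDegree_X_pow] at h3
  rw [← finrank_eq_one_iff_eq_top]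
  exact Nat.dvd_one.mp ((Nat.dvd_add_right h3).mp h4)

/-- Only the zero sets are known to agree, so divisibility by the irreducible `f` is obtained from
the Nullstellensatz. -/
theorem isGenericCurvePoint_ballicoHefezParam [IsAlgClosed K] {q : ℕ} (hq : 2 ≤ q)
    {f : MvPolynomial (Fin 3) K} (hf : Irreducible f)
    (h : ∀ v, eval v f = 0 ↔ eval v (ballicoHefezPoly K q) = 0) :
    IsGenericCurvePoint f (ballicoHefezParam q 1 (RatFunc.X : RatFunc K)) where
  aeval_eq_zero_iff n g hg := by
    constructor
    · intro hg0
      refine MvPolynomial.dvd_of_zeros_subset hf fun v hv => ?_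
      obtain ⟨a, b, rfl⟩ := (eval_ballicoHefezPoly_eq_zero_iff (by lia) v).mp ((h v).mp hv)
      exact eval_ballicoHefezParam_eq_zero hg RatFunc.transcendental_X hg0 a b
    · rintro ⟨k, rfl⟩
      have hpoly : aeval (ballicoHefezParam q 1 (Polynomial.X : Polynomial K)) f = 0 := by
        refine Polynomial.funext fun r => ?_
        have h1 : Polynomial.eval r (aeval (ballicoHefezParam q 1 (Polynomial.X : Polynomial K)) f) =
            aeval (fun i => Polynomial.eval r (ballicoHefezParam q 1 (Polynomial.X : Polynomial K) i)) f :=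
          comp_aeval_apply _ (Polynomial.aeval (R := K) r) f
        have h2 : (fun i => Polynomial.eval r (ballicoHefezParam q 1 (Polynomial.X : Polynomial K) i)) =
            ballicoHefezParam q 1 r := by
          funext i
          fin_cases i <;> simp [ballicoHefezParam]
        rw [h1, h2, Polynomial.eval_zero]
        exact (h _).mpr ((eval_ballicoHefezPoly_eq_zero_iff (by lia) _).mpr ⟨1, r, rfl⟩)
      have h3 := congrArg (Algebra.algHom K (Polynomial K) (RatFunc K)) hpoly
      rw [comp_aeval_apply, map_zero] at h3
      have h4 : (fun i => Algebra.algHom K (Polynomial K) (RatFunc K)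
          (ballicoHefezParam q 1 (Polynomial.X : Polynomial K) i)) =
            ballicoHefezParam q 1 (RatFunc.X : RatFunc K) := by
        funext i
        fin_cases i <;> simp [ballicoHefezParam, Algebra.algHom]
      rw [h4] at h3
      rw [map_mul, h3, zero_mul]
  adjoin_eq_top := by
    refine adjoin_pair_ballicoHefez hq ?_ ?_
    · refine subset_adjoin _ _ ⟨0, 2, ?_⟩
      simp [ballicoHefezParam, add_comm]
    · refine subset_adjoin _ _ ⟨1, 2, ?_⟩
      simp [ballicoHefezParam]

variable {F : Type*} [Field F] [Algebra F K]

theorem exists_mk_eq_standard {M N : Matrix (Fin 3) (Fin 3) K} (hMN : M * N = 1)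
    (P : ℙ K (Fin 3 → K)) : ∃ (v : Fin 3 → K) (hv : M *ᵥ v ≠ 0), P = Projectivization.mk K (M *ᵥ v) hv ∧
      (v = ![0, 1, 0] ∨ (∃ a, v = ![1, a, 0]) ∨ ∃ a b, v = ![a, b, 1]) := by
  have key : ∀ (c : K) (w : Fin 3 → K), c ≠ 0 → N *ᵥ P.rep = c • w →
      ∃ hv : M *ᵥ w ≠ 0, P = Projectivization.mk K (M *ᵥ w) hv := by
    intro c w hc hw
    have h1 : P.rep = c • (M *ᵥ w) := by
      rw [← mulVec_smul, ← hw, mulVec_mulVec, hMN, one_mulVec]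
    have h2 : M *ᵥ w ≠ 0 := by
      intro h
      rw [h, smul_zero] at h1
      exact P.rep_nonzero h1
    refine ⟨h2, ?_⟩
    rw [← P.mk_rep, Projectivization.mk_eq_mk_iff]
    exact ⟨Units.mk0 c hc, h1.symm⟩
  obtain ⟨c, hc, h | ⟨a, h⟩ | ⟨a, b, h⟩⟩ :=
    exists_smul_standard (mulVec_ne_zero_of_mul_eq_one hMN P.rep_nonzero)
  · obtain ⟨hv, hP⟩ := key c _ hc h
    exact ⟨_, hv, hP, Or.inl rfl⟩
  · obtain ⟨hv, hP⟩ := key c _ hc h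
    exact ⟨_, hv, hP, Or.inr (Or.inl ⟨a, rfl⟩)⟩
  · obtain ⟨hv, hP⟩ := key c _ hc h
    exact ⟨_, hv, hP, Or.inr (Or.inr ⟨a, b, rfl⟩)⟩

theorem GeomIrredPlaneCurve.smooth_and_galois_of_ballicoHefez_coordinates [Finite F] [IsAlgClosed K]
    (p e : ℕ) [Fact p.Prime] [CharP K p] (he : e ≠ 0) (hcard : Nat.card F = p ^ e) (hd : 4 ≤ d)
    (C : GeomIrredPlaneCurve F K d) (B : GL (Fin 3) F)
    (hB : ∀ v : Fin 3 → K, eval v (map (algebraMap F K) C.poly) = 0 ↔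
      eval ((B.1.map (algebraMap F K)) *ᵥ v) (ballicoHefezPoly K (p ^ e)) = 0) :
    C.smoothRationalPoints.Nonempty ∧ C.galoisPoints = rationalPlanePoints F K := by
  have hq : 2 ≤ p ^ e := Nat.one_lt_pow he (Fact.out : p.Prime).one_lt
  set M := B⁻¹.1.map (algebraMap F K) with hM
  set N := B.1.map (algebraMap F K) with hN
  have hMN : M * N = 1 := by
    rw [← Matrix.map_mul, ← Units.val_mul, inv_mul_cancel]
    exact Matrix.map_one _ (map_zero _) (map_one _)
  have hNM : N * M = 1 := by
    rw [← Matrix.map_mul, ← Units.val_mul, mul_inv_cancel]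
    exact Matrix.map_one _ (map_zero _) (map_one _)
  have hNMF : B.1 * B⁻¹.1 = 1 := by rw [← Units.val_mul, mul_inv_cancel]; rfl
  set g := linearPullback M (map (algebraMap F K) C.poly) with hg
  have hghom : g.IsHomogeneous d := isHomogeneous_linearPullback M (C.isHomogeneous.map _)
  have hzero : ∀ v, eval v g = 0 ↔ eval v (ballicoHefezPoly K (p ^ e)) = 0 := by
    intro v
    rw [hg, eval_linearPullback, hB, mulVec_mulVec, hNM, one_mulVec]
  have hμ := isGenericCurvePoint_ballicoHefezParam hq (irreducible_linearPullback hMN hNM C.irreducible)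
    hzero
  set μ := ballicoHefezParam (p ^ e) 1 (RatFunc.X : RatFunc K) with hμdef
  obtain ⟨k, hk⟩ := (hμ.aeval_eq_zero_iff _ _ (isHomogeneous_ballicoHefezPoly (p ^ e))).mp
    (aeval_ballicoHefezParam_one (p ^ e) _)
  -- The equation `g` of degree `d ≥ 4` divides the Ballico-Hefez form of degree `q + 1`.
  have hq3 : 3 ≤ p ^ e := by
    have h1 := (isHomogeneous_ballicoHefezPoly (p ^ e)).totalDegree (ballicoHefezPoly_ne_zero (K := K) hq)
    have h0 := ballicoHefezPoly_ne_zero (K := K) hq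
    rw [hk] at h1 h0
    rw [totalDegree_mul_of_isDomain (left_ne_zero_of_mul h0) (right_ne_zero_of_mul h0),
      hghom.totalDegree (left_ne_zero_of_mul h0)] at h1
    lia
  constructor
  · have he0 : eval ![0, 1, 0] g = 0 := by
      rw [hzero, eval_ballicoHefezPoly_infinity _ _ (by lia)]
      simp
    -- Differentiate the product `g * k` at a zero of `g`: the derivative of the form there is that
    -- of `g` times the value of `k`, so the derivative of `g` cannot vanish.
    have h2 := eval_pderiv_ballicoHefezPoly (K := K) hq
    rw [hk, Derivation.leibniz, smul_eq_mul, smul_eq_mul, map_add, map_mul, map_mul] at h2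
    have hMe : M *ᵥ ![0, 1, 0] = fun i => algebraMap F K ((B⁻¹.1 *ᵥ ![0, 1, 0]) i) := by
      funext i
      rw [RingHom.map_mulVec]
      congr 2
      funext j
      fin_cases j <;> simp
    have hv : B⁻¹.1 *ᵥ ![0, 1, 0] ≠ 0 :=
      mulVec_ne_zero_of_mul_eq_one hNMF fun h => by simpa using congrFun h 1
    refine ⟨Projectivization.mk F _ hv, (C.mk_mem_smoothRationalPoints_iff hv).mpr ⟨?_, ?_⟩⟩
    · rw [hg, eval_linearPullback, hMe, eval_algebraMap_map] at he0
      exact (_root_.map_eq_zero _).mp he0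
    · by_contra! hall
      have h3 : eval ![0, 1, 0] (pderiv 2 g) = 0 := by
        rw [hg, pderiv_linearPullback, map_sum]
        refine Finset.sum_eq_zero fun i _ => ?_
        rw [map_mul, eval_linearPullback, pderiv_map, hMe, eval_algebraMap_map, hall i, map_zero,
          mul_zero]
      rw [h3, he0] at h2
      simp at h2
  · have hcoord : μ = (N.map (algebraMap K (RatFunc K))) *ᵥ
        ((M.map (algebraMap K (RatFunc K))) *ᵥ μ) := by
      rw [mulVec_mulVec, ← Matrix.map_mul, hNM, Matrix.map_one _ (map_zero _) (map_one _), one_mulVec]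
    have hφ := hμ.linear_change hNM hMN hcoord
    rw [linearPullback_mul, hMN, linearPullback_one] at hφ
    have htop : K⟮(RatFunc.X : RatFunc K)⟯ = ⊤ := RatFunc.adjoin_X
    have hX : Transcendental K (RatFunc.X : RatFunc K) := RatFunc.transcendental_X
    have hμ2 : μ 2 = 1 := by simp [hμdef, ballicoHefezParam]
    have hx : μ 0 / μ 2 = RatFunc.X ^ p ^ e + RatFunc.X := by
      simp [hμdef, ballicoHefezParam, add_comm]
    have hy : μ 1 / μ 2 = RatFunc.X ^ (p ^ e + 1) := by simp [hμdef, ballicoHefezParam]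
    have hrange := mem_range_algebraMap_iff_pow_card (F := F) (K := K)
    rw [hcard] at hrange
    ext P
    obtain ⟨v, hv, rfl, rfl | ⟨a, rfl⟩ | ⟨a, b, rfl⟩⟩ := exists_mk_eq_standard hMN P
    · rw [C.isGalois_iff_vertical (by lia) hφ hNM rfl hv, mk_mem_rationalPlanePoints_iff hNMF hv, hx]
      exact iff_of_true (isGalois_adjoin_frobenius_add p e he htop) rational_vertical
    · rw [C.isGalois_iff_infinity (by lia) hφ hNM rfl a hv, mk_mem_rationalPlanePoints_iff hNMF hv,
        rational_infinity_iff, hrange]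
      exact isGalois_infinity_model_iff p e he hX htop one_ne_zero (γ := 0) (δ := 0)
        (by rw [hx]; simp) (by rw [hy]; simp) a
    · rw [C.isGalois_iff_affine (by lia) hφ hNM rfl (by simp [hμ2]) a b hv,
        mk_mem_rationalPlanePoints_iff hNMF hv, rational_affine_iff, hrange, hrange, hx, hy]
      refine ⟨fun h => ?_, fun h => isGalois_affine_point p e he hX htop h.1 h.2⟩
      by_contra hab
      exact not_isGalois_affine_point p e hq3 hX htop hab h

end FromBallicoHefez

theorem mainTheorem1 {F K : Type*} [Field F] [Finite F] [Field K] [Algebra F K]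
    [IsAlgClosure F K] {d : ℕ} (hd : 4 ≤ d) (C : GeomIrredPlaneCurve F K d)
    (hgenus : C.geometricGenus = 0 ∨ C.geometricGenus = 1) :
    (C.smoothRationalPoints.Nonempty ∧ C.galoisPoints = rationalPlanePoints F K) ↔
      ProjectivelyEquivalentOver F C.points (ballicoHefezPoints K (Nat.card F)) := by
  have := IsAlgClosure.isAlgClosed F (K := K)
  have := Fintype.ofFinite F
  obtain ⟨p, hp⟩ := CharP.exists F
  obtain ⟨e, hprime, hcard⟩ := FiniteField.card F p
  have : Fact p.Prime := ⟨hprime⟩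
  have : CharP K p := charP_of_injective_algebraMap (algebraMap F K).injective p
  rw [← Nat.card_eq_fintype_card] at hcard
  rw [hcard, projectivelyEquivalentOver_ballicoHefez_iff p e (by lia) C]
  constructor
  · rintro ⟨hsm, hΔ⟩
    obtain ⟨φ, hφ⟩ := C.exists_isGenericCurvePoint (by lia)
    rw [← hcard]
    refine C.exists_ballicoHefez_coordinates p hd hφ ?_ hsm hΔ
    rcases hgenus with h | h
    · exact h.trans_le zero_le_one
    · exact h.le
  · rintro ⟨B, hB⟩
    exact C.smooth_and_galois_of_ballicoHefez_coordinates p e e.ne_zero hcard hd B hB
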